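/- **Setting.** Let $d,p\ge 1$, $\Theta=[\theta_{inf},\theta_{sup}]^p$ and $\theta_0\in\Theta$ with $\theta_{inf}<(\theta_0)_i<\theta_{sup}$ for all $i$. Let $\{K_\theta,\theta\in\Theta\}$ be functions $\mathbb R^d\to\mathbb R$ such that: 1. every $K_\theta$ is a stationary covariance function; $\theta\mapsto K_\theta(t)$ is three times differentiable on $\Theta$ for every $t$; for all $q\in\{0,\dots,3\}$ and $i_1,\dots,i_q$ there is $C<\infty$ with $\left|\frac{\partial}{\partial\theta_{i_1}}\cdots\frac{\partial}{\partial\theta_{i_q}}K_\theta(t)\right|\le \frac{C}{1+|t|^{d+1}}$ for all $\theta\in\Theta$, $t\in\mathbb R^d$ ($|t|$ is the Euclidean norm); 2. with $\hat K_\theta(f)=(2\pi)^{-d}\int_{\mathbb R^d}K_\theta(t)e^{-\mathrm i f\cdot t}dt$, one has $K_\theta(t)=\int_{\mathbb R^d}\hat K_\theta(f)e^{\mathrm i f\cdot t}df$ for all $\theta\in\Theta$ and $t$ (with $\hat K_\theta$ integrable), and $(f,\theta)\mapsto\hat K_\theta(f)$ is real-valued, positive and continuous on $\mathbb R^d\times\Theta$;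 3. for all $\theta\in\Theta$ and $1\le i\le p$, $K_\theta(t)$ and $\frac{\partial}{\partial\theta_i}K_\theta(t)$ are three times differentiable in $t$ for $t\ne0$, and for all $T>0$, $\theta\in\Theta$, $1\le i\le p$, $k\in\{1,2,3\}$, $i_1,\dots,i_k\in\{1,\dots,d\}$ there is $C_T<\infty$ such that $\left|\frac{\partial}{\partial t_{i_1}}\cdots\frac{\partial}{\partial t_{i_k}}K_\theta(t)\right|\le\frac{C_T}{1+|t|^{d+1}}$ and $\left|\frac{\partial}{\partial t_{i_1}}\cdots\frac{\partial}{\partial t_{i_k}}\frac{\partial}{\partial\theta_i}K_\theta(t)\right|\le\frac{C_T}{1+|t|^{d+1}}$ for $|t|\ge T$. Let $(v_a)_{a\ge1}$ be a sequence in $\{1,2,\dots\}^d$ with $\{v_a:1\le a\le N^d\}=\{1,\dots,N\}^d$ for all $N\ge1$. Let $(X_a)_{a\ge1}$ be i.i.d. with a symmetric distribution with support $S_X\subset[-1,1]^d$ that has a probability density, positive on $S_X$. For $\epsilon\in[0,\frac12)$ and $n\ge1$ let $R$ and $D_i=\frac{\partial R}{\partial\theta_i}$ be the $n\times n$ random matrices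 with entries $R_{a,b}=K_{\theta_0}(v_a-v_b+\epsilon(X_a-X_b))$ and $(D_i)_{a,b}=\frac{\partial}{\partial\theta_i}K_{\theta_0}(v_a-v_b+\epsilon(X_a-X_b))$. Let $\mathrm{diag}(A)$ be $A$ with its off-diagonal entries set to $0$, let $A^t$ be the transpose of $A$, and put $$M_{ML}^{i,j}=\tfrac12R^{-1}D_iR^{-1}D_j,$$ $$M^i=R^{-1}\mathrm{diag}(R^{-1})^{-2}\left\{\mathrm{diag}(R^{-1}D_iR^{-1})\,\mathrm{diag}(R^{-1})^{-1}-R^{-1}D_i\right\}R^{-1},$$ $$M_{CV,1}^{i,j}=2\{M^i+(M^i)^t\}R\{M^j+(M^j)^t\}R,$$ $$M_{CV,2}^{i,j}=-8\,\mathrm{diag}(R^{-1})^{-3}\mathrm{diag}(R^{-1}D_iR^{-1})R^{-1}D_jR^{-1}+2\,\mathrm{diag}(R^{-1})^{-2}R^{-1}D_iR^{-1}D_jR^{-1}+6\,\mathrm{diag}(R^{-1})^{-4}\mathrm{diag}(R^{-1}D_iR^{-1})\mathrm{diag}(R^{-1}D_jR^{-1})R^{-1}.$$ **Proposition.** There are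 deterministic $p\times p$ matrices $\Sigma_{ML}$, $\Sigma_{CV,1}$, $\Sigma_{CV,2}$, functions of $\epsilon\in[0,\frac12)$, such that, for $(\Sigma,M)$ being $(\Sigma_{ML},M_{ML})$, $(\Sigma_{CV,1},M_{CV,1})$ or $(\Sigma_{CV,2},M_{CV,2})$ and for all $1\le i,j\le p$: * for every $\epsilon\in[0,\frac12)$, $\frac1n\mathrm{Tr}(M^{i,j})\to(\Sigma)_{i,j}$ almost surely as $n\to\infty$ (this determines $\Sigma$); * $(\Sigma)_{i,j}$ is $C^2$ in $\epsilon$ on $[0,\frac12)$; * almost surely, for every $n$, $\mathrm{Tr}(M^{i,j})$ is $C^2$ in $\epsilon$ on $[0,\frac12)$; for every $\epsilon\in[0,\frac12)$ its second derivative is integrable, and $$\frac{\partial^2}{\partial\epsilon^2}(\Sigma)_{i,j}=\lim_{n\to+\infty}\frac1n\,\mathbb E\left\{\frac{\partial^2}{\partial\epsilon^2}\mathrm{Tr}(M^{i,j})\right\}.$$ Derivatives in $\epsilon$ at $\epsilon=0$ are right derivatives. -/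

import Mathlib

open MeasureTheory ProbabilityTheory Filter Set
open scoped Topology Matrix ENNReal

noncomputable section

namespace PerturbedGrid

/-- `f` is `n` times (Frechet) differentiable on `s`: all derivatives of order `m < n`, taken
within `s`, are differentiable on `s`. -/
def TimesDifferentiableOn {F : Type*} [NormedAddCommGroup F] [NormedSpace ℝ F]
    (n : ℕ) (f : F → ℝ) (s : Set F) : Prop :=
  ∀ m < n, DifferentiableOn ℝ (fun x => iteratedFDerivWithin ℝ m f s x) s

/-- The parameter set `Θ = [a, b]^p`. -/
def paramBox (p : ℕ) (a b : ℝ) : Set (Fin p → ℝ) := {θ | ∀ i, a ≤ θ i ∧ θ i ≤ b}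

/-- The iterated partial derivative `∂/∂θ_{I 0} ⋯ ∂/∂θ_{I (q-1)} K_θ(t)`
(one-sided at the boundary of `Θ`). -/
def thetaPartial {p d : ℕ} (Θ : Set (Fin p → ℝ))
    (K : (Fin p → ℝ) → EuclideanSpace ℝ (Fin d) → ℝ) {q : ℕ} (I : Fin q → Fin p)
    (θ : Fin p → ℝ) (t : EuclideanSpace ℝ (Fin d)) : ℝ :=
  iteratedFDerivWithin ℝ q (fun θ' => K θ' t) Θ θ (fun l => Pi.single (I l) 1)

/-- The first partial derivative `∂/∂θ_i K_θ(t)`. -/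
def thetaPartial₁ {p d : ℕ} (Θ : Set (Fin p → ℝ))
    (K : (Fin p → ℝ) → EuclideanSpace ℝ (Fin d) → ℝ) (i : Fin p)
    (θ : Fin p → ℝ) (t : EuclideanSpace ℝ (Fin d)) : ℝ :=
  thetaPartial Θ K (fun _ : Fin 1 => i) θ t

/-- The iterated partial derivative `∂/∂t_{J 0} ⋯ ∂/∂t_{J (k-1)} h(t)`, for `t ≠ 0`. -/
def spacePartial {d : ℕ} (h : EuclideanSpace ℝ (Fin d) → ℝ) {k : ℕ} (J : Fin k → Fin d)
    (t : EuclideanSpace ℝ (Fin d)) : ℝ :=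
  iteratedFDerivWithin ℝ k h {0}ᶜ t (fun l => EuclideanSpace.single (J l) 1)

/-- `k` is a stationary covariance function: `(s, t) ↦ k (s - t)` is symmetric and
positive semidefinite. -/
def IsStationaryCovariance {d : ℕ} (k : EuclideanSpace ℝ (Fin d) → ℝ) : Prop :=
  (∀ t, k (-t) = k t) ∧
  ∀ (n : ℕ) (t : Fin n → EuclideanSpace ℝ (Fin d)) (c : Fin n → ℝ),
    0 ≤ ∑ a, ∑ b, c a * c b * k (t a - t b)

/-- The Fourier transform `ĥ(f) = (2π)^{-d} ∫ h(t) e^{-i f·t} dt`. -/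
def fourierHat {d : ℕ} (h : EuclideanSpace ℝ (Fin d) → ℝ) (f : EuclideanSpace ℝ (Fin d)) : ℂ :=
  (1 / (2 * (Real.pi : ℂ)) ^ d) *
    ∫ t : EuclideanSpace ℝ (Fin d),
      (h t : ℂ) * Complex.exp (-(Complex.I * ((inner ℝ f t : ℝ) : ℂ)))

/-- The basic regularity condition on the parametric family `K_θ`, `θ ∈ Θ`. -/
structure CovarianceCondition {p d : ℕ} (Θ : Set (Fin p → ℝ))
    (K : (Fin p → ℝ) → EuclideanSpace ℝ (Fin d) → ℝ) : Prop where
  stationary : ∀ θ ∈ Θ, IsStationaryCovariance (K θ)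
  differentiable : ∀ t, TimesDifferentiableOn 3 (fun θ => K θ t) Θ
  bound : ∀ q ≤ 3, ∀ I : Fin q → Fin p, ∃ C : ℝ, ∀ θ ∈ Θ, ∀ t,
    |thetaPartial Θ K I θ t| ≤ C / (1 + ‖t‖ ^ (d + 1))
  fourier_integrable : ∀ θ ∈ Θ, Integrable (fourierHat (K θ))
  fourier_inversion : ∀ θ ∈ Θ, ∀ t,
    (K θ t : ℂ) = ∫ f : EuclideanSpace ℝ (Fin d),
      fourierHat (K θ) f * Complex.exp (Complex.I * ((inner ℝ f t : ℝ) : ℂ))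
  fourier_real : ∀ θ ∈ Θ, ∀ f, (fourierHat (K θ) f).im = 0
  fourier_pos : ∀ θ ∈ Θ, ∀ f, 0 < (fourierHat (K θ) f).re
  fourier_continuous : ContinuousOn
    (fun z : EuclideanSpace ℝ (Fin d) × (Fin p → ℝ) => fourierHat (K z.2) z.1) (univ ×ˢ Θ)

/-- The strengthened condition: in addition, `K_θ` and `∂K_θ/∂θ_i` are three times differentiable
in `t ≠ 0`, and their `t`-derivatives of order 1, 2, 3 decay like `|t|^{-(d+1)}` away from `0`. -/
structure SmoothCovarianceCondition {p d : ℕ} (Θ : Set (Fin p → ℝ))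
    (K : (Fin p → ℝ) → EuclideanSpace ℝ (Fin d) → ℝ) : Prop
    extends CovarianceCondition Θ K where
  differentiable_space : ∀ θ ∈ Θ, TimesDifferentiableOn 3 (K θ) {0}ᶜ
  differentiable_space_theta : ∀ θ ∈ Θ, ∀ i,
    TimesDifferentiableOn 3 (thetaPartial₁ Θ K i θ) {0}ᶜ
  bound_space : ∀ T > (0 : ℝ), ∀ θ ∈ Θ, ∀ k ∈ Finset.Icc 1 3, ∀ J : Fin k → Fin d,
    ∃ C : ℝ, ∀ t, T ≤ ‖t‖ → |spacePartial (K θ) J t| ≤ C / (1 + ‖t‖ ^ (d + 1))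
  bound_space_theta : ∀ T > (0 : ℝ), ∀ θ ∈ Θ, ∀ i, ∀ k ∈ Finset.Icc 1 3, ∀ J : Fin k → Fin d,
    ∃ C : ℝ, ∀ t, T ≤ ‖t‖ →
      |spacePartial (thetaPartial₁ Θ K i θ) J t| ≤ C / (1 + ‖t‖ ^ (d + 1))

/-- `v 0, v 1, …` runs through the points of `{1, 2, …}^d` in such a way that the first `N^d` of
them are the points of `{1, …, N}^d`. -/
def IsGridEnumeration {d : ℕ} (v : ℕ → Fin d → ℕ) : Prop :=
  ∀ N : ℕ, 0 < N → v '' {i | i < N ^ d} = {w | ∀ k, 1 ≤ w k ∧ w k ≤ N}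

/-- The law of one perturbation: a symmetric probability distribution whose support is contained
in `[-1,1]^d`, with a probability density that is positive on the support. -/
structure IsPerturbationLaw {d : ℕ} (μ : Measure (EuclideanSpace ℝ (Fin d))) : Prop where
  isProbability : IsProbabilityMeasure μ
  symmetric : μ.map (fun x => -x) = μ
  support_subset : μ.support ⊆ {x | ∀ k, |x k| ≤ 1}
  density : ∃ g : EuclideanSpace ℝ (Fin d) → ℝ≥0∞, Measurable g ∧
    μ = volume.withDensity g ∧ ∀ x ∈ μ.support, 0 < g x

/-- The `a`-th observation point `v_a + ε x_a`. -/
def obsPoint {d : ℕ} (v : ℕ → Fin d → ℕ) (x : ℕ → EuclideanSpace ℝ (Fin d)) (ε : ℝ) (a : ℕ) :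
    EuclideanSpace ℝ (Fin d) :=
  WithLp.toLp 2 (fun k => (v a k : ℝ)) + ε • x a

/-- The `n × n` matrix with entries `k((v_a - v_b) + ε (x_a - x_b))`. For `k = K_θ` it is `R_θ`,
and for `k = ∂K_θ/∂θ_i` it is `∂R_θ/∂θ_i`. -/
def gridMatrix {d : ℕ} (k : EuclideanSpace ℝ (Fin d) → ℝ) (v : ℕ → Fin d → ℕ)
    (x : ℕ → EuclideanSpace ℝ (Fin d)) (ε : ℝ) (n : ℕ) : Matrix (Fin n) (Fin n) ℝ :=
  Matrix.of fun a b => k (obsPoint v x ε a - obsPoint v x ε b)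

/-- `diag(A)`: the matrix `A` with all off-diagonal elements set to `0`. -/
def dg {n : ℕ} (A : Matrix (Fin n) (Fin n) ℝ) : Matrix (Fin n) (Fin n) ℝ :=
  Matrix.diagonal fun a => A a a

/-- `M_ML^{i,j}` in terms of `R`, `Di = ∂R/∂θ_i` and `Dj = ∂R/∂θ_j`. -/
def matML {n : ℕ} (R Di Dj : Matrix (Fin n) (Fin n) ℝ) : Matrix (Fin n) (Fin n) ℝ :=
  (1 / 2 : ℝ) • (R⁻¹ * Di * R⁻¹ * Dj)

/-- The matrix `M^i` of the gradient of the cross validation criterion. -/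
def matGradCV {n : ℕ} (R Di : Matrix (Fin n) (Fin n) ℝ) : Matrix (Fin n) (Fin n) ℝ :=
  R⁻¹ * (dg R⁻¹)⁻¹ ^ 2 * (dg (R⁻¹ * Di * R⁻¹) * (dg R⁻¹)⁻¹ - R⁻¹ * Di) * R⁻¹

/-- `M_{CV,1}^{i,j}`. -/
def matCV1 {n : ℕ} (R Di Dj : Matrix (Fin n) (Fin n) ℝ) : Matrix (Fin n) (Fin n) ℝ :=
  (2 : ℝ) • ((matGradCV R Di + (matGradCV R Di)ᵀ) * R *
    (matGradCV R Dj + (matGradCV R Dj)ᵀ) * R)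

/-- `M_{CV,2}^{i,j}`. -/
def matCV2 {n : ℕ} (R Di Dj : Matrix (Fin n) (Fin n) ℝ) : Matrix (Fin n) (Fin n) ℝ :=
  (-8 : ℝ) • ((dg R⁻¹)⁻¹ ^ 3 * dg (R⁻¹ * Di * R⁻¹) * R⁻¹ * Dj * R⁻¹)
  + (2 : ℝ) • ((dg R⁻¹)⁻¹ ^ 2 * R⁻¹ * Di * R⁻¹ * Dj * R⁻¹)
  + (6 : ℝ) • ((dg R⁻¹)⁻¹ ^ 4 * dg (R⁻¹ * Di * R⁻¹) * dg (R⁻¹ * Dj * R⁻¹) * R⁻¹)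

/-- `Tr(M^{i,j})` at the parameter `θ₀`, for the `n` first observation points, where `M` is one of
`matML`, `matCV1`, `matCV2`. -/
def traceAt {p d : ℕ}
    (M : ∀ {n : ℕ}, Matrix (Fin n) (Fin n) ℝ → Matrix (Fin n) (Fin n) ℝ →
      Matrix (Fin n) (Fin n) ℝ → Matrix (Fin n) (Fin n) ℝ)
    (Θ : Set (Fin p → ℝ)) (K : (Fin p → ℝ) → EuclideanSpace ℝ (Fin d) → ℝ) (θ₀ : Fin p → ℝ)
    (v : ℕ → Fin d → ℕ) (i j : Fin p) (x : ℕ → EuclideanSpace ℝ (Fin d)) (n : ℕ) (ε : ℝ) : ℝ :=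
  (M (gridMatrix (K θ₀) v x ε n)
    (gridMatrix (thetaPartial₁ Θ K i θ₀) v x ε n)
    (gridMatrix (thetaPartial₁ Θ K j θ₀) v x ε n)).trace

/-- `S(ε)` is, for every `ε ∈ [0, 1/2)`, the almost sure limit of `(1/n) T_n(ε)` as `n → ∞`. -/
def IsAlmostSureLimit {Ω : Type*} [MeasurableSpace Ω] (P : Measure Ω)
    (T : Ω → ℕ → ℝ → ℝ) (S : ℝ → ℝ) : Prop :=
  ∀ ε ∈ Ico (0 : ℝ) (1 / 2), ∀ᵐ ω ∂P,
    Tendsto (fun n : ℕ => (1 / (n : ℝ)) * T ω n ε) atTop (𝓝 (S ε))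

/-- `S` is `C²` on `[0, 1/2)`, and for every `ε` in this interval
`∂²S/∂ε² = lim_n (1/n) E{∂²T_n/∂ε²}`, where it is part of the claim that `T_n` is almost surely
`C²` in `ε` and that the expectation exists. Derivatives at `ε = 0` are taken
within `[0, 1/2)`. -/
def SecondDerivativeExchange {Ω : Type*} [MeasurableSpace Ω] (P : Measure Ω)
    (T : Ω → ℕ → ℝ → ℝ) (S : ℝ → ℝ) : Prop :=
  ContDiffOn ℝ 2 S (Ico 0 (1 / 2)) ∧
  (∀ᵐ ω ∂P, ∀ n : ℕ, ContDiffOn ℝ 2 (T ω n) (Ico 0 (1 / 2))) ∧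
  ∀ ε ∈ Ico (0 : ℝ) (1 / 2),
    (∀ n : ℕ, Integrable (fun ω => iteratedDerivWithin 2 (T ω n) (Ico 0 (1 / 2)) ε) P) ∧
    Tendsto
      (fun n : ℕ => (1 / (n : ℝ)) * ∫ ω, iteratedDerivWithin 2 (T ω n) (Ico 0 (1 / 2)) ε ∂P)
      atTop (𝓝 (iteratedDerivWithin 2 S (Ico 0 (1 / 2)) ε))

end PerturbedGrid

end

/-!
The three matrices are noncommutative expressions in `R`, the `D_i`, `R⁻¹` and `diag(R⁻¹)⁻¹`, and
one argument serves all such expressions. For `ε ≤ β < 1/2` the points stay a positive distance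
apart. A continuous positive spectral density dominates a multiple of a difference of two
concentrated Gaussians, whose kernel is so peaked that its matrix is close to half the identity;
hence `R` is coercive, uniformly over all finite sets of points. Together with the decay of the
kernels this bounds the normalized trace and its first three derivatives in `ε`, uniformly in `n`
and in the perturbations.

For the almost sure limit, cut the grid into cubes of side `N` and erase the entries of `R` and
`D_i` between different cubes. This moves the trace by at most a multiple of the total weight of the
erased pairs, which is `o(1)` per point as `N → ∞`; and the trace becomes a sum over the cubes of
independent, identically distributed terms, to which the strong law of large numbers applies. Thus
the normalized traces are eventually within `o(1)` of constants depending on `N` only, so they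
converge almost surely to the limit of these constants.

Finally, functions that converge pointwise and whose derivatives up to order three are uniformly
bounded converge with their first two derivatives. Applied to the expectations of the normalized
traces, this is the exchange of limit and derivatives.
-/

namespace PerturbedGrid

noncomputable section

open scoped Matrix.Norms.L2Operator

/-! ### Uniformly bounded families and jets -/

section Families

/-- A family of functions that is bounded on `s` by one constant. The codomain may depend on the
member of the family, so that matrices of all sizes can be treated together. -/
def UniformlyBoundedOn {T S : Type*} {E : T → Type*} [∀ τ, Norm (E τ)] (s : Set S)
    (A : ∀ τ, S → E τ) : Prop :=
  ∃ C : ℝ, ∀ τ, ∀ x ∈ s, ‖A τ x‖ ≤ C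

/-- A family of functions of a real variable whose derivatives of order at most `k` within `s`
exist and are bounded on `s`, uniformly over the family. -/
def UniformlyBoundedJetOn {T : Type*} {E : T → Type*} [∀ τ, NormedAddCommGroup (E τ)]
    [∀ τ, NormedSpace ℝ (E τ)] (s : Set ℝ) : ℕ → (∀ τ, ℝ → E τ) → Prop
  | 0, A => UniformlyBoundedOn s A
  | k + 1, A => UniformlyBoundedOn s A ∧ ∃ A' : ∀ τ, ℝ → E τ,
      (∀ τ, ∀ x ∈ s, HasDerivWithinAt (A τ) (A' τ x) s x) ∧ UniformlyBoundedJetOn s k A'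

variable {T S : Type*} {E : T → Type*}

theorem UniformlyBoundedOn.exists_nonneg [∀ τ, Norm (E τ)] {s : Set S} {A : ∀ τ, S → E τ}
    (hA : UniformlyBoundedOn s A) : ∃ C : ℝ, 0 ≤ C ∧ ∀ τ, ∀ x ∈ s, ‖A τ x‖ ≤ C :=
  let ⟨C, hC⟩ := hA
  ⟨|C|, abs_nonneg C, fun τ x hx => (hC τ x hx).trans (le_abs_self C)⟩

section NormedSpace

variable [∀ τ, NormedAddCommGroup (E τ)]

theorem UniformlyBoundedOn.add {s : Set S} {A B : ∀ τ, S → E τ} (hA : UniformlyBoundedOn s A)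
    (hB : UniformlyBoundedOn s B) : UniformlyBoundedOn s (fun τ x => A τ x + B τ x) :=
  let ⟨C, hC⟩ := hA
  let ⟨D, hD⟩ := hB
  ⟨C + D, fun τ x hx => norm_add_le_of_le (hC τ x hx) (hD τ x hx)⟩

variable {E' : T → Type*} [∀ τ, NormedSpace ℝ (E τ)] [∀ τ, NormedAddCommGroup (E' τ)]
  [∀ τ, NormedSpace ℝ (E' τ)]

theorem UniformlyBoundedOn.map {s : Set S} {A : ∀ τ, S → E τ} (hA : UniformlyBoundedOn s A)
    {c : ℝ} (L : ∀ τ, E τ →ₗ[ℝ] E' τ) (hL : ∀ τ x, ‖L τ x‖ ≤ c * ‖x‖) :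
    UniformlyBoundedOn s (fun τ x => L τ (A τ x)) := by
  obtain ⟨C, hC⟩ := hA
  refine ⟨|c| * C, fun τ x hx => ?_⟩
  calc ‖L τ (A τ x)‖ ≤ c * ‖A τ x‖ := hL τ _
    _ ≤ |c| * ‖A τ x‖ := by gcongr; exact le_abs_self c
    _ ≤ |c| * C := by gcongr; exact hC τ x hx

namespace UniformlyBoundedJetOn

variable {s : Set ℝ} {k : ℕ} {A B : ∀ τ, ℝ → E τ}

theorem uniformlyBoundedOn (hA : UniformlyBoundedJetOn s k A) : UniformlyBoundedOn s A := by
  cases k with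
  | zero => exact hA
  | succ k => exact hA.1

theorem of_succ (hA : UniformlyBoundedJetOn s (k + 1) A) : UniformlyBoundedJetOn s k A := by
  induction k generalizing A with
  | zero => exact hA.1
  | succ k ih =>
    obtain ⟨hbdd, A', hderiv, hA'⟩ := hA
    exact ⟨hbdd, A', hderiv, ih hA'⟩

theorem of_le {n : ℕ} (hA : UniformlyBoundedJetOn s n A) (hkn : k ≤ n) :
    UniformlyBoundedJetOn s k A := by
  induction hkn with
  | refl => exact hA
  | step _ ih => exact ih hA.of_succ

theorem add (hA : UniformlyBoundedJetOn s k A) (hB : UniformlyBoundedJetOn s k B) :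
    UniformlyBoundedJetOn s k (fun τ x => A τ x + B τ x) := by
  induction k generalizing A B with
  | zero => exact UniformlyBoundedOn.add hA hB
  | succ k ih =>
    obtain ⟨hAbdd, A', hAderiv, hA'⟩ := hA
    obtain ⟨hBbdd, B', hBderiv, hB'⟩ := hB
    exact ⟨hAbdd.add hBbdd, _, fun τ x hx => (hAderiv τ x hx).add (hBderiv τ x hx), ih hA' hB'⟩

theorem map (hA : UniformlyBoundedJetOn s k A) {c : ℝ} (L : ∀ τ, E τ →ₗ[ℝ] E' τ)
    (hL : ∀ τ x, ‖L τ x‖ ≤ c * ‖x‖) : UniformlyBoundedJetOn s k (fun τ x => L τ (A τ x)) := by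
  induction k generalizing A with
  | zero => exact UniformlyBoundedOn.map hA L hL
  | succ k ih =>
    obtain ⟨hbdd, A', hderiv, hA'⟩ := hA
    exact ⟨hbdd.map L hL, _, fun τ x hx => ((L τ).mkContinuous c
      (hL τ)).hasFDerivAt.comp_hasDerivWithinAt x (hderiv τ x hx), ih hA'⟩

theorem reindex (hA : UniformlyBoundedJetOn s k A) {T' : Type*} (g : T' → T) :
    UniformlyBoundedJetOn s k (fun τ => A (g τ)) := by
  induction k generalizing A with
  | zero => exact hA.imp fun C hC τ => hC (g τ)
  | succ k ih =>
    obtain ⟨hbdd, A', hderiv, hA'⟩ := hA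
    exact ⟨hbdd.imp fun C hC τ => hC (g τ), _, fun τ => hderiv (g τ), ih hA'⟩

end UniformlyBoundedJetOn

end NormedSpace

section NormedRing

variable [∀ τ, NormedRing (E τ)]

theorem UniformlyBoundedOn.mul {s : Set S} {A B : ∀ τ, S → E τ} (hA : UniformlyBoundedOn s A)
    (hB : UniformlyBoundedOn s B) : UniformlyBoundedOn s (fun τ x => A τ x * B τ x) :=
  let ⟨C, hC⟩ := hA
  let ⟨D, hD⟩ := hB
  ⟨C * D, fun τ x hx => norm_mul_le_of_le (hC τ x hx) (hD τ x hx)⟩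

namespace UniformlyBoundedJetOn

variable [∀ τ, NormedAlgebra ℝ (E τ)] {s : Set ℝ} {k : ℕ} {A B : ∀ τ, ℝ → E τ}

theorem mul (hA : UniformlyBoundedJetOn s k A) (hB : UniformlyBoundedJetOn s k B) :
    UniformlyBoundedJetOn s k (fun τ x => A τ x * B τ x) := by
  induction k generalizing A B with
  | zero => exact UniformlyBoundedOn.mul hA hB
  | succ k ih =>
    have hAk := hA.of_succ
    have hBk := hB.of_succ
    obtain ⟨hAbdd, A', hAderiv, hA'⟩ := hA
    obtain ⟨hBbdd, B', hBderiv, hB'⟩ := hB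
    exact ⟨hAbdd.mul hBbdd, _, fun τ x hx => (hAderiv τ x hx).mul (hBderiv τ x hx),
      (ih hA' hBk).add (ih hAk hB')⟩

theorem ringInverse [∀ τ, CompleteSpace (E τ)] (hA : UniformlyBoundedJetOn s k A)
    (hunit : ∀ τ, ∀ x ∈ s, IsUnit (A τ x))
    (hbdd : UniformlyBoundedOn s (fun τ x => Ring.inverse (A τ x))) :
    UniformlyBoundedJetOn s k (fun τ x => Ring.inverse (A τ x)) := by
  induction k with
  | zero => exact hbdd
  | succ k ih =>
    have hinv := ih hA.of_succ
    obtain ⟨-, A', hderiv, hA'⟩ := hA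
    have hneg := ((hinv.mul hA').mul hinv).map (c := 1) (fun _ => -LinearMap.id) (by simp)
    refine ⟨hbdd, fun τ x => -(Ring.inverse (A τ x) * A' τ x * Ring.inverse (A τ x)),
      fun τ x hx => ?_, hneg⟩
    obtain ⟨u, hu⟩ := hunit τ x hx
    have h := (hu ▸ hasFDerivAt_ringInverse (𝕜 := ℝ) u).comp_hasDerivWithinAt x (hderiv τ x hx)
    exact h.congr_deriv (by simp [← hu])

end UniformlyBoundedJetOn

end NormedRing

end Families

/-! ### The operator norm of matrices -/

section MatrixNorm

variable {𝕜 m ι : Type*} [RCLike 𝕜] [Fintype m] [Fintype ι] [DecidableEq ι]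

theorem norm_le_of_norm_mulVec_le (A : Matrix m ι 𝕜) {c : ℝ} (hc : 0 ≤ c)
    (h : ∀ x : ι → 𝕜, ‖WithLp.toLp 2 (A *ᵥ x)‖ ≤ c * ‖WithLp.toLp 2 x‖) : ‖A‖ ≤ c := by
  rw [Matrix.l2_opNorm_def]
  exact ContinuousLinearMap.opNorm_le_bound _ hc fun x => h x.ofLp

theorem norm_apply_le_norm (A : Matrix m ι 𝕜) (a : m) (b : ι) : ‖A a b‖ ≤ ‖A‖ := by
  have h := (PiLp.norm_apply_le _ a).trans (Matrix.l2_opNorm_mulVec A (EuclideanSpace.single b 1))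
  simpa using h

theorem norm_diagonal_diag_le (A : Matrix ι ι 𝕜) : ‖Matrix.diagonal A.diag‖ ≤ ‖A‖ := by
  rw [Matrix.l2_opNorm_diagonal]
  exact (pi_norm_le_iff_of_nonneg (norm_nonneg _)).2 fun a => norm_apply_le_norm A a a

theorem norm_trace_le (A : Matrix ι ι 𝕜) : ‖A.trace‖ ≤ Fintype.card ι * ‖A‖ :=
  calc ‖A.trace‖ ≤ ∑ a, ‖A a a‖ := norm_sum_le _ _
    _ ≤ ∑ _ : ι, ‖A‖ := Finset.sum_le_sum fun a _ => norm_apply_le_norm A a a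
    _ = Fintype.card ι * ‖A‖ := by simp

theorem norm_one_le : ‖(1 : Matrix ι ι 𝕜)‖ ≤ 1 :=
  norm_le_of_norm_mulVec_le _ zero_le_one fun x => by simp

theorem norm_transpose [DecidableEq m] (A : Matrix m ι ℝ) : ‖Aᵀ‖ = ‖A‖ := by
  rw [← Matrix.conjTranspose_eq_transpose_of_trivial, Matrix.l2_opNorm_conjTranspose]

-- Schur's test: Cauchy-Schwarz with respect to the weights `‖A a b‖`.
theorem norm_le_of_sum_norm_le {A : Matrix m ι 𝕜} {s : ℝ} (hs : 0 ≤ s)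
    (hrow : ∀ a, ∑ b, ‖A a b‖ ≤ s) (hcol : ∀ b, ∑ a, ‖A a b‖ ≤ s) : ‖A‖ ≤ s := by
  refine norm_le_of_norm_mulVec_le _ hs fun x => le_of_sq_le_sq ?_ (by positivity)
  rw [mul_pow, EuclideanSpace.norm_sq_eq, EuclideanSpace.norm_sq_eq]
  have hmulVec (a : m) : ‖(A *ᵥ x) a‖ ^ 2 ≤ s * ∑ b, ‖A a b‖ * ‖x b‖ ^ 2 :=
    calc ‖(A *ᵥ x) a‖ ^ 2 ≤ (∑ b, ‖A a b * x b‖) ^ 2 := by gcongr; exact norm_sum_le _ _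
      _ ≤ (∑ b, ‖A a b‖) * ∑ b, ‖A a b‖ * ‖x b‖ ^ 2 :=
        Finset.sum_sq_le_sum_mul_sum_of_sq_le_mul _ (fun _ _ => norm_nonneg _)
          (fun _ _ => by positivity) (fun b _ => le_of_eq (by rw [norm_mul]; ring))
      _ ≤ s * ∑ b, ‖A a b‖ * ‖x b‖ ^ 2 := by gcongr; exact hrow a
  calc ∑ a, ‖(A *ᵥ x) a‖ ^ 2 ≤ ∑ a, s * ∑ b, ‖A a b‖ * ‖x b‖ ^ 2 :=
        Finset.sum_le_sum fun a _ => hmulVec a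
    _ = s * ∑ b, (∑ a, ‖A a b‖) * ‖x b‖ ^ 2 := by
      simp only [← Finset.mul_sum, Finset.sum_mul]
      rw [Finset.sum_comm]
    _ ≤ s * ∑ b, s * ‖x b‖ ^ 2 := by gcongr with b; exact hcol b
    _ = s ^ 2 * ∑ b, ‖x b‖ ^ 2 := by rw [← Finset.mul_sum]; ring

end MatrixNorm

/-! ### Coercive matrices -/

section Coercive

variable {ι : Type*} [Fintype ι]

/-- The quadratic form of the (possibly nonsymmetric) matrix `R` is bounded below by `c` times the
squared Euclidean norm. -/
def Coercive (c : ℝ) (R : Matrix ι ι ℝ) : Prop :=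
  ∀ x : ι → ℝ, c * (x ⬝ᵥ x) ≤ x ⬝ᵥ (R *ᵥ x)

theorem norm_toLp_sq (x : ι → ℝ) : ‖WithLp.toLp 2 x‖ ^ 2 = x ⬝ᵥ x := by
  rw [EuclideanSpace.real_norm_sq_eq]
  simp [dotProduct, pow_two]

theorem abs_dotProduct_mulVec_le [DecidableEq ι] (A : Matrix ι ι ℝ) (x : ι → ℝ) :
    |x ⬝ᵥ (A *ᵥ x)| ≤ ‖A‖ * (x ⬝ᵥ x) :=
  calc |x ⬝ᵥ (A *ᵥ x)| ≤ ‖WithLp.toLp 2 (A *ᵥ x)‖ * ‖WithLp.toLp 2 x‖ := by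
        simpa [EuclideanSpace.inner_toLp_toLp] using
          abs_real_inner_le_norm (WithLp.toLp 2 (A *ᵥ x)) (WithLp.toLp 2 x)
    _ ≤ ‖A‖ * ‖WithLp.toLp 2 x‖ * ‖WithLp.toLp 2 x‖ := by
        gcongr
        exact Matrix.l2_opNorm_mulVec A (WithLp.toLp 2 x)
    _ = ‖A‖ * (x ⬝ᵥ x) := by rw [mul_assoc, ← pow_two, norm_toLp_sq]

namespace Coercive

variable {c : ℝ} {R : Matrix ι ι ℝ}

theorem mul_norm_le_norm_mulVec (hR : Coercive c R) (x : ι → ℝ) :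
    c * ‖WithLp.toLp 2 x‖ ≤ ‖WithLp.toLp 2 (R *ᵥ x)‖ := by
  have hcauchy : x ⬝ᵥ (R *ᵥ x) ≤ ‖WithLp.toLp 2 (R *ᵥ x)‖ * ‖WithLp.toLp 2 x‖ := by
    simpa [EuclideanSpace.inner_toLp_toLp] using
      real_inner_le_norm (WithLp.toLp 2 (R *ᵥ x)) (WithLp.toLp 2 x)
  have hquad := (hR x).trans hcauchy
  rw [← norm_toLp_sq, pow_two, ← mul_assoc] at hquad
  rcases (norm_nonneg (WithLp.toLp 2 x)).eq_or_lt with h0 | hpos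
  · simp [← h0]
  · exact le_of_mul_le_mul_right hquad hpos

variable [DecidableEq ι]

theorem of_norm_sub_smul_one_le {s r : ℝ} (h : ‖R - s • (1 : Matrix ι ι ℝ)‖ ≤ r) :
    Coercive (s - r) R := fun x => by
  have hxx : 0 ≤ x ⬝ᵥ x := by rw [← norm_toLp_sq]; positivity
  have hsplit : x ⬝ᵥ ((R - s • (1 : Matrix ι ι ℝ)) *ᵥ x) = x ⬝ᵥ (R *ᵥ x) - s * (x ⬝ᵥ x) := by
    rw [Matrix.sub_mulVec, dotProduct_sub, Matrix.smul_mulVec, Matrix.one_mulVec,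
      dotProduct_smul, smul_eq_mul]
  have hquad := (abs_dotProduct_mulVec_le (R - s • (1 : Matrix ι ι ℝ)) x).trans
    (mul_le_mul_of_nonneg_right h hxx)
  rw [hsplit] at hquad
  linarith [neg_le_of_abs_le hquad]

theorem isUnit_det (hR : Coercive c R) (hc : 0 < c) : IsUnit R.det := by
  rw [← Matrix.isUnit_iff_isUnit_det, ← Matrix.mulVec_injective_iff_isUnit]
  refine (injective_iff_map_eq_zero (Matrix.mulVecLin R)).2 fun x hx => ?_
  have h : c * ‖WithLp.toLp 2 x‖ ≤ 0 := by
    simpa [show R *ᵥ x = 0 from hx] using hR.mul_norm_le_norm_mulVec x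
  simpa using norm_le_zero_iff.1 (nonpos_of_mul_nonpos_right h hc)

theorem norm_inv_le (hR : Coercive c R) (hc : 0 < c) : ‖R⁻¹‖ ≤ c⁻¹ := by
  refine norm_le_of_norm_mulVec_le _ (by positivity) fun x => ?_
  have h := hR.mul_norm_le_norm_mulVec (R⁻¹ *ᵥ x)
  rw [Matrix.mulVec_mulVec, Matrix.mul_nonsing_inv _ (hR.isUnit_det hc), Matrix.one_mulVec] at h
  rwa [inv_mul_eq_div, le_div_iff₀' hc]

-- With `y = R⁻¹ e_a`, the diagonal entry is `y ⬝ᵥ R y ≥ c ‖y‖²`, while `1 = ‖R y‖ ≤ C ‖y‖`.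
theorem le_inv_apply_self (hR : Coercive c R) (hc : 0 < c) {C : ℝ} (hC : ‖R‖ ≤ C) (a : ι) :
    c / C ^ 2 ≤ R⁻¹ a a := by
  set y : ι → ℝ := R⁻¹ *ᵥ Pi.single a 1 with hy
  have hRy : R *ᵥ y = Pi.single a 1 := by
    rw [hy, Matrix.mulVec_mulVec, Matrix.mul_nonsing_inv _ (hR.isUnit_det hc), Matrix.one_mulVec]
  have hdiag : R⁻¹ a a = y ⬝ᵥ (R *ᵥ y) := by rw [hRy, hy]; simp
  have hone : 1 ≤ C * ‖WithLp.toLp 2 y‖ :=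
    calc (1 : ℝ) = ‖WithLp.toLp 2 (R *ᵥ y)‖ := by simp [hRy]
      _ ≤ ‖R‖ * ‖WithLp.toLp 2 y‖ := Matrix.l2_opNorm_mulVec R (WithLp.toLp 2 y)
      _ ≤ C * ‖WithLp.toLp 2 y‖ := by gcongr
  have hCpos : 0 < C := pos_of_mul_pos_left (one_pos.trans_le hone) (norm_nonneg _)
  rw [hdiag, div_le_iff₀ (by positivity)]
  calc c ≤ c * (C * ‖WithLp.toLp 2 y‖) ^ 2 := le_mul_of_one_le_right hc.le (one_le_pow₀ hone)
    _ = c * (y ⬝ᵥ y) * C ^ 2 := by rw [← norm_toLp_sq]; ring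
    _ ≤ y ⬝ᵥ (R *ᵥ y) * C ^ 2 := by gcongr; exact hR y

theorem isUnit_det_diagonal_diag_inv (hR : Coercive c R) (hc : 0 < c) {C : ℝ} (hC : ‖R‖ ≤ C)
    (hCpos : 0 < C) : IsUnit (Matrix.diagonal R⁻¹.diag).det := by
  rw [Matrix.det_diagonal, isUnit_iff_ne_zero]
  exact Finset.prod_ne_zero_iff.2 fun a _ =>
    ((by positivity : 0 < c / C ^ 2).trans_le (hR.le_inv_apply_self hc hC a)).ne'

theorem norm_inv_diagonal_diag_inv_le (hR : Coercive c R) (hc : 0 < c) {C : ℝ} (hC : ‖R‖ ≤ C)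
    (hCpos : 0 < C) : ‖(Matrix.diagonal R⁻¹.diag)⁻¹‖ ≤ C ^ 2 / c := by
  have hle (a : ι) : c / C ^ 2 ≤ R⁻¹ a a := hR.le_inv_apply_self hc hC a
  have hpos (a : ι) : 0 < R⁻¹ a a := (by positivity : 0 < c / C ^ 2).trans_le (hle a)
  have hinv : (Matrix.diagonal R⁻¹.diag)⁻¹ = Matrix.diagonal fun a => (R⁻¹ a a)⁻¹ :=
    Matrix.inv_eq_right_inv (by
      simp [Matrix.diagonal_mul_diagonal, fun a => mul_inv_cancel₀ (hpos a).ne'])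
  rw [hinv, Matrix.l2_opNorm_diagonal]
  refine (pi_norm_le_iff_of_nonneg (by positivity)).2 fun a => ?_
  rw [Real.norm_eq_abs, abs_of_pos (inv_pos.2 (hpos a)), ← inv_div]
  exact inv_anti₀ (by positivity) (hle a)

end Coercive

end Coercive

/-! ### The trace norm -/

section TraceNorm

variable {ι : Type*} [Fintype ι] [DecidableEq ι]

/-- The trace norm of `A` is at most `δ`. The trace norm is dual to the operator norm, and only
this duality is used. -/
def TraceNormLE (A : Matrix ι ι ℝ) (δ : ℝ) : Prop :=
  ∀ Z : Matrix ι ι ℝ, |(A * Z).trace| ≤ δ * ‖Z‖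

namespace TraceNormLE

variable {A B : Matrix ι ι ℝ} {δ η b : ℝ}

theorem abs_trace_le (hA : TraceNormLE A δ) (hδ : 0 ≤ δ) : |A.trace| ≤ δ := by
  simpa using (hA 1).trans (mul_le_of_le_one_right hδ norm_one_le)

theorem of_sum_abs_le (hA : ∑ a, ∑ b, |A a b| ≤ δ) : TraceNormLE A δ := fun Z =>
  calc |(A * Z).trace| = |∑ a, ∑ b, A a b * Z b a| := by
        simp only [Matrix.trace, Matrix.diag_apply, Matrix.mul_apply]
    _ ≤ ∑ a, ∑ b, |A a b * Z b a| := (Finset.abs_sum_le_sum_abs _ _).trans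
        (Finset.sum_le_sum fun _ _ => Finset.abs_sum_le_sum_abs _ _)
    _ ≤ ∑ a, ∑ b, |A a b| * ‖Z‖ := by
        gcongr with a _ b
        rw [abs_mul]
        exact mul_le_mul_of_nonneg_left (norm_apply_le_norm Z b a) (abs_nonneg _)
    _ ≤ δ * ‖Z‖ := by
        simp only [← Finset.sum_mul]
        exact mul_le_mul_of_nonneg_right hA (norm_nonneg Z)

theorem add (hA : TraceNormLE A δ) (hB : TraceNormLE B η) : TraceNormLE (A + B) (δ + η) :=
  fun Z => by
    rw [add_mul, Matrix.trace_add, add_mul]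
    exact (abs_add_le _ _).trans (add_le_add (hA Z) (hB Z))

theorem smul (hA : TraceNormLE A δ) (c : ℝ) : TraceNormLE (c • A) (|c| * δ) := fun Z => by
  rw [Matrix.smul_mul, Matrix.trace_smul, smul_eq_mul, abs_mul, mul_assoc]
  exact mul_le_mul_of_nonneg_left (hA Z) (abs_nonneg c)

theorem mul_right (hA : TraceNormLE A δ) (hδ : 0 ≤ δ) (hB : ‖B‖ ≤ b) :
    TraceNormLE (A * B) (δ * b) := fun Z => by
  rw [mul_assoc, mul_assoc]
  exact (hA (B * Z)).trans (mul_le_mul_of_nonneg_left (norm_mul_le_of_le hB le_rfl) hδ)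

theorem mul_left (hA : TraceNormLE A δ) (hδ : 0 ≤ δ) (hB : ‖B‖ ≤ b) :
    TraceNormLE (B * A) (b * δ) := fun Z => by
  rw [mul_assoc, Matrix.trace_mul_comm, mul_assoc, mul_comm b, mul_assoc, mul_comm b]
  exact (hA (Z * B)).trans (mul_le_mul_of_nonneg_left (norm_mul_le_of_le le_rfl hB) hδ)

theorem transpose (hA : TraceNormLE A δ) : TraceNormLE Aᵀ δ := fun Z => by
  rw [← Matrix.trace_transpose, Matrix.transpose_mul, Matrix.transpose_transpose,
    Matrix.trace_mul_comm, ← norm_transpose Z]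
  exact hA Zᵀ

theorem diagonal_diag (hA : TraceNormLE A δ) (hδ : 0 ≤ δ) :
    TraceNormLE (Matrix.diagonal A.diag) δ := fun Z => by
  have htrace : (Matrix.diagonal A.diag * Z).trace = (A * Matrix.diagonal Z.diag).trace := by
    simp [Matrix.trace, Matrix.diagonal_mul, Matrix.mul_diagonal]
  rw [htrace]
  exact (hA _).trans (mul_le_mul_of_nonneg_left (norm_diagonal_diag_le Z) hδ)

theorem inv_sub_inv (hAB : TraceNormLE (A - B) δ) (hδ : 0 ≤ δ) (hA : IsUnit A.det)
    (hB : IsUnit B.det) (hAb : ‖A⁻¹‖ ≤ b) (hBb : ‖B⁻¹‖ ≤ b) :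
    TraceNormLE (A⁻¹ - B⁻¹) (b * δ * b) := by
  have hunit : IsUnit A ↔ IsUnit B := by
    simp only [Matrix.isUnit_iff_isUnit_det, hA, hB]
  have hb : 0 ≤ b := (norm_nonneg _).trans hAb
  have hBA : TraceNormLE (B - A) δ := by simpa using hAB.smul (-1)
  rw [Matrix.inv_sub_inv hunit]
  exact (hBA.mul_left hδ hAb).mul_right (mul_nonneg hb hδ) hBb

end TraceNormLE

end TraceNorm

/-! ### Matrix expressions -/

/-- Noncommutative expressions in a matrix `R` (`base`), a family of further matrices (`var`),
`R⁻¹` (`baseInv`) and `diag(R⁻¹)⁻¹` (`diagInv`). No other inverses are allowed: these two exist,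
with norm bounds, as soon as `R` is bounded and coercive. -/
inductive MatExpr (σ : Type*)
  | base : MatExpr σ
  | var : σ → MatExpr σ
  | baseInv : MatExpr σ
  | diagInv : MatExpr σ
  | add : MatExpr σ → MatExpr σ → MatExpr σ
  | smul : ℝ → MatExpr σ → MatExpr σ
  | mul : MatExpr σ → MatExpr σ → MatExpr σ
  | diag : MatExpr σ → MatExpr σ
  | transpose : MatExpr σ → MatExpr σ

namespace MatExpr

variable {σ : Type*}

instance : Add (MatExpr σ) := ⟨add⟩

instance : SMul ℝ (MatExpr σ) := ⟨smul⟩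

instance : Mul (MatExpr σ) := ⟨mul⟩

section Eval

variable {ι : Type*} [Fintype ι] [DecidableEq ι]

/-- The value of a matrix expression at `base = R` and `var i = D i`. -/
def eval (R : Matrix ι ι ℝ) (D : σ → Matrix ι ι ℝ) : MatExpr σ → Matrix ι ι ℝ
  | base => R
  | var i => D i
  | baseInv => R⁻¹
  | diagInv => (Matrix.diagonal R⁻¹.diag)⁻¹
  | add e f => e.eval R D + f.eval R D
  | smul c e => c • e.eval R D
  | mul e f => e.eval R D * f.eval R D
  | diag e => Matrix.diagonal (e.eval R D).diag
  | transpose e => (e.eval R D)ᵀ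

variable (R : Matrix ι ι ℝ) (D : σ → Matrix ι ι ℝ)

theorem eval_add (e f : MatExpr σ) : (e + f).eval R D = e.eval R D + f.eval R D := rfl

theorem eval_smul (c : ℝ) (e : MatExpr σ) : (c • e).eval R D = c • e.eval R D := rfl

theorem eval_mul (e f : MatExpr σ) : (e * f).eval R D = e.eval R D * f.eval R D := rfl

end Eval

/-- The expression of `matML`. -/
def ml (i j : σ) : MatExpr σ := (1 / 2 : ℝ) • (baseInv * var i * baseInv * var j)

/-- The expression of `matGradCV`. -/
def gradCV (i : σ) : MatExpr σ :=
  baseInv * (diagInv * diagInv) *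
    (diag (baseInv * var i * baseInv) * diagInv + (-1 : ℝ) • (baseInv * var i)) * baseInv

/-- The expression of `matCV1`. -/
def cv1 (i j : σ) : MatExpr σ :=
  (2 : ℝ) • ((gradCV i + transpose (gradCV i)) * base *
    (gradCV j + transpose (gradCV j)) * base)

/-- The expression of `matCV2`. -/
def cv2 (i j : σ) : MatExpr σ :=
  (-8 : ℝ) • (diagInv * diagInv * diagInv * diag (baseInv * var i * baseInv) * baseInv * var j *
    baseInv)
  + (2 : ℝ) • (diagInv * diagInv * baseInv * var i * baseInv * var j * baseInv)
  + (6 : ℝ) • (diagInv * diagInv * diagInv * diagInv * diag (baseInv * var i * baseInv) *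
    diag (baseInv * var j * baseInv) * baseInv)

section EvalFin

variable {n : ℕ} (R : Matrix (Fin n) (Fin n) ℝ) (D : σ → Matrix (Fin n) (Fin n) ℝ) (i j : σ)

theorem eval_ml : (ml i j).eval R D = matML R (D i) (D j) := rfl

theorem eval_gradCV : (gradCV i).eval R D = matGradCV R (D i) := by
  simp only [gradCV, eval_mul, eval_add, eval_smul, matGradCV, pow_two, neg_one_smul,
    ← sub_eq_add_neg]
  rfl

theorem eval_cv1 : (cv1 i j).eval R D = matCV1 R (D i) (D j) := by
  simp only [cv1, matCV1, ← eval_gradCV]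
  rfl

theorem eval_cv2 : (cv2 i j).eval R D = matCV2 R (D i) (D j) := by
  simp only [cv2, eval_add, eval_smul, eval_mul, matCV2, pow_succ, pow_zero, one_mul]
  rfl

end EvalFin

end MatExpr

/-! ### Properties of families of matrices inherited by matrix expressions -/

section Closed

variable {T S σ : Type*} {ι : T → Type*} [∀ τ, Fintype (ι τ)] [∀ τ, DecidableEq (ι τ)]

/-- The property `Q` of families of matrices is inherited by the values of matrix expressions: it
is stable under the operations of `MatExpr`, where inverses must be uniformly bounded on `s`. -/
structure ClosedUnderMatExpr (s : Set S) (Q : (∀ τ, S → Matrix (ι τ) (ι τ) ℝ) → Prop) : Prop where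
  add : ∀ {A B}, Q A → Q B → Q (fun τ x => A τ x + B τ x)
  smul : ∀ (c : ℝ) {A}, Q A → Q (fun τ x => c • A τ x)
  mul : ∀ {A B}, Q A → Q B → Q (fun τ x => A τ x * B τ x)
  diag : ∀ {A}, Q A → Q (fun τ x => Matrix.diagonal (A τ x).diag)
  transpose : ∀ {A}, Q A → Q (fun τ x => (A τ x)ᵀ)
  inv : ∀ {A}, Q A → (∀ τ, ∀ x ∈ s, IsUnit (A τ x).det) →
    UniformlyBoundedOn s (fun τ x => (A τ x)⁻¹) → Q (fun τ x => (A τ x)⁻¹)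

theorem ClosedUnderMatExpr.eval {s : Set S} {Q : (∀ τ, S → Matrix (ι τ) (ι τ) ℝ) → Prop}
    (hQ : ClosedUnderMatExpr s Q) {R : ∀ τ, S → Matrix (ι τ) (ι τ) ℝ}
    {D : σ → ∀ τ, S → Matrix (ι τ) (ι τ) ℝ} (hR : Q R) (hD : ∀ i, Q (D i))
    (hbdd : UniformlyBoundedOn s R) {c : ℝ} (hc : 0 < c)
    (hcoer : ∀ τ, ∀ x ∈ s, Coercive c (R τ x)) (e : MatExpr σ) :
    Q (fun τ x => e.eval (R τ x) (fun i => D i τ x)) := by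
  obtain ⟨C, hCpos, hC⟩ : ∃ C : ℝ, 0 < C ∧ ∀ τ, ∀ x ∈ s, ‖R τ x‖ ≤ C :=
    let ⟨C, hC0, hC⟩ := hbdd.exists_nonneg
    ⟨C + 1, by positivity, fun τ x hx => (hC τ x hx).trans (by linarith)⟩
  have hinv : Q (fun τ x => (R τ x)⁻¹) :=
    hQ.inv hR (fun τ x hx => (hcoer τ x hx).isUnit_det hc)
      ⟨c⁻¹, fun τ x hx => (hcoer τ x hx).norm_inv_le hc⟩
  induction e with
  | base => exact hR
  | var i => exact hD i
  | baseInv => exact hinv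
  | diagInv =>
    exact hQ.inv (hQ.diag hinv)
      (fun τ x hx => (hcoer τ x hx).isUnit_det_diagonal_diag_inv hc (hC τ x hx) hCpos)
      ⟨C ^ 2 / c, fun τ x hx => (hcoer τ x hx).norm_inv_diagonal_diag_inv_le hc (hC τ x hx) hCpos⟩
  | add e f he hf => exact hQ.add he hf
  | smul c e he => exact hQ.smul c he
  | mul e f he hf => exact hQ.mul he hf
  | diag e he => exact hQ.diag he
  | transpose e he => exact hQ.transpose he

theorem UniformlyBoundedOn.matrix_smul {s : Set S} {A : ∀ τ, S → Matrix (ι τ) (ι τ) ℝ}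
    (hA : UniformlyBoundedOn s A) (c : ℝ) : UniformlyBoundedOn s (fun τ x => c • A τ x) :=
  hA.map (c := |c|) (fun _ => c • LinearMap.id) (fun _ _ => (norm_smul c _).le)

theorem closedUnderMatExpr_uniformlyBoundedJetOn (s : Set ℝ) (k : ℕ) :
    ClosedUnderMatExpr (ι := ι) s
      (UniformlyBoundedJetOn (E := fun τ => Matrix (ι τ) (ι τ) ℝ) s k) where
  add := UniformlyBoundedJetOn.add
  smul c A hA := hA.map (c := |c|) (fun _ => c • LinearMap.id) (fun _ _ => (norm_smul c _).le)
  mul := UniformlyBoundedJetOn.mul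
  diag hA := hA.map (c := 1)
    (fun τ => Matrix.diagonalLinearMap (ι τ) ℝ ℝ ∘ₗ Matrix.diagLinearMap (ι τ) ℝ ℝ)
    (fun _ A => (norm_diagonal_diag_le A).trans (one_mul _).ge)
  transpose hA := hA.map (c := 1)
    (fun τ => (Matrix.transposeLinearEquiv (ι τ) (ι τ) ℝ ℝ).toLinearMap)
    (fun _ A => (norm_transpose A).le.trans (one_mul _).ge)
  inv {A} hA hunit hbdd := by
    have (τ : T) : CompleteSpace (Matrix (ι τ) (ι τ) ℝ) := FiniteDimensional.complete ℝ _
    simp only [Matrix.nonsing_inv_eq_ringInverse] at hbdd ⊢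
    exact hA.ringInverse (fun τ x hx => (Matrix.isUnit_iff_isUnit_det _).2 (hunit τ x hx)) hbdd

/-- A uniformly bounded family of pairs of matrices, indexed by `Bool`, in which the trace norm of
the difference of each pair is at most a common multiple of `δ`. -/
def TraceNormClose (δ : T → ℝ) (A : ∀ τ, Bool → Matrix (ι τ) (ι τ) ℝ) : Prop :=
  UniformlyBoundedOn univ A ∧
    ∃ C : ℝ, 0 ≤ C ∧ ∀ τ, TraceNormLE (A τ true - A τ false) (C * δ τ)

namespace TraceNormClose

variable {δ : T → ℝ} {A B : ∀ τ, Bool → Matrix (ι τ) (ι τ) ℝ}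

theorem add (hA : TraceNormClose δ A) (hB : TraceNormClose δ B) :
    TraceNormClose δ (fun τ x => A τ x + B τ x) := by
  obtain ⟨hA0, C, hC0, hC⟩ := hA
  obtain ⟨hB0, D, hD0, hD⟩ := hB
  refine ⟨hA0.add hB0, C + D, add_nonneg hC0 hD0, fun τ => ?_⟩
  rw [add_sub_add_comm, add_mul]
  exact (hC τ).add (hD τ)

theorem smul (hA : TraceNormClose δ A) (c : ℝ) : TraceNormClose δ (fun τ x => c • A τ x) := by
  obtain ⟨hA0, C, hC0, hC⟩ := hA
  refine ⟨hA0.matrix_smul c, |c| * C, mul_nonneg (abs_nonneg c) hC0, fun τ => ?_⟩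
  rw [← smul_sub, mul_assoc]
  exact (hC τ).smul c

theorem mul (hδ : ∀ τ, 0 ≤ δ τ) (hA : TraceNormClose δ A) (hB : TraceNormClose δ B) :
    TraceNormClose δ (fun τ x => A τ x * B τ x) := by
  obtain ⟨hA0, C, hC0, hC⟩ := hA
  obtain ⟨hB0, D, hD0, hD⟩ := hB
  obtain ⟨a, ha0, ha⟩ := hA0.exists_nonneg
  obtain ⟨b, hb0, hb⟩ := hB0.exists_nonneg
  refine ⟨hA0.mul hB0, C * b + a * D, by positivity, fun τ => ?_⟩
  have hsplit : A τ true * B τ true - A τ false * B τ false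
      = (A τ true - A τ false) * B τ true + A τ false * (B τ true - B τ false) := by
    noncomm_ring
  have hconst : (C * b + a * D) * δ τ = C * δ τ * b + a * (D * δ τ) := by ring
  rw [hsplit, hconst]
  exact ((hC τ).mul_right (mul_nonneg hC0 (hδ τ)) (hb τ true trivial)).add
    ((hD τ).mul_left (mul_nonneg hD0 (hδ τ)) (ha τ false trivial))

theorem diag (hδ : ∀ τ, 0 ≤ δ τ) (hA : TraceNormClose δ A) :
    TraceNormClose δ (fun τ x => Matrix.diagonal (A τ x).diag) := by
  obtain ⟨⟨a, ha⟩, C, hC0, hC⟩ := hA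
  refine ⟨⟨a, fun τ x hx => (norm_diagonal_diag_le _).trans (ha τ x hx)⟩, C, hC0, fun τ => ?_⟩
  rw [Matrix.diagonal_sub]
  exact (hC τ).diagonal_diag (mul_nonneg hC0 (hδ τ))

theorem transpose (hA : TraceNormClose δ A) : TraceNormClose δ (fun τ x => (A τ x)ᵀ) := by
  obtain ⟨⟨a, ha⟩, C, hC0, hC⟩ := hA
  exact ⟨⟨a, fun τ x hx => (norm_transpose _).le.trans (ha τ x hx)⟩, C, hC0,
    fun τ => (hC τ).transpose⟩

theorem inv (hδ : ∀ τ, 0 ≤ δ τ) (hA : TraceNormClose δ A) (hunit : ∀ τ x, IsUnit (A τ x).det)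
    (hbdd : UniformlyBoundedOn univ (fun τ x => (A τ x)⁻¹)) :
    TraceNormClose δ (fun τ x => (A τ x)⁻¹) := by
  obtain ⟨-, C, hC0, hC⟩ := hA
  obtain ⟨b, hb0, hb⟩ := hbdd.exists_nonneg
  refine ⟨hbdd, b * C * b, by positivity, fun τ => ?_⟩
  have hconst : b * C * b * δ τ = b * (C * δ τ) * b := by ring
  rw [hconst]
  exact (hC τ).inv_sub_inv (mul_nonneg hC0 (hδ τ)) (hunit τ true) (hunit τ false)
    (hb τ true trivial) (hb τ false trivial)

end TraceNormClose

theorem closedUnderMatExpr_traceNormClose {δ : T → ℝ} (hδ : ∀ τ, 0 ≤ δ τ) :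
    ClosedUnderMatExpr (ι := ι) univ (TraceNormClose (ι := ι) δ) where
  add := TraceNormClose.add
  smul c _ hA := hA.smul c
  mul := TraceNormClose.mul hδ
  diag := TraceNormClose.diag hδ
  transpose := TraceNormClose.transpose
  inv hA hunit := hA.inv hδ fun τ x => hunit τ x trivial

end Closed

/-! ### The integer lattice -/

section Lattice

variable {d : ℕ}

/-- The weight `1 / (1 + |z|^{d+1})` of a lattice vector, where `|z|` is the sup norm: the decay of
the kernels, transported to the lattice. -/
def weight (z : Fin d → ℤ) : ℝ := 1 / (1 + ‖z‖ ^ (d + 1))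

theorem weight_pos (z : Fin d → ℤ) : 0 < weight z := by unfold weight; positivity

theorem weight_zero : weight (0 : Fin d → ℤ) = 1 := by simp [weight]

theorem weight_neg (z : Fin d → ℤ) : weight (-z) = weight z := by simp [weight]

theorem tsum_weight_nonneg : 0 ≤ ∑' z : Fin d → ℤ, weight z :=
  tsum_nonneg fun z => (weight_pos z).le

theorem norm_pi_intCast {ι : Type*} [Fintype ι] (z : ι → ℤ) : ‖(fun k => (z k : ℝ))‖ = ‖z‖ :=
  rfl

theorem summable_norm_inv_pow_int {m : ℕ} (hm : d < m) :
    Summable fun z : Fin d → ℤ => ‖z‖⁻¹ ^ m := by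
  set b := Pi.basisFun ℝ (Fin d)
  set L := Submodule.span ℤ (Set.range b) with hL
  have hrank : Module.finrank ℤ L = d := by
    rw [hL, finrank_span_eq_card (b.linearIndependent.restrict_scalars' ℤ), Fintype.card_fin]
  have hmem (z : Fin d → ℤ) : (fun k => (z k : ℝ)) ∈ L :=
    b.mem_span_iff_repr_mem ℤ _ |>.2 fun i => ⟨z i, by simp [b]⟩
  have hinj : Function.Injective fun z : Fin d → ℤ => (⟨_, hmem z⟩ : L) := fun z w h =>
    funext fun k => Int.cast_injective (congrFun (Subtype.ext_iff.1 h) k)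
  refine ((ZLattice.summable_norm_pow_inv L m (hrank.trans_lt hm)).comp_injective
    hinj).congr fun z => ?_
  simp only [Function.comp, ← norm_pi_intCast z, Submodule.coe_norm]

theorem summable_weight : Summable (weight : (Fin d → ℤ) → ℝ) := by
  have hsum : Summable fun z : Fin d → ℤ => ‖z‖⁻¹ ^ (d + 1) + if z = 0 then 1 else 0 :=
    (summable_norm_inv_pow_int d.lt_succ_self).add
      (summable_of_ne_finset_zero (s := {0}) fun z hz => if_neg (Finset.notMem_singleton.1 hz))
  refine hsum.of_nonneg_of_le (fun z => (weight_pos z).le) fun z => ?_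
  obtain rfl | hz := eq_or_ne z 0
  · simp [weight_zero]
  · have := norm_pos_iff.2 hz
    rw [if_neg hz, add_zero, weight, inv_pow, one_div]
    exact inv_anti₀ (by positivity) (by linarith)

theorem sum_weight_sub_le {ι : Type*} [Fintype ι] {z : ι → Fin d → ℤ} (hz : Function.Injective z)
    (w : Fin d → ℤ) : ∑ b, weight (w - z b) ≤ ∑' y : Fin d → ℤ, weight y := by
  rw [← tsum_fintype (L := .unconditional _)]
  exact Summable.tsum_le_tsum_of_inj (fun b => w - z b) (sub_right_injective.comp hz)
    (fun c _ => (weight_pos c).le) (fun b => le_rfl) .of_finite summable_weight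

theorem one_le_norm_of_ne_zero {ι : Type*} [Fintype ι] {z : ι → ℤ} (hz : z ≠ 0) : 1 ≤ ‖z‖ := by
  obtain ⟨k, hk⟩ := Function.ne_iff.1 hz
  refine le_trans ?_ (norm_le_pi_norm z k)
  rw [Int.norm_eq_abs]
  exact_mod_cast Int.one_le_abs hk

end Lattice

/-! ### Perturbed lattice points -/

section KernelMatrix

variable {d : ℕ} {ι : Type*}

/-- The points `z_a + ε x_a`. -/
def perturbedPoint (z : ι → Fin d → ℤ) (x : ι → EuclideanSpace ℝ (Fin d)) (ε : ℝ) (a : ι) :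
    EuclideanSpace ℝ (Fin d) :=
  WithLp.toLp 2 (fun k => (z a k : ℝ)) + ε • x a

theorem perturbedPoint_sub (z : ι → Fin d → ℤ) (x : ι → EuclideanSpace ℝ (Fin d)) (ε : ℝ)
    (a b : ι) : perturbedPoint z x ε a - perturbedPoint z x ε b
      = WithLp.toLp 2 (fun k => ((z a - z b) k : ℝ)) + ε • (x a - x b) := by
  ext k
  simp only [perturbedPoint, PiLp.add_apply, PiLp.sub_apply, PiLp.smul_apply, Pi.sub_apply,
    Int.cast_sub, smul_eq_mul]
  ring

/-- The matrix `h(y_a - y_b)` of a kernel `h` at the points `y_a`. -/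
def kernelMatrix {E : Type*} [Sub E] (h : E → ℝ) (y : ι → E) : Matrix ι ι ℝ :=
  Matrix.of fun a b => h (y a - y b)

end KernelMatrix

/-- A finite configuration of distinct lattice points, together with perturbation vectors of
sup norm at most one. -/
structure Configuration (d : ℕ) : Type 1 where
  /-- The index set. -/
  index : Type
  [fintype : Fintype index]
  [decidableEq : DecidableEq index]
  /-- The lattice points. -/
  site : index → Fin d → ℤ
  site_injective : Function.Injective site
  /-- The perturbation vectors. -/
  shift : index → EuclideanSpace ℝ (Fin d)
  abs_shift_le : ∀ a k, |shift a k| ≤ 1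

namespace Configuration

variable {d : ℕ}

instance (c : Configuration d) : Fintype c.index := c.fintype

instance (c : Configuration d) : DecidableEq c.index := c.decidableEq

/-- The perturbed points of a configuration. -/
def point (c : Configuration d) (ε : ℝ) : c.index → EuclideanSpace ℝ (Fin d) :=
  perturbedPoint c.site c.shift ε

/-- The matrix of a kernel at the perturbed points of a configuration. -/
def matrix (c : Configuration d) (h : EuclideanSpace ℝ (Fin d) → ℝ) (ε : ℝ) :
    Matrix c.index c.index ℝ :=
  kernelMatrix h (c.point ε)

variable (c : Configuration d) {ε β : ℝ}

theorem abs_shift_sub_le (a b : c.index) (k : Fin d) : |(c.shift a - c.shift b) k| ≤ 2 := by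
  rw [PiLp.sub_apply]
  exact (abs_sub _ _).trans (by linarith [c.abs_shift_le a k, c.abs_shift_le b k])

theorem one_le_norm_site_sub {a b : c.index} (hab : a ≠ b) : 1 ≤ ‖c.site a - c.site b‖ :=
  one_le_norm_of_ne_zero (sub_ne_zero.2 (c.site_injective.ne hab))

theorem norm_site_sub_le (hε : 0 ≤ ε) (a b : c.index) :
    ‖c.site a - c.site b‖ ≤ ‖c.point ε a - c.point ε b‖ + 2 * ε := by
  refine (pi_norm_le_iff_of_nonneg (by positivity)).2 fun k => ?_
  have hcoord : |(c.point ε a - c.point ε b) k| ≤ ‖c.point ε a - c.point ε b‖ :=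
    PiLp.norm_apply_le (c.point ε a - c.point ε b) k
  have hshift : |ε * (c.shift a - c.shift b) k| ≤ 2 * ε := by
    rw [abs_mul, abs_of_nonneg hε, mul_comm]
    gcongr
    exact c.abs_shift_sub_le a b k
  have hsplit : (((c.site a - c.site b) k : ℤ) : ℝ)
      = (c.point ε a - c.point ε b) k - ε * (c.shift a - c.shift b) k := by
    rw [point, perturbedPoint_sub, PiLp.add_apply, PiLp.smul_apply, smul_eq_mul,
      add_sub_cancel_right]
  rw [Int.norm_eq_abs, hsplit]
  exact (abs_sub _ _).trans (add_le_add hcoord hshift)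

theorem mul_norm_site_sub_le (hε : 0 ≤ ε) (a b : c.index) :
    (1 - 2 * ε) * ‖c.site a - c.site b‖ ≤ ‖c.point ε a - c.point ε b‖ := by
  obtain rfl | hab := eq_or_ne a b
  · simp
  nlinarith [c.one_le_norm_site_sub hab, c.norm_site_sub_le hε a b]

theorem one_sub_two_mul_le_norm_point_sub (hβ : β < 1 / 2) (hε : ε ∈ Ico 0 β) {a b : c.index}
    (hab : a ≠ b) : 1 - 2 * β ≤ ‖c.point ε a - c.point ε b‖ := by
  nlinarith [c.one_le_norm_site_sub hab, c.mul_norm_site_sub_le hε.1 a b, hε.2]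

theorem inv_one_add_norm_pow_le (hβ : β < 1 / 2) (hε : ε ∈ Ico 0 β) (a b : c.index) :
    1 / (1 + ‖c.point ε a - c.point ε b‖ ^ (d + 1))
      ≤ 1 / (1 - 2 * β) ^ (d + 1) * weight (c.site a - c.site b) := by
  have hr : 0 < 1 - 2 * β := by linarith
  have hr_pow : (1 - 2 * β) ^ (d + 1) ≤ 1 := pow_le_one₀ hr.le (by linarith [hε.1, hε.2])
  rw [weight, one_div_mul_one_div]
  refine one_div_le_one_div_of_le (by positivity) ?_
  calc (1 - 2 * β) ^ (d + 1) * (1 + ‖c.site a - c.site b‖ ^ (d + 1))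
      = (1 - 2 * β) ^ (d + 1) + ((1 - 2 * β) * ‖c.site a - c.site b‖) ^ (d + 1) := by
        rw [mul_pow]; ring
    _ ≤ 1 + ‖c.point ε a - c.point ε b‖ ^ (d + 1) := by
      gcongr
      refine le_trans ?_ (c.mul_norm_site_sub_le hε.1 a b)
      gcongr
      exact hε.2.le

theorem norm_le_of_abs_le_weight {A : Matrix c.index c.index ℝ} {C : ℝ} (hC : 0 ≤ C)
    (hA : ∀ a b, |A a b| ≤ C * weight (c.site a - c.site b)) :
    ‖A‖ ≤ C * ∑' y : Fin d → ℤ, weight y := by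
  have hrow (a : c.index) :
      ∑ b, C * weight (c.site a - c.site b) ≤ C * ∑' y : Fin d → ℤ, weight y := by
    rw [← Finset.mul_sum]
    exact mul_le_mul_of_nonneg_left (sum_weight_sub_le c.site_injective _) hC
  refine norm_le_of_sum_norm_le (mul_nonneg hC tsum_weight_nonneg)
    (fun a => (Finset.sum_le_sum fun b _ => hA a b).trans (hrow a))
    fun b => (Finset.sum_le_sum fun a _ => ?_).trans (hrow b)
  rw [← weight_neg, neg_sub]
  exact hA a b

end Configuration

/-! ### Smooth decaying kernels -/

section Kernels

variable {d : ℕ}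

/-- Regularity of a kernel outside the origin, and decay of the kernel and of its derivatives. -/
structure RegularKernel (h : EuclideanSpace ℝ (Fin d) → ℝ) : Prop where
  differentiable : TimesDifferentiableOn 3 h {0}ᶜ
  bound : ∃ C : ℝ, ∀ t, |h t| ≤ C / (1 + ‖t‖ ^ (d + 1))
  bound_deriv : ∀ T > (0 : ℝ), ∀ k ∈ Finset.Icc 1 3, ∀ J : Fin k → Fin d,
    ∃ C : ℝ, ∀ t, T ≤ ‖t‖ → |spacePartial h J t| ≤ C / (1 + ‖t‖ ^ (d + 1))

/-- The `m`-th derivative of `h` at `t` in the direction `u`. -/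
def dirDeriv (h : EuclideanSpace ℝ (Fin d) → ℝ) (m : ℕ) (u t : EuclideanSpace ℝ (Fin d)) : ℝ :=
  iteratedFDerivWithin ℝ m h {0}ᶜ t fun _ => u

theorem dirDeriv_zero (h : EuclideanSpace ℝ (Fin d) → ℝ) (u t : EuclideanSpace ℝ (Fin d)) :
    dirDeriv h 0 u t = h t :=
  iteratedFDerivWithin_zero_apply _

theorem dirDeriv_eq_sum (h : EuclideanSpace ℝ (Fin d) → ℝ) (m : ℕ)
    (u t : EuclideanSpace ℝ (Fin d)) :
    dirDeriv h m u t = ∑ J : Fin m → Fin d, (∏ l, u (J l)) * spacePartial h J t := by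
  have hu : ∑ k, u k • EuclideanSpace.single k (1 : ℝ) = u := by
    simpa only [EuclideanSpace.basisFun_repr, EuclideanSpace.basisFun_apply] using
      (EuclideanSpace.basisFun (Fin d) ℝ).sum_repr u
  set f := (iteratedFDerivWithin ℝ m h {0}ᶜ t).toMultilinearMap
  calc dirDeriv h m u t = f fun _ => ∑ k, u k • EuclideanSpace.single k (1 : ℝ) := by rw [hu]; rfl
    _ = ∑ J : Fin m → Fin d, f fun l => u (J l) • EuclideanSpace.single (J l) (1 : ℝ) :=
      f.map_sum _
    _ = _ := Finset.sum_congr rfl fun J _ => f.map_smul_univ _ _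

namespace RegularKernel

variable {h : EuclideanSpace ℝ (Fin d) → ℝ} (hh : RegularKernel h)

include hh

theorem exists_abs_spacePartial_le {T : ℝ} (hT : 0 < T) {m : ℕ} (hm : m ≤ 3) (J : Fin m → Fin d) :
    ∃ C : ℝ, ∀ t, T ≤ ‖t‖ → |spacePartial h J t| ≤ C / (1 + ‖t‖ ^ (d + 1)) := by
  obtain rfl | hm_pos := m.eq_zero_or_pos
  · obtain ⟨C, hC⟩ := hh.bound
    exact ⟨C, fun t _ => by simpa only [spacePartial, iteratedFDerivWithin_zero_apply] using hC t⟩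
  · exact hh.bound_deriv T hT m (Finset.mem_Icc.2 ⟨hm_pos, hm⟩) J

theorem exists_abs_dirDeriv_le {T : ℝ} (hT : 0 < T) {m : ℕ} (hm : m ≤ 3) :
    ∃ C : ℝ, 0 ≤ C ∧ ∀ t u : EuclideanSpace ℝ (Fin d), T ≤ ‖t‖ → (∀ k, |u k| ≤ 2) →
      |dirDeriv h m u t| ≤ C * (1 / (1 + ‖t‖ ^ (d + 1))) := by
  choose C hC using hh.exists_abs_spacePartial_le hT hm
  refine ⟨∑ J : Fin m → Fin d, 2 ^ m * |C J|, by positivity, fun t u ht hu => ?_⟩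
  rw [dirDeriv_eq_sum, Finset.sum_mul]
  refine (Finset.abs_sum_le_sum_abs _ _).trans (Finset.sum_le_sum fun J _ => ?_)
  have hprod : ∏ l, |u (J l)| ≤ 2 ^ m :=
    (Finset.prod_le_prod (fun l _ => abs_nonneg _) fun l _ => hu (J l)).trans (by simp)
  have hpartial : |spacePartial h J t| ≤ |C J| * (1 / (1 + ‖t‖ ^ (d + 1))) := by
    refine (hC J t ht).trans ?_
    rw [div_eq_mul_one_div]
    gcongr
    exact le_abs_self _
  rw [abs_mul, mul_assoc, Finset.abs_prod]
  exact mul_le_mul hprod hpartial (abs_nonneg _) (by positivity)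

theorem hasDerivAt_dirDeriv {m : ℕ} (hm : m < 3) (w u : EuclideanSpace ℝ (Fin d)) {ε : ℝ}
    (hne : w + ε • u ≠ 0) :
    HasDerivAt (fun ε : ℝ => dirDeriv h m u (w + ε • u)) (dirDeriv h (m + 1) u (w + ε • u)) ε := by
  have hfderiv : HasFDerivAt (fun t => iteratedFDerivWithin ℝ m h {0}ᶜ t)
      (fderivWithin ℝ (iteratedFDerivWithin ℝ m h {0}ᶜ) {0}ᶜ (w + ε • u)) (w + ε • u) :=
    (hh.differentiable m hm _ hne).hasFDerivWithinAt.hasFDerivAt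
      (isOpen_compl_singleton.mem_nhds hne)
  have hline : HasDerivAt (fun ε : ℝ => w + ε • u) u ε := by
    simpa only [id, one_smul] using! ((hasDerivAt_id ε).smul_const u).const_add w
  rw [dirDeriv, iteratedFDerivWithin_succ_apply_left]
  exact (ContinuousMultilinearMap.apply ℝ (fun _ : Fin m => EuclideanSpace ℝ (Fin d)) ℝ
    fun _ => u).hasFDerivAt.comp_hasDerivAt ε (hfderiv.comp_hasDerivAt ε hline)

end RegularKernel

/-- The `m`-th derivative in `ε` of the matrix of a kernel at the perturbed points. -/
def Configuration.jet (c : Configuration d) (h : EuclideanSpace ℝ (Fin d) → ℝ) (m : ℕ) (ε : ℝ) :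
    Matrix c.index c.index ℝ :=
  Matrix.of fun a b => if a = b then (if m = 0 then h 0 else 0) else
    dirDeriv h m (c.shift a - c.shift b) (c.point ε a - c.point ε b)

theorem Configuration.jet_zero (c : Configuration d) (h : EuclideanSpace ℝ (Fin d) → ℝ) :
    c.jet h 0 = c.matrix h := by
  funext ε a b
  by_cases hab : a = b <;> simp [jet, matrix, kernelMatrix, hab, dirDeriv_zero]

namespace RegularKernel

variable {h : EuclideanSpace ℝ (Fin d) → ℝ} (hh : RegularKernel h) {β : ℝ} (hβ : β < 1 / 2)

include hh hβ

theorem exists_abs_jet_le {m : ℕ} (hm : m ≤ 3) :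
    ∃ C : ℝ, 0 ≤ C ∧ ∀ c : Configuration d, ∀ ε ∈ Ico 0 β, ∀ a b,
      |c.jet h m ε a b| ≤ C * weight (c.site a - c.site b) := by
  have hr : 0 < 1 - 2 * β := by linarith
  obtain ⟨C, hC0, hC⟩ := hh.exists_abs_dirDeriv_le hr hm
  have hC' : 0 ≤ C * (1 / (1 - 2 * β) ^ (d + 1)) := by positivity
  refine ⟨|h 0| + C * (1 / (1 - 2 * β) ^ (d + 1)), by positivity, fun c ε hε a b => ?_⟩
  have hw := weight_pos (c.site a - c.site b)
  obtain rfl | hab := eq_or_ne a b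
  · have hdiag : |c.jet h m ε a a| ≤ |h 0| := by
      by_cases hm0 : m = 0 <;> simp [Configuration.jet, hm0]
    rw [sub_self, weight_zero, mul_one]
    linarith
  · calc |c.jet h m ε a b|
        = |dirDeriv h m (c.shift a - c.shift b) (c.point ε a - c.point ε b)| := by
          rw [Configuration.jet, Matrix.of_apply, if_neg hab]
      _ ≤ C * (1 / (1 + ‖c.point ε a - c.point ε b‖ ^ (d + 1))) :=
        hC _ _ (c.one_sub_two_mul_le_norm_point_sub hβ hε hab) (c.abs_shift_sub_le a b)
      _ ≤ C * (1 / (1 - 2 * β) ^ (d + 1) * weight (c.site a - c.site b)) :=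
        mul_le_mul_of_nonneg_left (c.inv_one_add_norm_pow_le hβ hε a b) hC0
      _ ≤ _ := by
        rw [← mul_assoc]
        gcongr
        linarith [abs_nonneg (h 0)]

theorem uniformlyBoundedOn_jet {m : ℕ} (hm : m ≤ 3) :
    UniformlyBoundedOn (Ico 0 β) (fun c : Configuration d => c.jet h m) :=
  let ⟨_, hC0, hC⟩ := hh.exists_abs_jet_le hβ hm
  ⟨_, fun c ε hε => c.norm_le_of_abs_le_weight hC0 (hC c ε hε)⟩

theorem hasDerivWithinAt_jet {m : ℕ} (hm : m < 3) (c : Configuration d) {ε : ℝ}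
    (hε : ε ∈ Ico 0 β) :
    HasDerivWithinAt (c.jet h m) (c.jet h (m + 1) ε) (Ico 0 β) ε := by
  refine hasDerivWithinAt_pi.2 fun a => hasDerivWithinAt_pi.2 fun b => ?_
  by_cases hab : a = b
  · simpa [Configuration.jet, hab] using! hasDerivWithinAt_const ε (Ico 0 β) _
  · have hne : c.point ε a - c.point ε b ≠ 0 := norm_pos_iff.1 <|
      (by linarith : 0 < 1 - 2 * β).trans_le (c.one_sub_two_mul_le_norm_point_sub hβ hε hab)
    simp only [Configuration.point, perturbedPoint_sub] at hne
    simpa only [Configuration.jet, Configuration.point, perturbedPoint_sub, Matrix.of_apply,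
      if_neg hab] using! (hh.hasDerivAt_dirDeriv hm _ _ hne).hasDerivWithinAt

theorem uniformlyBoundedJetOn_matrix :
    UniformlyBoundedJetOn (Ico 0 β) 3 (fun c : Configuration d => c.matrix h) := by
  have hderiv (m : ℕ) (hm : m < 3) (c : Configuration d) (ε : ℝ) (hε : ε ∈ Ico 0 β) :
      HasDerivWithinAt (c.jet h m) (c.jet h (m + 1) ε) (Ico 0 β) ε :=
    hh.hasDerivWithinAt_jet hβ hm c hε
  have hbdd (m : ℕ) (hm : m ≤ 3) : UniformlyBoundedOn (Ico 0 β)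
      (fun c : Configuration d => c.jet h m) := hh.uniformlyBoundedOn_jet hβ hm
  simp only [← Configuration.jet_zero]
  exact ⟨hbdd 0 (by norm_num), _, hderiv 0 (by norm_num), hbdd 1 (by norm_num), _,
    hderiv 1 (by norm_num), hbdd 2 (by norm_num), _, hderiv 2 (by norm_num), hbdd 3 le_rfl⟩

end RegularKernel

end Kernels

/-! ### Uniform coercivity of covariance matrices -/

section FourierDensity

variable {V : Type*} [NormedAddCommGroup V] [InnerProductSpace ℝ V] [FiniteDimensional ℝ V]
  [MeasurableSpace V] [BorelSpace V]

/-- `κ` is an integrable spectral density of the kernel `k`. The normalization is that of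
`fourierHat`: no constant in front of the integral. -/
structure HasFourierDensity (k κ : V → ℝ) : Prop where
  integrable : Integrable κ
  eq_integral : ∀ t, (k t : ℂ) =
    ∫ f, (κ f : ℂ) * Complex.exp (Complex.I * ((inner ℝ f t : ℝ) : ℂ))

theorem integrable_mul_cexp_inner {κ : V → ℝ} (hκ : Integrable κ) (t : V) :
    Integrable fun f => (κ f : ℂ) * Complex.exp (Complex.I * ((inner ℝ f t : ℝ) : ℂ)) := by
  refine hκ.ofReal.mul_bdd (c := 1) (Continuous.aestronglyMeasurable (by fun_prop)) <|
    Eventually.of_forall fun f => ?_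
  rw [mul_comm, Complex.norm_exp_ofReal_mul_I]

namespace HasFourierDensity

variable {k κ q g : V → ℝ}

theorem const_mul (hk : HasFourierDensity k κ) (c : ℝ) :
    HasFourierDensity (fun t => c * k t) (fun f => c * κ f) where
  integrable := hk.integrable.const_mul c
  eq_integral t := by
    simp only [Complex.ofReal_mul, mul_assoc]
    rw [integral_const_mul, hk.eq_integral]

theorem sub (hk : HasFourierDensity k κ) (hq : HasFourierDensity q g) :
    HasFourierDensity (fun t => k t - q t) (fun f => κ f - g f) where
  integrable := hk.integrable.sub hq.integrable
  eq_integral t := by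
    simp only [Complex.ofReal_sub, sub_mul]
    rw [integral_sub (integrable_mul_cexp_inner hk.integrable t)
      (integrable_mul_cexp_inner hq.integrable t), hk.eq_integral, hq.eq_integral]

variable {ι : Type*} [Fintype ι]

theorem dotProduct_kernelMatrix_mulVec_eq_integral (hk : HasFourierDensity k κ) (y : ι → V)
    (x : ι → ℝ) : x ⬝ᵥ (kernelMatrix k y *ᵥ x) = ∫ f, κ f *
      Complex.normSq (∑ a, (x a : ℂ) * Complex.exp (Complex.I * ((inner ℝ f (y a) : ℝ) : ℂ))) := by
  set S : V → ℂ := fun f =>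
    ∑ a, (x a : ℂ) * Complex.exp (Complex.I * ((inner ℝ f (y a) : ℝ) : ℂ)) with hS
  have hconj (f : V) : (starRingEnd ℂ) (S f)
      = ∑ a, (x a : ℂ) * Complex.exp (-(Complex.I * ((inner ℝ f (y a) : ℝ) : ℂ))) := by
    simp only [hS, map_sum, map_mul, Complex.conj_ofReal, ← Complex.exp_conj, Complex.conj_I,
      neg_mul]
  have hnormSq (f : V) : ((κ f * Complex.normSq (S f) : ℝ) : ℂ)
      = ∑ a, ∑ b, (x a : ℂ) * (((κ f : ℂ) *
        Complex.exp (Complex.I * ((inner ℝ f (y a - y b) : ℝ) : ℂ))) * (x b : ℂ)) := by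
    rw [Complex.ofReal_mul, ← Complex.mul_conj, hconj, hS, Finset.sum_mul_sum, Finset.mul_sum]
    refine Finset.sum_congr rfl fun a _ => ?_
    rw [Finset.mul_sum]
    refine Finset.sum_congr rfl fun b _ => ?_
    rw [inner_sub_right, Complex.ofReal_sub, mul_sub, sub_eq_add_neg, Complex.exp_add]
    ring
  have hterm (a b : ι) : Integrable fun f => (x a : ℂ) * (((κ f : ℂ) *
      Complex.exp (Complex.I * ((inner ℝ f (y a - y b) : ℝ) : ℂ))) * (x b : ℂ)) :=
    ((integrable_mul_cexp_inner hk.integrable _).mul_const _).const_mul _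
  change _ = ∫ f, κ f * Complex.normSq (S f)
  rw [← Complex.ofReal_inj, ← integral_complex_ofReal]
  simp_rw [hnormSq]
  simp only [dotProduct, Matrix.mulVec, kernelMatrix, Matrix.of_apply, Finset.mul_sum]
  rw [integral_finsetSum _ fun a _ => integrable_finsetSum _ fun b _ => hterm a b]
  push_cast
  refine Finset.sum_congr rfl fun a _ => ?_
  rw [integral_finsetSum _ fun b _ => hterm a b]
  refine Finset.sum_congr rfl fun b _ => ?_
  rw [integral_const_mul, integral_mul_const, hk.eq_integral]

theorem coercive_of_mul_le (hk : HasFourierDensity k κ) (hq : HasFourierDensity q g) {γ c : ℝ}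
    (hγ : 0 ≤ γ) (hle : ∀ f, γ * g f ≤ κ f) {y : ι → V} (hcoer : Coercive c (kernelMatrix q y)) :
    Coercive (γ * c) (kernelMatrix k y) := fun x => by
  have hnonneg : 0 ≤ x ⬝ᵥ (kernelMatrix (fun t => k t - γ * q t) y *ᵥ x) := by
    rw [(hk.sub (hq.const_mul γ)).dotProduct_kernelMatrix_mulVec_eq_integral]
    exact integral_nonneg fun f => mul_nonneg (sub_nonneg.2 (hle f)) (Complex.normSq_nonneg _)
  have hsplit : kernelMatrix (fun t => k t - γ * q t) y
      = kernelMatrix k y - γ • kernelMatrix q y := rfl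
  rw [hsplit, Matrix.sub_mulVec, dotProduct_sub, Matrix.smul_mulVec, dotProduct_smul,
    smul_eq_mul, sub_nonneg] at hnonneg
  rw [mul_assoc]
  exact (mul_le_mul_of_nonneg_left (hcoer x) hγ).trans hnonneg

end HasFourierDensity

theorem integrable_gaussian {b : ℝ} (hb : 0 < b) :
    Integrable fun f : V => Real.exp (-b * ‖f‖ ^ 2) := by
  refine (GaussianFourier.integrable_cexp_neg_mul_sq_norm_add (V := V) (b := (b : ℂ))
    (by simpa using hb) 0 0).re.congr (Eventually.of_forall fun f => ?_)
  have hreal : (-(b : ℂ) * (‖f‖ : ℂ) ^ 2) = ((-b * ‖f‖ ^ 2 : ℝ) : ℂ) := by push_cast; rfl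
  simp only [zero_mul, add_zero]
  rw [hreal, ← Complex.ofReal_exp]
  exact Complex.ofReal_re _

theorem hasFourierDensity_gaussian {b : ℝ} (hb : 0 < b) :
    HasFourierDensity (V := V)
      (fun t => (Real.pi / b) ^ (Module.finrank ℝ V / 2 : ℝ) * Real.exp (-(‖t‖ ^ 2 / (4 * b))))
      (fun f => Real.exp (-b * ‖f‖ ^ 2)) where
  integrable := integrable_gaussian hb
  eq_integral t := by
    have hexp (f : V) : ((Real.exp (-b * ‖f‖ ^ 2) : ℝ) : ℂ) *
          Complex.exp (Complex.I * ((inner ℝ f t : ℝ) : ℂ))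
        = Complex.exp (-(b : ℂ) * (‖f‖ : ℂ) ^ 2 + Complex.I * ((inner ℝ t f : ℝ) : ℂ)) := by
      rw [Complex.exp_add, real_inner_comm]
      push_cast
      rfl
    simp_rw [hexp]
    rw [GaussianFourier.integral_cexp_neg_mul_sq_norm_add (by simpa using hb) Complex.I t,
      Complex.ofReal_mul, Complex.ofReal_cpow (by positivity), Complex.I_sq]
    push_cast
    congr 2
    ring

end FourierDensity

section GaussianGap

variable {V : Type*} [NormedAddCommGroup V]

/-- A difference of two Gaussian functions, positive only in a ball. Every positive continuous
function therefore dominates a multiple of it. -/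
def gaussianGapDensity (b η : ℝ) (f : V) : ℝ :=
  Real.exp (-(2 * b) * ‖f‖ ^ 2) - η * Real.exp (-b * ‖f‖ ^ 2)

theorem gaussianGapDensity_eq (b η : ℝ) (f : V) :
    gaussianGapDensity b η f = Real.exp (-b * ‖f‖ ^ 2) * (Real.exp (-b * ‖f‖ ^ 2) - η) := by
  rw [gaussianGapDensity, mul_sub, ← Real.exp_add, mul_comm η]
  congr 2
  ring

theorem gaussianGapDensity_le_one {b η : ℝ} (hb : 0 ≤ b) (hη : 0 ≤ η) (f : V) :
    gaussianGapDensity b η f ≤ 1 := by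
  have hexp : Real.exp (-(2 * b) * ‖f‖ ^ 2) ≤ 1 :=
    Real.exp_le_one_iff.2 (by nlinarith [sq_nonneg ‖f‖])
  exact (sub_le_self _ (by positivity)).trans hexp

theorem gaussianGapDensity_nonpos {b η : ℝ} (hb : 0 < b) (hη : 0 < η) {f : V}
    (hf : √(|Real.log η| / b) < ‖f‖) : gaussianGapDensity b η f ≤ 0 := by
  have hlog : |Real.log η| < b * ‖f‖ ^ 2 := by
    rw [mul_comm, ← div_lt_iff₀ hb]
    exact Real.lt_sq_of_sqrt_lt hf
  have hexp : Real.exp (-b * ‖f‖ ^ 2) ≤ η := by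
    rw [← Real.exp_log hη]
    exact Real.exp_le_exp.2 (by linarith [neg_abs_le (Real.log η)])
  rw [gaussianGapDensity_eq]
  exact mul_nonpos_of_nonneg_of_nonpos (Real.exp_pos _).le (sub_nonpos.2 hexp)

theorem exists_mul_gaussianGapDensity_le [ProperSpace V] {κ : V → ℝ} (hcont : Continuous κ)
    (hpos : ∀ f, 0 < κ f) {b η : ℝ} (hb : 0 < b) (hη : 0 < η) :
    ∃ γ : ℝ, 0 < γ ∧ ∀ f, γ * gaussianGapDensity b η f ≤ κ f := by
  obtain ⟨f₀, -, hf₀⟩ :=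
    (isCompact_closedBall (0 : V) (√(|Real.log η| / b))).exists_isMinOn
      ⟨0, Metric.mem_closedBall_self (Real.sqrt_nonneg _)⟩ hcont.continuousOn
  refine ⟨κ f₀, hpos f₀, fun f => ?_⟩
  by_cases hf : f ∈ Metric.closedBall (0 : V) (√(|Real.log η| / b))
  · exact (mul_le_of_le_one_right (hpos f₀).le
      (gaussianGapDensity_le_one hb.le hη.le f)).trans (hf₀ hf)
  · rw [mem_closedBall_zero_iff, not_le] at hf
    exact (mul_nonpos_of_nonneg_of_nonpos (hpos f₀).le
      (gaussianGapDensity_nonpos hb hη hf)).trans (hpos f).le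

/-- The kernel whose spectral density is a multiple of `gaussianGapDensity b η`, for a suitable
`η`, normalized so that the broader Gaussian has coefficient one. -/
def gaussianGap (b : ℝ) (t : V) : ℝ :=
  Real.exp (-(‖t‖ ^ 2 / (8 * b))) - Real.exp (-(‖t‖ ^ 2 / (4 * b))) / 2

theorem gaussianGap_zero (b : ℝ) : gaussianGap b (0 : V) = 1 / 2 := by
  norm_num [gaussianGap]

theorem abs_gaussianGap_le {b : ℝ} (hb : 0 < b) (t : V) :
    |gaussianGap b t| ≤ Real.exp (-(‖t‖ ^ 2 / (8 * b))) := by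
  have hle : Real.exp (-(‖t‖ ^ 2 / (4 * b))) ≤ Real.exp (-(‖t‖ ^ 2 / (8 * b))) := by
    refine Real.exp_le_exp.2 (neg_le_neg ?_)
    gcongr
    norm_num
  have hpos := Real.exp_pos (-(‖t‖ ^ 2 / (4 * b)))
  rw [gaussianGap, abs_le]
  constructor <;> linarith

theorem exists_hasFourierDensity_gaussianGap [InnerProductSpace ℝ V] [FiniteDimensional ℝ V]
    [MeasurableSpace V] [BorelSpace V] {b : ℝ} (hb : 0 < b) :
    ∃ α η : ℝ, 0 < α ∧ 0 < η ∧
      HasFourierDensity (gaussianGap b : V → ℝ) (fun f => α * gaussianGapDensity b η f) := by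
  set A := (Real.pi / (2 * b)) ^ (Module.finrank ℝ V / 2 : ℝ) with hA_def
  set A' := (Real.pi / b) ^ (Module.finrank ℝ V / 2 : ℝ) with hA'_def
  have hA : 0 < A := by positivity
  have hA' : 0 < A' := by positivity
  refine ⟨A⁻¹, A / (2 * A'), by positivity, by positivity, ?_⟩
  convert ((hasFourierDensity_gaussian (V := V) (b := 2 * b) (by positivity)).sub
    ((hasFourierDensity_gaussian hb).const_mul (A / (2 * A')))).const_mul A⁻¹ using 2 with t
  · rw [gaussianGap, ← hA_def, ← hA'_def, show 4 * (2 * b) = 8 * b by ring]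
    field_simp
  · rfl

end GaussianGap

section Coercivity

variable {d : ℕ}

theorem exp_neg_div_le {m : ℕ} (hm : m ≠ 0) {n s : ℝ} (hn : 1 ≤ n) (hs : 0 < s) (hs1 : s ≤ 1) :
    Real.exp (-(n / s)) ≤ 2 * m.factorial * s * (1 / (1 + n ^ m)) := by
  have hlower : (1 + n ^ m) / (2 * m.factorial * s) ≤ Real.exp (n / s) :=
    calc (1 + n ^ m) / (2 * m.factorial * s) ≤ (n ^ m + n ^ m) / (2 * m.factorial * s ^ m) := by
          gcongr
          · exact one_le_pow₀ hn
          · exact pow_le_of_le_one hs.le hs1 hm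
      _ = (n / s) ^ m / m.factorial := by rw [div_pow]; field_simp; ring
      _ ≤ Real.exp (n / s) := Real.pow_div_factorial_le_exp _ (by positivity) m
  rw [Real.exp_neg, mul_one_div, ← inv_div (1 + n ^ m)]
  exact inv_anti₀ (by positivity) hlower

theorem Configuration.exp_neg_norm_point_sub_sq_le (c : Configuration d) {β ε s : ℝ}
    (hβ : β < 1 / 2) (hε : ε ∈ Ico 0 β) (hs : 0 < s) (hs1 : s ≤ 1) {a a' : c.index}
    (haa' : a ≠ a') :
    Real.exp (-(‖c.point ε a - c.point ε a'‖ ^ 2 / (s * (1 - 2 * β) ^ 2)))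
      ≤ 2 * (d + 1).factorial * s * weight (c.site a - c.site a') := by
  set r := 1 - 2 * β
  set n := ‖c.site a - c.site a'‖
  have hr : 0 < r := by simp only [r]; linarith
  have hn : 1 ≤ n := c.one_le_norm_site_sub haa'
  have hdist : r * n ≤ ‖c.point ε a - c.point ε a'‖ := by
    refine le_trans ?_ (c.mul_norm_site_sub_le hε.1 a a')
    gcongr
    linarith [hε.2]
  refine le_trans (Real.exp_le_exp.2 (neg_le_neg ?_)) (exp_neg_div_le d.succ_ne_zero hn hs hs1)
  calc n / s ≤ n ^ 2 / s := by gcongr; exact le_self_pow₀ hn two_ne_zero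
    _ = (r * n) ^ 2 / (s * r ^ 2) := by field_simp
    _ ≤ ‖c.point ε a - c.point ε a'‖ ^ 2 / (s * r ^ 2) := by gcongr

-- The matrix of a concentrated kernel `gaussianGap b` is a small perturbation of half the identity.
theorem exists_coercive_gaussianGap {β : ℝ} (hβ : β < 1 / 2) :
    ∃ b : ℝ, 0 < b ∧ ∀ c : Configuration d, ∀ ε ∈ Ico 0 β,
      Coercive (1 / 4) (c.matrix (gaussianGap b) ε) := by
  set W := ∑' y : Fin d → ℤ, weight y
  have hW : 0 ≤ W := tsum_weight_nonneg
  set m := ((d + 1).factorial : ℝ)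
  set s := min 1 (1 / (8 * m * (W + 1)))
  have hs_pos : 0 < s := lt_min one_pos (by positivity)
  have hsW : 2 * m * s * W ≤ 1 / 4 := by
    have hle : s * (8 * m * (W + 1)) ≤ 1 :=
      (le_div_iff₀ (by positivity)).1 (min_le_right 1 (1 / (8 * m * (W + 1))))
    have hms : 0 < m * s := by positivity
    linarith
  have hr : 0 < 1 - 2 * β := by linarith
  refine ⟨s * (1 - 2 * β) ^ 2 / 8, by positivity, fun c ε hε => ?_⟩
  have hnorm : ‖c.matrix (gaussianGap (s * (1 - 2 * β) ^ 2 / 8)) ε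
      - (1 / 2 : ℝ) • (1 : Matrix c.index c.index ℝ)‖ ≤ 1 / 4 := by
    refine (c.norm_le_of_abs_le_weight (C := 2 * m * s) (by positivity) fun a a' => ?_).trans hsW
    obtain rfl | haa' := eq_or_ne a a'
    · have hzero : (c.matrix (gaussianGap (s * (1 - 2 * β) ^ 2 / 8)) ε
          - (1 / 2 : ℝ) • (1 : Matrix c.index c.index ℝ)) a a = 0 := by
        simp [Configuration.matrix, kernelMatrix, gaussianGap_zero]
      rw [hzero, abs_zero]
      exact mul_nonneg (by positivity) (weight_pos _).le
    · rw [Matrix.sub_apply, Matrix.smul_apply, Matrix.one_apply_ne haa', smul_zero, sub_zero]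
      refine (abs_gaussianGap_le (by positivity) _).trans ?_
      rw [mul_div_cancel₀ _ (by norm_num : (8 : ℝ) ≠ 0)]
      exact c.exp_neg_norm_point_sub_sq_le hβ hε hs_pos (min_le_left _ _) haa'
  convert Coercive.of_norm_sub_smul_one_le hnorm using 1
  norm_num

theorem HasFourierDensity.exists_coercive {k κ : EuclideanSpace ℝ (Fin d) → ℝ}
    (hk : HasFourierDensity k κ) (hcont : Continuous κ) (hpos : ∀ f, 0 < κ f) {β : ℝ}
    (hβ : β < 1 / 2) :
    ∃ c : ℝ, 0 < c ∧ ∀ C : Configuration d, ∀ ε ∈ Ico 0 β, Coercive c (C.matrix k ε) := by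
  obtain ⟨b, hb, hcoer⟩ := exists_coercive_gaussianGap (d := d) hβ
  obtain ⟨α, η, hα, hη, hgap⟩ :=
    exists_hasFourierDensity_gaussianGap (V := EuclideanSpace ℝ (Fin d)) hb
  obtain ⟨γ, hγ, hle⟩ := exists_mul_gaussianGapDensity_le hcont hpos hb hη
  refine ⟨γ / α * (1 / 4), by positivity, fun C ε hε =>
    hk.coercive_of_mul_le hgap (by positivity) (fun f => ?_) (hcoer C ε hε)⟩
  rw [← mul_assoc, div_mul_cancel₀ _ hα.ne']
  exact hle f

theorem CovarianceCondition.exists_coercive {p : ℕ} {Θ : Set (Fin p → ℝ)}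
    {K : (Fin p → ℝ) → EuclideanSpace ℝ (Fin d) → ℝ} (hK : CovarianceCondition Θ K)
    {θ : Fin p → ℝ} (hθ : θ ∈ Θ) {β : ℝ} (hβ : β < 1 / 2) :
    ∃ c : ℝ, 0 < c ∧ ∀ C : Configuration d, ∀ ε ∈ Ico 0 β, Coercive c (C.matrix (K θ) ε) := by
  have hre (f : EuclideanSpace ℝ (Fin d)) : ((fourierHat (K θ) f).re : ℂ) = fourierHat (K θ) f :=
    Complex.ext rfl (hK.fourier_real θ hθ f).symm
  have hcont : Continuous fun f => fourierHat (K θ) f :=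
    hK.fourier_continuous.comp_continuous (f := fun f => (f, θ)) (by fun_prop)
      fun _ => ⟨trivial, hθ⟩
  have hdensity : HasFourierDensity (K θ) fun f => (fourierHat (K θ) f).re :=
    ⟨(hK.fourier_integrable θ hθ).re, by simpa only [hre] using hK.fourier_inversion θ hθ⟩
  exact hdensity.exists_coercive (Complex.continuous_re.comp hcont) (hK.fourier_pos θ hθ) hβ

end Coercivity

/-! ### Block decompositions -/

section BlockMask

variable {ι J : Type*} [DecidableEq J]

/-- The matrix `A` with the entries between indices of different labels set to zero: a block
diagonal matrix, up to a permutation of the indices. -/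
def blockMask (l : ι → J) (A : Matrix ι ι ℝ) : Matrix ι ι ℝ :=
  Matrix.of fun a b => if l a = l b then A a b else 0

/-- The diagonal block of `A` with label `j`. -/
def block (l : ι → J) (A : Matrix ι ι ℝ) (j : J) : Matrix {a // l a = j} {a // l a = j} ℝ :=
  A.submatrix Subtype.val Subtype.val

theorem blockMask_submatrix_sigmaFiberEquiv (l : ι → J) (A : Matrix ι ι ℝ) :
    (blockMask l A).submatrix (Equiv.sigmaFiberEquiv l) (Equiv.sigmaFiberEquiv l)
      = Matrix.blockDiagonal' (block l A) := by
  ext ⟨i, a, ha⟩ ⟨j, b, hb⟩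
  obtain rfl | hij := eq_or_ne i j
  · rw [Matrix.blockDiagonal'_apply_eq]
    simp [blockMask, block, Equiv.sigmaFiberEquiv, ha, hb]
  · rw [Matrix.blockDiagonal'_apply_ne _ _ _ hij]
    simp [blockMask, Equiv.sigmaFiberEquiv, ha, hb, hij]

-- The quadratic form of `blockMask l R` at `x` is the sum over the labels `j` of the quadratic form
-- of `R` at the part of `x` with label `j`.
theorem coercive_blockMask [Fintype ι] [Finite J] {c : ℝ} {R : Matrix ι ι ℝ} (hR : Coercive c R)
    (l : ι → J) : Coercive c (blockMask l R) := fun x => by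
  have := Fintype.ofFinite J
  set part : J → ι → ℝ := fun j a => if l a = j then x a else 0 with hpart
  have hnorm : x ⬝ᵥ x = ∑ j, part j ⬝ᵥ part j := by
    simp only [dotProduct]
    rw [Finset.sum_comm]
    simp [hpart]
  have hquad : x ⬝ᵥ (blockMask l R *ᵥ x) = ∑ j, part j ⬝ᵥ (R *ᵥ part j) := by
    simp only [dotProduct, Matrix.mulVec, Finset.mul_sum]
    conv_rhs => rw [Finset.sum_comm]
    refine Finset.sum_congr rfl fun a _ => ?_
    rw [Finset.sum_comm]
    refine Finset.sum_congr rfl fun b _ => ?_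
    by_cases hab : l a = l b <;> simp [hpart, blockMask, hab]
  rw [hnorm, hquad, Finset.mul_sum]
  exact Finset.sum_le_sum fun j _ => hR (part j)

end BlockMask

section BlockDiagonal

variable {J : Type*} [DecidableEq J] {m : J → Type*} [∀ j, DecidableEq (m j)]

theorem diagonal_diag_blockDiagonal' (A : ∀ j, Matrix (m j) (m j) ℝ) :
    Matrix.diagonal (Matrix.blockDiagonal' A).diag
      = Matrix.blockDiagonal' fun j => Matrix.diagonal (A j).diag := by
  rw [Matrix.blockDiagonal'_diagonal]
  congr 1
  funext a
  exact Matrix.blockDiagonal'_apply_eq A a.1 a.2 a.2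

theorem inv_blockDiagonal' [Fintype J] [∀ j, Fintype (m j)] {A : ∀ j, Matrix (m j) (m j) ℝ}
    (hA : ∀ j, IsUnit (A j).det) :
    (Matrix.blockDiagonal' A)⁻¹ = Matrix.blockDiagonal' fun j => (A j)⁻¹ := by
  refine Matrix.inv_eq_right_inv ?_
  rw [← Matrix.blockDiagonal'_mul, ← Matrix.blockDiagonal'_one]
  congr 1
  funext j
  exact Matrix.mul_nonsing_inv _ (hA j)

end BlockDiagonal

namespace MatExpr

variable {σ ι κ : Type*} [DecidableEq ι] [DecidableEq κ] [Fintype ι] [Fintype κ]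

theorem eval_submatrix (e : MatExpr σ) (R : Matrix ι ι ℝ) (D : σ → Matrix ι ι ℝ) (f : κ ≃ ι) :
    e.eval (R.submatrix f f) (fun i => (D i).submatrix f f) = (e.eval R D).submatrix f f := by
  have hdiag (A : Matrix ι ι ℝ) :
      Matrix.diagonal (A.submatrix f f).diag = (Matrix.diagonal A.diag).submatrix f f := by
    rw [Matrix.submatrix_diagonal_equiv]
    rfl
  induction e with
  | base | var i => rfl
  | baseInv => exact Matrix.inv_submatrix_equiv R f f
  | diagInv => simp only [eval, Matrix.inv_submatrix_equiv, hdiag]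
  | add e f he hf => simp only [eval, he, hf]; rfl
  | smul c e he => simp only [eval, he]; rfl
  | mul e f he hf => simp only [eval, he, hf, Matrix.submatrix_mul_equiv]
  | diag e he => simp only [eval, he, hdiag]
  | transpose e he => simp only [eval, he]; rfl

theorem trace_eval_submatrix (e : MatExpr σ) (R : Matrix ι ι ℝ) (D : σ → Matrix ι ι ℝ)
    (f : κ ≃ ι) :
    (e.eval (R.submatrix f f) fun i => (D i).submatrix f f).trace = (e.eval R D).trace := by
  rw [e.eval_submatrix]
  exact f.sum_comp fun a => e.eval R D a a

variable {J : Type*} [DecidableEq J] [Fintype J]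

theorem eval_blockDiagonal' {m : J → Type*} [∀ j, DecidableEq (m j)] [∀ j, Fintype (m j)]
    (e : MatExpr σ) {R : ∀ j, Matrix (m j) (m j) ℝ} (D : σ → ∀ j, Matrix (m j) (m j) ℝ) {c : ℝ}
    (hc : 0 < c) (hR : ∀ j, Coercive c (R j)) :
    e.eval (Matrix.blockDiagonal' R) (fun i => Matrix.blockDiagonal' (D i))
      = Matrix.blockDiagonal' fun j => e.eval (R j) fun i => D i j := by
  have hinv : (Matrix.blockDiagonal' R)⁻¹ = Matrix.blockDiagonal' fun j => (R j)⁻¹ :=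
    inv_blockDiagonal' fun j => (hR j).isUnit_det hc
  induction e with
  | base | var i => rfl
  | baseInv => exact hinv
  | diagInv =>
    rw [eval, hinv, diagonal_diag_blockDiagonal', inv_blockDiagonal' fun j => ?_]
    · rfl
    · exact (hR j).isUnit_det_diagonal_diag_inv hc (le_max_left _ 1)
        (one_pos.trans_le (le_max_right _ _))
  | add e f he hf => simp only [eval, he, hf]; exact (Matrix.blockDiagonal'_add _ _).symm
  | smul c e he => simp only [eval, he]; exact (Matrix.blockDiagonal'_smul c _).symm
  | mul e f he hf => simp only [eval, he, hf]; exact (Matrix.blockDiagonal'_mul _ _).symm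
  | diag e he => simp only [eval, he, diagonal_diag_blockDiagonal']
  | transpose e he => simp only [eval, he]; exact Matrix.blockDiagonal'_transpose _

theorem trace_eval_blockMask (e : MatExpr σ) (l : ι → J) (R : Matrix ι ι ℝ)
    (D : σ → Matrix ι ι ℝ) {c : ℝ} (hc : 0 < c) (hR : ∀ j, Coercive c (block l R j)) :
    (e.eval (blockMask l R) fun i => blockMask l (D i)).trace
      = ∑ j, (e.eval (block l R j) fun i => block l (D i) j).trace := by
  rw [← e.trace_eval_submatrix _ _ (Equiv.sigmaFiberEquiv l)]
  simp only [blockMask_submatrix_sigmaFiberEquiv]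
  rw [e.eval_blockDiagonal' _ hc hR, Matrix.trace_blockDiagonal']

end MatExpr

/-! ### Cutting configurations into blocks -/

section BlockApproximation

variable {d : ℕ} {σ : Type*}

/-- A regular kernel `k` with uniformly coercive matrices, and a family of further regular
kernels. -/
structure AdmissibleKernels (k : EuclideanSpace ℝ (Fin d) → ℝ)
    (D : σ → EuclideanSpace ℝ (Fin d) → ℝ) : Prop where
  regular : RegularKernel k
  regular_var : ∀ i, RegularKernel (D i)
  coercive : ∀ β < (1 / 2 : ℝ), ∃ r : ℝ, 0 < r ∧ ∀ c : Configuration d, ∀ ε ∈ Ico 0 β,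
    Coercive r (c.matrix k ε)

section ExprTrace

variable {E ι κ : Type*} [Fintype ι] [Fintype κ] [DecidableEq ι] [DecidableEq κ]

/-- The trace of a matrix expression in the matrices of the kernels `k` and `D i` at the points
`y`. -/
def exprTrace [Sub E] (e : MatExpr σ) (k : E → ℝ) (D : σ → E → ℝ) (y : ι → E) : ℝ :=
  (e.eval (kernelMatrix k y) fun i => kernelMatrix (D i) y).trace

theorem exprTrace_comp_equiv [Sub E] (e : MatExpr σ) (k : E → ℝ) (D : σ → E → ℝ) (y : ι → E)
    (f : κ ≃ ι) : exprTrace e k D (y ∘ f) = exprTrace e k D y :=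
  e.trace_eval_submatrix (kernelMatrix k y) (fun i => kernelMatrix (D i) y) f

theorem exprTrace_const_add [AddCommGroup E] (e : MatExpr σ) (k : E → ℝ) (D : σ → E → ℝ)
    (y : ι → E) (z : E) : exprTrace e k D (fun a => z + y a) = exprTrace e k D y := by
  simp only [exprTrace, kernelMatrix, add_sub_add_left_eq_sub]

end ExprTrace

namespace Configuration

/-- The configuration obtained by an injective change of the indices. -/
def reindex (c : Configuration d) {κ : Type} [Fintype κ] [DecidableEq κ] (f : κ → c.index)
    (hf : Function.Injective f) : Configuration d where
  index := κ
  site := c.site ∘ f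
  site_injective := c.site_injective.comp hf
  shift := c.shift ∘ f
  abs_shift_le a := c.abs_shift_le (f a)

variable {J : Type*} [DecidableEq J] (c : Configuration d) (l : c.index → J)

/-- The part of a configuration with label `j`. -/
def fiber (j : J) : Configuration d :=
  c.reindex (Subtype.val : {a // l a = j} → c.index) Subtype.val_injective

/-- The total weight of the pairs of points with different labels. -/
def crossWeight : ℝ :=
  ∑ a, ∑ b, if l a = l b then 0 else weight (c.site a - c.site b)

theorem crossWeight_nonneg : 0 ≤ c.crossWeight l :=
  Finset.sum_nonneg fun a _ => Finset.sum_nonneg fun b _ => by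
    split_ifs
    · exact le_rfl
    · exact (weight_pos _).le

theorem traceNormLE_sub_blockMask {A : Matrix c.index c.index ℝ} {C : ℝ}
    (hA : ∀ a b, |A a b| ≤ C * weight (c.site a - c.site b)) :
    TraceNormLE (A - blockMask l A) (C * c.crossWeight l) := by
  refine .of_sum_abs_le ?_
  simp only [crossWeight, Finset.mul_sum]
  refine Finset.sum_le_sum fun a _ => Finset.sum_le_sum fun b _ => ?_
  by_cases hab : l a = l b
  · simp [blockMask, hab]
  · simpa [blockMask, hab] using hA a b

end Configuration

/-- A configuration together with a map from its index set to finitely many labels. -/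
abbrev LabelledConfiguration (d : ℕ) : Type 1 :=
  Σ (c : Configuration d) (J : ℕ), c.index → Fin J

theorem RegularKernel.traceNormClose_blockMask {h : EuclideanSpace ℝ (Fin d) → ℝ}
    (hh : RegularKernel h) {β ε : ℝ} (hβ : β < 1 / 2) (hε : ε ∈ Ico 0 β) :
    TraceNormClose (fun τ : LabelledConfiguration d => τ.1.crossWeight τ.2.2)
      fun τ s => bif s then τ.1.matrix h ε else blockMask τ.2.2 (τ.1.matrix h ε) := by
  obtain ⟨C, hC0, hC⟩ := hh.exists_abs_jet_le hβ (m := 0) (by norm_num)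
  simp only [Configuration.jet_zero] at hC
  refine ⟨⟨C * ∑' y : Fin d → ℤ, weight y, fun τ s _ => ?_⟩, C, hC0, fun τ =>
    τ.1.traceNormLE_sub_blockMask τ.2.2 (hC τ.1 ε hε)⟩
  refine τ.1.norm_le_of_abs_le_weight hC0 fun a b => ?_
  cases s with
  | true => exact hC τ.1 ε hε a b
  | false =>
    by_cases hab : τ.2.2 a = τ.2.2 b
    · simpa [blockMask, hab] using hC τ.1 ε hε a b
    · simpa [blockMask, hab] using mul_nonneg hC0 (weight_pos (τ.1.site a - τ.1.site b)).le

namespace AdmissibleKernels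

variable {k : EuclideanSpace ℝ (Fin d) → ℝ} {D : σ → EuclideanSpace ℝ (Fin d) → ℝ}

theorem uniformlyBoundedJetOn_eval (h : AdmissibleKernels k D) (e : MatExpr σ) {β : ℝ}
    (hβ : β < 1 / 2) :
    UniformlyBoundedJetOn (Ico 0 β) 3
      fun (c : Configuration d) ε => e.eval (c.matrix k ε) fun i => c.matrix (D i) ε := by
  obtain ⟨r, hr, hcoer⟩ := h.coercive β hβ
  have hk := h.regular.uniformlyBoundedJetOn_matrix hβ
  exact (closedUnderMatExpr_uniformlyBoundedJetOn (Ico 0 β) 3).eval hk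
    (fun i => (h.regular_var i).uniformlyBoundedJetOn_matrix hβ) hk.uniformlyBoundedOn hr hcoer e

theorem uniformlyBoundedJetOn_exprTrace (h : AdmissibleKernels k D) (e : MatExpr σ) {β : ℝ}
    (hβ : β < 1 / 2) :
    UniformlyBoundedJetOn (E := fun _ => ℝ) (Ico 0 β) 3 fun (c : Configuration d) ε =>
      1 / (Fintype.card c.index : ℝ) * exprTrace e k D (c.point ε) := by
  refine (h.uniformlyBoundedJetOn_eval e hβ).map (c := 1)
    (fun c => (1 / (Fintype.card c.index : ℝ)) • Matrix.traceLinearMap c.index ℝ ℝ) fun c A => ?_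
  change ‖1 / (Fintype.card c.index : ℝ) * A.trace‖ ≤ 1 * ‖A‖
  rw [norm_mul, Real.norm_of_nonneg (by positivity), one_mul, one_div]
  exact inv_mul_le_of_le_mul₀ (by positivity) (norm_nonneg A) (norm_trace_le A)

theorem exists_abs_exprTrace_le (h : AdmissibleKernels k D) (e : MatExpr σ) {ε : ℝ}
    (hε : ε ∈ Ico (0 : ℝ) (1 / 2)) :
    ∃ C : ℝ, 0 ≤ C ∧ ∀ c : Configuration d,
      |exprTrace e k D (c.point ε)| ≤ C * Fintype.card c.index := by
  obtain ⟨β, hεβ, hβ⟩ := exists_between hε.2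
  obtain ⟨C, hC0, hC⟩ := (h.uniformlyBoundedJetOn_eval e hβ).uniformlyBoundedOn.exists_nonneg
  refine ⟨C, hC0, fun c => ?_⟩
  rw [mul_comm]
  exact (norm_trace_le (e.eval (c.matrix k ε) fun i => c.matrix (D i) ε)).trans
    (mul_le_mul_of_nonneg_left (hC c ε ⟨hε.1, hεβ⟩) (Nat.cast_nonneg _))

theorem traceNormClose_eval_blockMask (h : AdmissibleKernels k D) (e : MatExpr σ) {β ε : ℝ}
    (hβ : β < 1 / 2) (hε : ε ∈ Ico 0 β) :
    TraceNormClose (fun τ : LabelledConfiguration d => τ.1.crossWeight τ.2.2)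
      fun τ s => e.eval (bif s then τ.1.matrix k ε else blockMask τ.2.2 (τ.1.matrix k ε))
        fun i => bif s then τ.1.matrix (D i) ε else blockMask τ.2.2 (τ.1.matrix (D i) ε) := by
  obtain ⟨r, hr, hcoer⟩ := h.coercive β hβ
  have hk := h.regular.traceNormClose_blockMask hβ hε
  refine (closedUnderMatExpr_traceNormClose fun τ => τ.1.crossWeight_nonneg _).eval hk
    (fun i => (h.regular_var i).traceNormClose_blockMask hβ hε) hk.1 hr (fun τ s _ => ?_) e
  cases s with
  | true => exact hcoer τ.1 ε hε
  | false => exact coercive_blockMask (hcoer τ.1 ε hε) _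

theorem exists_abs_exprTrace_sub_sum_fiber_le (h : AdmissibleKernels k D) (e : MatExpr σ) {ε : ℝ}
    (hε : ε ∈ Ico (0 : ℝ) (1 / 2)) :
    ∃ C : ℝ, 0 ≤ C ∧ ∀ (c : Configuration d) (J : ℕ) (l : c.index → Fin J),
      |exprTrace e k D (c.point ε) - ∑ j, exprTrace e k D ((c.fiber l j).point ε)|
        ≤ C * c.crossWeight l := by
  obtain ⟨β, hεβ, hβ⟩ := exists_between hε.2
  have hεβ' : ε ∈ Ico 0 β := ⟨hε.1, hεβ⟩
  obtain ⟨r, hr, hcoer⟩ := h.coercive β hβ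
  obtain ⟨-, C, hC0, hC⟩ := h.traceNormClose_eval_blockMask e hβ hεβ'
  refine ⟨C, hC0, fun c J l => ?_⟩
  have hclose : TraceNormLE
      ((e.eval (c.matrix k ε) fun i => c.matrix (D i) ε)
        - e.eval (blockMask l (c.matrix k ε)) fun i => blockMask l (c.matrix (D i) ε))
      (C * c.crossWeight l) := hC ⟨c, J, l⟩
  have htrace := hclose.abs_trace_le (mul_nonneg hC0 (c.crossWeight_nonneg l))
  have hblock (j : Fin J) : Coercive r (block l (c.matrix k ε) j) := hcoer (c.fiber l j) ε hεβ'
  rw [Matrix.trace_sub, e.trace_eval_blockMask l _ _ hr hblock] at htrace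
  exact htrace

end AdmissibleKernels

end BlockApproximation

/-! ### Cubes of lattice points -/

section Cubes

variable {d : ℕ}

/-- The lattice points of the cube `[0, N)^d`. -/
def latticeCube (d N : ℕ) : Set (Fin d → ℤ) := {z | ∀ k, z k ∈ Ico 0 (N : ℤ)}

/-- The parametrization of `[0, N)^d ∩ ℤ^d` by `Fin d → Fin N`. -/
def cubeSite (d N : ℕ) (w : Fin d → Fin N) : Fin d → ℤ := fun k => ((w k : ℕ) : ℤ)

/-- The proportion of the integers `i` in `[0, N)` such that `i - m` is in `[0, N)`. -/
def overlap (N : ℕ) (m : ℤ) : ℝ := ((N - m.natAbs : ℕ) : ℝ) / N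

theorem overlap_nonneg (N : ℕ) (m : ℤ) : 0 ≤ overlap N m := by unfold overlap; positivity

theorem overlap_le_one (N : ℕ) (m : ℤ) : overlap N m ≤ 1 :=
  div_le_one_of_le₀ (Nat.cast_le.2 (Nat.sub_le _ _)) N.cast_nonneg

theorem tendsto_overlap (m : ℤ) : Tendsto (fun N => overlap N m) atTop (𝓝 1) := by
  have hlim : Tendsto (fun N : ℕ => 1 - (m.natAbs : ℝ) / N) atTop (𝓝 1) := by
    simpa using (tendsto_const_div_atTop_nhds_zero_nat (m.natAbs : ℝ)).const_sub 1
  refine hlim.congr' ?_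
  filter_upwards [eventually_gt_atTop m.natAbs] with N hN
  rw [overlap, Nat.cast_sub hN.le, sub_div, div_self (Nat.cast_ne_zero.2 (by omega))]

theorem card_filter_sub_mem_Ico (N : ℕ) (m : ℤ) :
    (Finset.univ.filter fun i : Fin N => (i : ℤ) - m ∈ Ico 0 (N : ℤ)).card = N - m.natAbs := by
  have himage : (Finset.univ.filter fun i : Fin N => (i : ℤ) - m ∈ Ico 0 (N : ℤ)).image
      (fun i : Fin N => (i : ℤ)) = Finset.Ico (max 0 m) (min N (N + m)) := by
    ext z
    simp only [Finset.mem_image, Finset.mem_filter, Finset.mem_univ, true_and, Finset.mem_Ico,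
      Set.mem_Ico]
    constructor
    · rintro ⟨i, hi, rfl⟩
      omega
    · intro hz
      exact ⟨⟨z.toNat, by omega⟩, by grind, by grind⟩
  have hinj : Function.Injective fun i : Fin N => (i : ℤ) :=
    Nat.cast_injective.comp Fin.val_injective
  rw [← Finset.card_image_of_injective _ hinj, himage, Int.card_Ico]
  omega

open scoped Classical in
theorem card_filter_cubeSite_sub_mem {N : ℕ} (hN : 0 < N) (y : Fin d → ℤ) :
    ((Finset.univ.filter fun w => cubeSite d N w - y ∈ latticeCube d N).card : ℝ)
      = (N : ℝ) ^ d * ∏ k, overlap N (y k) := by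
  have hpi : (Finset.univ.filter fun w => cubeSite d N w - y ∈ latticeCube d N)
      = Fintype.piFinset fun k =>
        Finset.univ.filter fun i : Fin N => (i : ℤ) - y k ∈ Ico 0 (N : ℤ) := by
    ext w
    simp [latticeCube, cubeSite]
  have hN' : (N : ℝ) ≠ 0 := Nat.cast_ne_zero.2 hN.ne'
  rw [hpi, Fintype.card_piFinset, ← Fin.prod_const, ← Finset.prod_mul_distrib, Nat.cast_prod]
  refine Finset.prod_congr rfl fun k _ => ?_
  rw [card_filter_sub_mem_Ico, overlap, mul_div_cancel₀ _ hN']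

/-- The average over the points of a cube of side `N` of the total weight of the differences with
the lattice points outside of the cube. -/
def cubeLoss (d N : ℕ) : ℝ := ∑' y : Fin d → ℤ, weight y * (1 - ∏ k, overlap N (y k))

theorem one_sub_prod_overlap_mem_Icc (N : ℕ) (y : Fin d → ℤ) :
    1 - ∏ k, overlap N (y k) ∈ Icc (0 : ℝ) 1 :=
  ⟨sub_nonneg.2 (Finset.prod_le_one (fun _ _ => overlap_nonneg _ _) fun _ _ => overlap_le_one _ _),
    sub_le_self _ (Finset.prod_nonneg fun _ _ => overlap_nonneg _ _)⟩

theorem cubeLoss_nonneg (d N : ℕ) : 0 ≤ cubeLoss d N :=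
  tsum_nonneg fun y => mul_nonneg (weight_pos y).le (one_sub_prod_overlap_mem_Icc N y).1

theorem tendsto_cubeLoss (d : ℕ) : Tendsto (cubeLoss d) atTop (𝓝 0) := by
  have hterm (y : Fin d → ℤ) :
      Tendsto (fun N => weight y * (1 - ∏ k, overlap N (y k))) atTop (𝓝 0) := by
    have hprod : Tendsto (fun N => ∏ k, overlap N (y k)) atTop (𝓝 (∏ _k : Fin d, 1)) :=
      tendsto_finsetProd _ fun k _ => tendsto_overlap (y k)
    simpa using (hprod.const_sub 1).const_mul (weight y)
  have hbound (N : ℕ) (y : Fin d → ℤ) : ‖weight y * (1 - ∏ k, overlap N (y k))‖ ≤ weight y := by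
    obtain ⟨hnonneg, hle⟩ := one_sub_prod_overlap_mem_Icc N y
    rw [Real.norm_of_nonneg (mul_nonneg (weight_pos y).le hnonneg)]
    exact mul_le_of_le_one_right (weight_pos y).le hle
  simpa only [tsum_zero] using! tendsto_tsum_of_dominated_convergence summable_weight hterm
    (.of_forall hbound)

open scoped Classical in
theorem summable_ite_weight (p : (Fin d → ℤ) → Prop) :
    Summable fun y => if p y then 0 else weight y := by
  refine summable_weight.of_nonneg_of_le (fun y => ?_) fun y => ?_
  all_goals split_ifs <;> simp [(weight_pos y).le]

open scoped Classical in
theorem sum_tsum_ite_cubeSite_sub_mem {N : ℕ} (hN : 0 < N) :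
    ∑ w, ∑' y : Fin d → ℤ, (if cubeSite d N w - y ∈ latticeCube d N then 0 else weight y)
      = (N : ℝ) ^ d * cubeLoss d N := by
  rw [← Summable.tsum_finsetSum fun w _ =>
    summable_ite_weight fun y => cubeSite d N w - y ∈ latticeCube d N, cubeLoss, ← tsum_mul_left]
  refine tsum_congr fun y => ?_
  have hcompl : ∑ w, (if cubeSite d N w - y ∈ latticeCube d N then 0 else weight y)
      = ∑ w, (weight y - weight y * if cubeSite d N w - y ∈ latticeCube d N then 1 else 0) :=
    Finset.sum_congr rfl fun w _ => by split_ifs <;> simp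
  rw [hcompl, Finset.sum_sub_distrib, ← Finset.mul_sum, Finset.sum_boole,
    card_filter_cubeSite_sub_mem hN, Finset.sum_const, Finset.card_univ, Fintype.card_fun,
    Fintype.card_fin, Fintype.card_fin, nsmul_eq_mul, Nat.cast_pow]
  ring

open scoped Classical in
theorem sum_ite_sub_mem_latticeCube_le {N : ℕ} (hN : 0 < N) {ι : Type*} [Fintype ι]
    {z : ι → Fin d → ℤ} (hz : Function.Injective z) (q : Fin d → ℤ) :
    ∑ w, ∑ b, (if z b - q ∈ latticeCube d N then 0 else weight (q + cubeSite d N w - z b))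
      ≤ (N : ℝ) ^ d * cubeLoss d N := by
  rw [← sum_tsum_ite_cubeSite_sub_mem hN]
  refine Finset.sum_le_sum fun w _ => ?_
  rw [← tsum_fintype (L := .unconditional _)]
  refine Summable.tsum_le_tsum_of_inj (fun b => q + cubeSite d N w - z b)
    (sub_right_injective.comp hz) (fun y _ => ?_) (fun b => le_of_eq ?_) .of_finite
    (summable_ite_weight fun y => cubeSite d N w - y ∈ latticeCube d N)
  · split_ifs
    exacts [le_rfl, (weight_pos y).le]
  · rw [show cubeSite d N w - (q + cubeSite d N w - z b) = z b - q by abel]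

end Cubes

/-! ### Enumerations exhausting the cubes -/

namespace IsGridEnumeration

variable {d : ℕ} {v : ℕ → Fin d → ℕ} (hv : IsGridEnumeration v)

include hv

theorem apply_mem_Icc {N a : ℕ} (ha : a < N ^ d) (hN : 0 < N) (k : Fin d) :
    1 ≤ v a k ∧ v a k ≤ N :=
  (hv N hN).subset (mem_image_of_mem v ha) k

theorem exists_lt_pow_eq {N : ℕ} (hN : 0 < N) {w : Fin d → ℕ} (hw : ∀ k, 1 ≤ w k ∧ w k ≤ N) :
    ∃ a < N ^ d, v a = w :=
  (hv N hN).superset hw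

theorem injOn_lt_pow {N : ℕ} (hN : 0 < N) : InjOn v {a | a < N ^ d} := by
  classical
  have himage : (Finset.range (N ^ d)).image v = Fintype.piFinset fun _ => Finset.Icc 1 N := by
    ext w
    simpa using! Set.ext_iff.1 (hv N hN) w
  have hcard : ((Finset.range (N ^ d)).image v).card = (Finset.range (N ^ d)).card := by
    simp [himage]
  simpa only [Finset.coe_range, Iio_def] using Finset.card_image_iff.1 hcard

variable (hd : 0 < d)

include hd

theorem injective : Function.Injective v := fun a b hab => by
  have hlt {c : ℕ} (hc : c ≤ max a b) : c < (max a b + 1) ^ d :=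
    (Nat.lt_succ_of_le hc).trans_le (Nat.le_self_pow hd.ne' _)
  exact hv.injOn_lt_pow (Nat.succ_pos _) (hlt (le_max_left a b)) (hlt (le_max_right a b)) hab

theorem one_le (a : ℕ) (k : Fin d) : 1 ≤ v a k :=
  (hv.apply_mem_Icc (a.lt_succ_self.trans_le (Nat.le_self_pow hd.ne' _)) a.succ_pos k).1

theorem lt_pow_iff (N a : ℕ) : a < N ^ d ↔ ∀ k, v a k ≤ N := by
  refine ⟨fun ha k => ?_, fun h => ?_⟩
  · have hN : 0 < N := Nat.pos_of_ne_zero fun hN => by simp [hN, hd.ne'] at ha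
    exact (hv.apply_mem_Icc ha hN k).2
  · have hN : 0 < N := (hv.one_le hd a ⟨0, hd⟩).trans (h _)
    obtain ⟨b, hb, hvb⟩ := hv.exists_lt_pow_eq hN fun k => ⟨hv.one_le hd a k, h k⟩
    rwa [← hv.injective hd hvb]

theorem bijective_sub_one : Function.Bijective fun a k => v a k - 1 := by
  refine ⟨fun a b hab => hv.injective hd (funext fun k => ?_), fun w => ?_⟩
  · have hk : v a k - 1 = v b k - 1 := congrFun hab k
    have := hv.one_le hd a k
    have := hv.one_le hd b k
    omega
  · obtain ⟨a, -, ha⟩ := hv.exists_lt_pow_eq (Nat.succ_pos (∑ k, w k)) (w := fun k => w k + 1)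
      fun k => ⟨Nat.le_add_left 1 _, Nat.succ_le_succ
        (Finset.single_le_sum (fun _ _ => Nat.zero_le _) (Finset.mem_univ k))⟩
    exact ⟨a, funext fun k => by simp [ha]⟩

end IsGridEnumeration

/-- An enumeration of `ℕ^d` that exhausts the cubes `[0, N)^d` one after the other. -/
structure CubeEnumeration (d : ℕ) where
  /-- The enumeration. -/
  equiv : ℕ ≃ (Fin d → ℕ)
  lt_pow_iff : ∀ N a, a < N ^ d ↔ ∀ k, equiv a k < N

namespace CubeEnumeration

variable {d : ℕ}

/-- The translate by `(-1, …, -1)` of a grid enumeration. -/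
def ofIsGridEnumeration {v : ℕ → Fin d → ℕ} (hv : IsGridEnumeration v) (hd : 0 < d) :
    CubeEnumeration d where
  equiv := Equiv.ofBijective _ (hv.bijective_sub_one hd)
  lt_pow_iff N a := by
    rw [hv.lt_pow_iff hd]
    refine forall_congr' fun k => ?_
    have := hv.one_le hd a k
    simp only [Equiv.ofBijective_apply]
    omega

variable (E : CubeEnumeration d)

/-- The lattice points of the enumeration. -/
def site (a : ℕ) : Fin d → ℤ := fun k => (E.equiv a k : ℤ)

theorem site_injective : Function.Injective E.site := fun _ _ h =>
  E.equiv.injective (funext fun k => Int.ofNat_inj.1 (congrFun h k))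

/-- The number `j` of the cube `N • site j + [0, N)^d` that contains the point of number `a`. -/
def cubeOf (N a : ℕ) : ℕ := E.equiv.symm fun k => E.equiv a k / N

/-- The number of the point at offset `w` in the cube of number `j`. -/
def indexOf {N : ℕ} (j : ℕ) (w : Fin d → Fin N) : ℕ := E.equiv.symm fun k => N * E.equiv j k + w k

theorem equiv_indexOf {N : ℕ} (j : ℕ) (w : Fin d → Fin N) (k : Fin d) :
    E.equiv (E.indexOf j w) k = N * E.equiv j k + w k := by
  rw [indexOf, Equiv.apply_symm_apply]

theorem site_indexOf {N : ℕ} (j : ℕ) (w : Fin d → Fin N) :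
    E.site (E.indexOf j w) = N • E.site j + cubeSite d N w := by
  funext k
  simp [site, equiv_indexOf, cubeSite]

theorem cubeOf_indexOf {N : ℕ} (j : ℕ) (w : Fin d → Fin N) : E.cubeOf N (E.indexOf j w) = j := by
  rw [cubeOf, Equiv.symm_apply_eq]
  funext k
  rw [equiv_indexOf, Nat.mul_add_div (w k).pos, Nat.div_eq_of_lt (w k).2, add_zero]

theorem cubeOf_lt_iff {N : ℕ} (hN : 0 < N) (m a : ℕ) :
    E.cubeOf N a < m ^ d ↔ a < (m * N) ^ d := by
  simp only [E.lt_pow_iff, cubeOf, Equiv.apply_symm_apply]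
  exact forall_congr' fun k => Nat.div_lt_iff_lt_mul hN

theorem cubeOf_eq_iff {N : ℕ} (hN : 0 < N) (j a : ℕ) :
    E.cubeOf N a = j ↔ E.site a - N • E.site j ∈ latticeCube d N := by
  rw [cubeOf, Equiv.symm_apply_eq, funext_iff]
  refine forall_congr' fun k => ?_
  have hcorner : (N • E.site j) k = ((E.equiv j k * N : ℕ) : ℤ) := by
    simp [site, mul_comm]
  rw [Pi.sub_apply, hcorner, site, Nat.div_eq_iff hN, Set.mem_Ico]
  omega

theorem indexOf_injective {N : ℕ} (j : ℕ) :
    Function.Injective (E.indexOf j : (Fin d → Fin N) → ℕ) := fun w w' h => by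
  funext k
  have hk := E.equiv_indexOf j w k
  rw [h, equiv_indexOf] at hk
  exact Fin.ext (by omega)

/-- The configuration of the first `n` points. -/
def configuration (x : ℕ → EuclideanSpace ℝ (Fin d)) (hx : ∀ a k, |x a k| ≤ 1) (n : ℕ) :
    Configuration d where
  index := Fin n
  site a := E.site a
  site_injective := E.site_injective.comp Fin.val_injective
  shift a := x a
  abs_shift_le a := hx a

/-- The cube containing one of the first `n` points; the points outside of the first `m^d` cubes
get a common label. -/
def label (N m : ℕ) {n : ℕ} (a : Fin n) : Fin (m ^ d + 1) :=
  ⟨min (E.cubeOf N a) (m ^ d), by omega⟩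

theorem label_eq_castSucc {N m n : ℕ} (a : Fin n) (j : Fin (m ^ d)) :
    E.label N m a = j.castSucc ↔ E.cubeOf N a = j := by
  rw [label, Fin.ext_iff, Fin.val_castSucc]
  have := j.2
  grind

section Fibers

variable {N m n : ℕ} (hN : 0 < N) (hn : (m * N) ^ d ≤ n)

include hN hn

/-- The points of a cube are parametrized by their offsets. -/
def fiberEquiv (j : Fin (m ^ d)) :
    (Fin d → Fin N) ≃ {a : Fin n // E.label N m a = j.castSucc} where
  toFun w :=
    ⟨⟨E.indexOf j w,
      ((E.cubeOf_lt_iff hN m _).1 (by rw [E.cubeOf_indexOf]; exact j.2)).trans_le hn⟩,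
      (E.label_eq_castSucc _ j).2 (E.cubeOf_indexOf _ _)⟩
  invFun a k := ⟨E.equiv a.1 k % N, Nat.mod_lt _ hN⟩
  left_inv w := by
    funext k
    refine Fin.ext ?_
    simp only [equiv_indexOf, Nat.mul_add_mod, Nat.mod_eq_of_lt (w k).2]
  right_inv a := by
    refine Subtype.ext (Fin.ext ?_)
    simp only [indexOf, Equiv.symm_apply_eq, ← (E.label_eq_castSucc a.1 j).1 a.2, cubeOf,
      Equiv.apply_symm_apply, Nat.div_add_mod]

theorem card_fiber_last :
    (Fintype.card {a : Fin n // E.label N m a = Fin.last (m ^ d)} : ℝ)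
      = n - ((m * N) ^ d : ℕ) := by
  have hcube (j : Fin (m ^ d)) :
      Fintype.card {a : Fin n // E.label N m a = j.castSucc} = N ^ d := by
    simp [← Fintype.card_congr (E.fiberEquiv hN hn j)]
  have hsum := Fintype.card_congr (Equiv.sigmaFiberEquiv (E.label N m : Fin n → _))
  simp only [Fintype.card_sigma, Fin.sum_univ_castSucc, hcube, Finset.sum_const, Finset.card_univ,
    Fintype.card_fin, smul_eq_mul, ← mul_pow] at hsum
  rw [eq_sub_iff_add_eq, add_comm]
  exact_mod_cast hsum

variable (x : ℕ → EuclideanSpace ℝ (Fin d)) (hx : ∀ a k, |x a k| ≤ 1)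

theorem exprTrace_fiber {σ : Type*} (e : MatExpr σ) (k : EuclideanSpace ℝ (Fin d) → ℝ)
    (D : σ → EuclideanSpace ℝ (Fin d) → ℝ) (ε : ℝ) (j : Fin (m ^ d)) :
    exprTrace e k D (((E.configuration x hx n).fiber (E.label N m) j.castSucc).point ε)
      = exprTrace e k D (perturbedPoint (cubeSite d N) (fun w => x (E.indexOf j w)) ε) := by
  rw [← exprTrace_const_add e k D (perturbedPoint (cubeSite d N) (fun w => x (E.indexOf j w)) ε)
    (WithLp.toLp 2 fun l => ((N • E.site j) l : ℝ))]
  refine (exprTrace_comp_equiv e k D _ (E.fiberEquiv hN hn j)).symm.trans (congrArg _ ?_)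
  funext w
  change perturbedPoint E.site x ε (E.indexOf j w) = _
  ext l
  simp [perturbedPoint, site_indexOf, add_assoc]

theorem sum_ite_label_eq_castSucc_le (j : Fin (m ^ d)) :
    ∑ a : {a : Fin n // E.label N m a = j.castSucc}, ∑ b : Fin n,
      (if E.label N m a.1 = E.label N m b then 0 else weight (E.site a.1 - E.site b))
      ≤ (N : ℝ) ^ d * cubeLoss d N := by
  classical
  rw [← (E.fiberEquiv hN hn j).sum_comp]
  refine le_trans (le_of_eq ?_) (sum_ite_sub_mem_latticeCube_le hN
    (E.site_injective.comp (Fin.val_injective (n := n))) (N • E.site j))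
  refine Finset.sum_congr rfl fun w _ => Finset.sum_congr rfl fun b _ => ?_
  rw [← E.site_indexOf, (E.fiberEquiv hN hn j w).2]
  refine if_congr (eq_comm.trans ?_) rfl rfl
  exact (E.label_eq_castSucc b j).trans (E.cubeOf_eq_iff hN j b)

theorem crossWeight_label_le :
    (E.configuration x hx n).crossWeight (E.label N m)
      ≤ ((m * N) ^ d : ℕ) * cubeLoss d N
        + (n - ((m * N) ^ d : ℕ)) * ∑' y : Fin d → ℤ, weight y := by
  change ∑ a : Fin n, ∑ b : Fin n,
    (if E.label N m a = E.label N m b then 0 else weight (E.site a - E.site b)) ≤ _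
  rw [← (Equiv.sigmaFiberEquiv fun a : Fin n => E.label N m a).sum_comp, Fintype.sum_sigma,
    Fin.sum_univ_castSucc]
  refine add_le_add ?_ ?_
  · refine (Finset.sum_le_sum fun j _ => E.sum_ite_label_eq_castSucc_le hN hn j).trans_eq ?_
    simp [mul_pow, mul_assoc]
  · rw [← E.card_fiber_last hN hn, ← nsmul_eq_mul]
    refine Finset.sum_le_card_nsmul _ _ _ fun a _ => ?_
    refine le_trans (Finset.sum_le_sum fun b _ => ?_)
      (sum_weight_sub_le (E.site_injective.comp (Fin.val_injective (n := n))) (E.site a.1))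
    split_ifs
    exacts [(weight_pos _).le, le_rfl]

end Fibers

theorem exists_abs_exprTrace_sub_sum_cubes_le {σ : Type*} {k : EuclideanSpace ℝ (Fin d) → ℝ}
    {D : σ → EuclideanSpace ℝ (Fin d) → ℝ} (h : AdmissibleKernels k D) (e : MatExpr σ) {ε : ℝ}
    (hε : ε ∈ Ico (0 : ℝ) (1 / 2)) :
    ∃ C : ℝ, 0 ≤ C ∧ ∀ x : ℕ → EuclideanSpace ℝ (Fin d), ∀ hx : ∀ a k, |x a k| ≤ 1,
      ∀ N m n : ℕ, 0 < N → (m * N) ^ d ≤ n →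
      |exprTrace e k D ((E.configuration x hx n).point ε)
        - ∑ j ∈ Finset.range (m ^ d),
          exprTrace e k D (perturbedPoint (cubeSite d N) (fun w => x (E.indexOf j w)) ε)|
        ≤ C * (((m * N) ^ d : ℕ) * cubeLoss d N + (n - ((m * N) ^ d : ℕ))) := by
  obtain ⟨C, hC0, hC⟩ := h.exists_abs_exprTrace_sub_sum_fiber_le e hε
  obtain ⟨B, hB0, hB⟩ := h.exists_abs_exprTrace_le e hε
  set W := ∑' y : Fin d → ℤ, weight y
  have hW0 : 0 ≤ W := tsum_weight_nonneg
  refine ⟨C + C * W + B, by positivity, fun x hx N m n hN hn => ?_⟩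
  set c := E.configuration x hx n
  have hcut := hC c (m ^ d + 1) (E.label N m)
  have hrest := (hB (c.fiber (E.label N m) (Fin.last _))).trans_eq
    (congrArg (B * ·) (E.card_fiber_last hN hn))
  rw [Fin.sum_univ_castSucc, ← sub_sub] at hcut
  simp only [c, E.exprTrace_fiber hN hn] at hcut
  rw [Finset.sum_range]
  have hp : (0 : ℝ) ≤ n - ((m * N) ^ d : ℕ) := sub_nonneg.2 (Nat.cast_le.2 hn)
  have hq : 0 ≤ ((m * N) ^ d : ℕ) * cubeLoss d N :=
    mul_nonneg (Nat.cast_nonneg _) (cubeLoss_nonneg d N)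
  have hweight := E.crossWeight_label_le hN hn x hx
  generalize (n : ℝ) - ((m * N) ^ d : ℕ) = p at *
  generalize ((m * N) ^ d : ℕ) * cubeLoss d N = q at *
  calc _ ≤ C * c.crossWeight (E.label N m) + B * p :=
        (sub_le_iff_le_add.1 (abs_sub_abs_le_abs_sub _ _)).trans (add_le_add hcut hrest)
    _ ≤ C * (q + p * W) + B * p := by gcongr
    _ = C * q + (C * W + B) * p := by ring
    _ ≤ (C + C * W + B) * q + (C + C * W + B) * p := by gcongr <;> nlinarith
    _ = (C + C * W + B) * (q + p) := by ring

end CubeEnumeration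

/-! ### Limits and integrals of jets -/

section DoubleLimits

variable {X κ : Type*} [PseudoMetricSpace X] {l : Filter κ} {u : κ → X} {b : ℕ → X} {D : ℕ → ℝ}

theorem cauchySeq_of_eventually_dist_le [l.NeBot] (hD : Tendsto D atTop (𝓝 0))
    (hu : ∀ᶠ N in atTop, ∀ η > 0, ∀ᶠ n in l, dist (u n) (b N) ≤ D N + η) : CauchySeq b := by
  refine Metric.cauchySeq_iff.2 fun η hη => ?_
  obtain ⟨N₀, hN₀⟩ := eventually_atTop.1
    (hu.and (hD.eventually_lt_const (show 0 < η / 4 by positivity)))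
  refine ⟨N₀, fun M hM N hN => ?_⟩
  obtain ⟨n, hnM, hnN⟩ := (((hN₀ M hM).1 (η / 4) (by positivity)).and
    ((hN₀ N hN).1 (η / 4) (by positivity))).exists
  linarith [dist_triangle_left (b M) (b N) (u n), (hN₀ M hM).2, (hN₀ N hN).2]

theorem tendsto_of_eventually_dist_le {L : X} (hD : Tendsto D atTop (𝓝 0))
    (hu : ∀ᶠ N in atTop, ∀ η > 0, ∀ᶠ n in l, dist (u n) (b N) ≤ D N + η)
    (hb : Tendsto b atTop (𝓝 L)) : Tendsto u l (𝓝 L) := by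
  refine Metric.tendsto_nhds.2 fun η hη => ?_
  obtain ⟨N, hN, hDN, hbN⟩ := (hu.and ((hD.eventually_lt_const (show 0 < η / 4 by positivity)).and
    (Metric.tendsto_nhds.1 hb (η / 4) (by positivity)))).exists
  filter_upwards [hN (η / 4) (by positivity)] with n hn
  linarith [dist_triangle (u n) (b N) L]

end DoubleLimits

section Slopes

variable {E : Type*} [NormedAddCommGroup E] [NormedSpace ℝ E] {s : Set ℝ} {x y C : ℝ}

theorem norm_slope_sub_le_of_lipschitz_deriv (hs : Convex ℝ s) {f f' : ℝ → E}
    (hf : ∀ z ∈ s, HasDerivWithinAt f (f' z) s z)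
    (hf' : ∀ z ∈ s, ‖f' z - f' x‖ ≤ C * |z - x|) (hC : 0 ≤ C) (hx : x ∈ s) (hy : y ∈ s)
    (hxy : y ≠ x) : ‖slope f x y - f' x‖ ≤ C * |y - x| := by
  have hsub : uIcc x y ⊆ s := by
    rw [← segment_eq_uIcc]
    exact hs.segment_subset hx hy
  have hderiv : ∀ z ∈ uIcc x y,
      HasDerivWithinAt (fun z => f z - (z - x) • f' x) (f' z - f' x) (uIcc x y) z := fun z hz => by
    simpa using ((hf z (hsub hz)).mono hsub).fun_sub
      (((hasDerivWithinAt_id z _).sub_const x).smul_const (f' x))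
  have hbound : ∀ z ∈ uIcc x y, ‖f' z - f' x‖ ≤ C * |y - x| := fun z hz =>
    (hf' z (hsub hz)).trans (mul_le_mul_of_nonneg_left (abs_sub_left_of_mem_uIcc hz) hC)
  have hmean := (convex_uIcc x y).norm_image_sub_le_of_norm_hasDerivWithin_le hderiv hbound
    left_mem_uIcc right_mem_uIcc
  have hyx : y - x ≠ 0 := sub_ne_zero.2 hxy
  have hslope : slope f x y - f' x
      = (y - x)⁻¹ • (f y - (y - x) • f' x - (f x - (x - x) • f' x)) := by
    rw [slope_def_module, sub_self, zero_smul, sub_zero, sub_right_comm,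
      smul_sub (y - x)⁻¹ (f y - f x), inv_smul_smul₀ hyx]
  rw [hslope, norm_smul, norm_inv, Real.norm_eq_abs, inv_mul_le_iff₀ (abs_pos.2 hyx), mul_comm]
  simpa only [Real.norm_eq_abs] using hmean

theorem hasDerivWithinAt_of_norm_slope_sub_le {f : ℝ → E} {f' : E}
    (hf : ∀ y ∈ s, y ≠ x → ‖slope f x y - f'‖ ≤ C * |y - x|) : HasDerivWithinAt f f' s x := by
  rw [hasDerivWithinAt_iff_tendsto_slope, tendsto_iff_norm_sub_tendsto_zero]
  have hzero : Tendsto (fun y : ℝ => C * |y - x|) (𝓝[s \ {x}] x) (𝓝 0) := by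
    have hcont : Continuous fun y : ℝ => C * |y - x| := by fun_prop
    simpa using (hcont.tendsto x).mono_left nhdsWithin_le_nhds
  refine squeeze_zero' (.of_forall fun _ => norm_nonneg _) ?_ hzero
  filter_upwards [self_mem_nhdsWithin] with y hy using hf y hy.1 hy.2

theorem exists_seq_tendsto_nhdsWithin_diff_singleton (hx : UniqueDiffWithinAt ℝ s x) :
    ∃ y : ℕ → ℝ, (∀ N, y N ∈ s \ {x}) ∧ Tendsto y atTop (𝓝 x) :=
  mem_closure_iff_seq_limit.1 <| mem_closure_iff_clusterPt.2 <|
    accPt_principal_iff_clusterPt.1 <| uniqueDiffWithinAt_iff_accPt.1 hx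

end Slopes

namespace UniformlyBoundedJetOn

section Derivatives

variable {T : Type*} {E : T → Type*} [∀ τ, NormedAddCommGroup (E τ)] [∀ τ, NormedSpace ℝ (E τ)]
  {s : Set ℝ} {k : ℕ} {A B : ∀ τ, ℝ → E τ}

protected theorem congr (hA : UniformlyBoundedJetOn s k A) (hAB : ∀ τ, EqOn (B τ) (A τ) s) :
    UniformlyBoundedJetOn s k B := by
  have hbdd : UniformlyBoundedOn s B :=
    hA.uniformlyBoundedOn.imp fun C hC τ x hx => hAB τ hx ▸ hC τ x hx
  cases k with
  | zero => exact hbdd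
  | succ k =>
    obtain ⟨-, A', hderiv, hA'⟩ := hA
    exact ⟨hbdd, A', fun τ x hx => (hderiv τ x hx).congr (hAB τ) (hAB τ hx), hA'⟩

protected theorem differentiableOn (hA : UniformlyBoundedJetOn s (k + 1) A) (τ : T) :
    DifferentiableOn ℝ (A τ) s :=
  let ⟨_, _, hderiv, _⟩ := hA
  fun x hx => (hderiv τ x hx).differentiableWithinAt

protected theorem derivWithin (hA : UniformlyBoundedJetOn s (k + 1) A) (hu : UniqueDiffOn ℝ s) :
    UniformlyBoundedJetOn s k fun τ => derivWithin (A τ) s :=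
  let ⟨_, _, hderiv, hA'⟩ := hA
  hA'.congr fun τ x hx => (hderiv τ x hx).derivWithin (hu x hx)

theorem contDiffOn (hA : UniformlyBoundedJetOn s (k + 1) A) (hu : UniqueDiffOn ℝ s) (τ : T) :
    ContDiffOn ℝ k (A τ) s := by
  induction k generalizing A with
  | zero => exact contDiffOn_zero.2 (hA.differentiableOn τ).continuousOn
  | succ k ih =>
    rw [Nat.cast_add_one, contDiffOn_succ_iff_derivWithin hu]
    exact ⟨hA.differentiableOn τ, by simp, ih (hA.derivWithin hu)⟩

theorem exists_lipschitz (hA : UniformlyBoundedJetOn s (k + 1) A) (hs : Convex ℝ s) :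
    ∃ C, 0 ≤ C ∧ ∀ τ, ∀ x ∈ s, ∀ y ∈ s, ‖A τ y - A τ x‖ ≤ C * |y - x| := by
  obtain ⟨-, A', hderiv, hA'⟩ := hA
  obtain ⟨C, hC₀, hC⟩ := hA'.uniformlyBoundedOn.exists_nonneg
  exact ⟨C, hC₀, fun τ x hx y hy =>
    hs.norm_image_sub_le_of_norm_hasDerivWithin_le (hderiv τ) (hC τ) hx hy⟩

theorem exists_norm_slope_sub_derivWithin_le (hA : UniformlyBoundedJetOn s 2 A) (hs : Convex ℝ s)
    (hu : UniqueDiffOn ℝ s) : ∃ C, ∀ τ, ∀ x ∈ s, ∀ y ∈ s, y ≠ x →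
      ‖slope (A τ) x y - derivWithin (A τ) s x‖ ≤ C * |y - x| := by
  obtain ⟨C, hC₀, hC⟩ := (hA.derivWithin hu).exists_lipschitz hs
  exact ⟨C, fun τ x hx y hy hyx => norm_slope_sub_le_of_lipschitz_deriv hs
    (fun z hz => (hA.differentiableOn τ z hz).hasDerivWithinAt) (hC τ x hx) hC₀ hx hy hyx⟩

end Derivatives

section PointwiseLimits

variable {E : Type*} [NormedAddCommGroup E] [NormedSpace ℝ E] {s : Set ℝ} {k : ℕ}
  {φ : ℕ → ℝ → E} {S : ℝ → E}

theorem continuousOn_of_tendsto (hφ : UniformlyBoundedJetOn (E := fun _ => E) s 1 φ)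
    (hs : Convex ℝ s) (hS : ∀ x ∈ s, Tendsto (φ · x) atTop (𝓝 (S x))) : ContinuousOn S s := by
  obtain ⟨C, -, hC⟩ := hφ.exists_lipschitz hs
  refine (LipschitzOnWith.of_dist_le' (K := C) fun x hx y hy => ?_).continuousOn
  rw [dist_eq_norm, Real.dist_eq]
  exact le_of_tendsto' ((hS x hx).sub (hS y hy)).norm fun n => hC n y hy x hx

theorem exists_tendsto_derivWithin [CompleteSpace E]
    (hφ : UniformlyBoundedJetOn (E := fun _ => E) s 2 φ) (hs : Convex ℝ s)
    (hu : UniqueDiffOn ℝ s) (hS : ∀ x ∈ s, Tendsto (φ · x) atTop (𝓝 (S x))) {x : ℝ}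
    (hx : x ∈ s) :
    ∃ S' : E, Tendsto (fun n => derivWithin (φ n) s x) atTop (𝓝 S') ∧
      HasDerivWithinAt S S' s x := by
  obtain ⟨C, hC⟩ := hφ.exists_norm_slope_sub_derivWithin_le hs hu
  have hslope : ∀ y ∈ s, Tendsto (fun n => slope (φ n) x y) atTop (𝓝 (slope S x y)) := fun y hy =>
    ((hS y hy).sub (hS x hx)).const_smul (y - x)⁻¹
  obtain ⟨y, hys, hyx⟩ := exists_seq_tendsto_nhdsWithin_diff_singleton (hu x hx)
  have hD : Tendsto (fun N => C * |y N - x|) atTop (𝓝 0) := by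
    simpa using (hyx.sub_const x).abs.const_mul C
  have hnear : ∀ᶠ N in atTop, ∀ η > 0, ∀ᶠ n in atTop,
      dist (derivWithin (φ n) s x) (slope S x (y N)) ≤ C * |y N - x| + η :=
    .of_forall fun N η hη => by
      filter_upwards [Metric.tendsto_nhds.1 (hslope _ (hys N).1) η hη] with n hn
      have hCn := hC n x hx _ (hys N).1 (hys N).2
      rw [← dist_eq_norm, dist_comm] at hCn
      exact (dist_triangle _ _ _).trans (add_le_add hCn hn.le)
  obtain ⟨S', hS'⟩ := cauchySeq_tendsto_of_complete (cauchySeq_of_eventually_dist_le hD hnear)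
  have hderiv := tendsto_of_eventually_dist_le hD hnear hS'
  exact ⟨S', hderiv, hasDerivWithinAt_of_norm_slope_sub_le fun y hy hyx =>
    le_of_tendsto' ((hslope y hy).sub hderiv).norm fun n => hC n x hx y hy hyx⟩

theorem contDiffOn_and_tendsto_iteratedDerivWithin [CompleteSpace E]
    (hφ : UniformlyBoundedJetOn (E := fun _ => E) s (k + 1) φ) (hs : Convex ℝ s)
    (hu : UniqueDiffOn ℝ s) (hS : ∀ x ∈ s, Tendsto (φ · x) atTop (𝓝 (S x))) :
    ContDiffOn ℝ k S s ∧ ∀ x ∈ s, Tendsto (fun n => iteratedDerivWithin k (φ n) s x) atTop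
      (𝓝 (iteratedDerivWithin k S s x)) := by
  induction k generalizing φ S with
  | zero =>
    exact ⟨contDiffOn_zero.2 (hφ.continuousOn_of_tendsto hs hS), by
      simpa only [iteratedDerivWithin_zero] using hS⟩
  | succ k ih =>
    choose! S' hφS' hSS' using fun x (hx : x ∈ s) =>
      (hφ.of_le (show 2 ≤ k + 1 + 1 by lia)).exists_tendsto_derivWithin hs hu hS hx
    have hderiv : ∀ x ∈ s, derivWithin S s x = S' x := fun x hx =>
      (hSS' x hx).derivWithin (hu x hx)
    obtain ⟨hcont, hlim⟩ := ih (S := derivWithin S s) (hφ.derivWithin hu) fun x hx =>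
      hderiv x hx ▸ hφS' x hx
    refine ⟨?_, fun x hx => ?_⟩
    · rw [Nat.cast_add_one, contDiffOn_succ_iff_derivWithin hu]
      exact ⟨fun x hx => (hSS' x hx).differentiableWithinAt, by simp, hcont⟩
    · simpa only [iteratedDerivWithin_succ'] using hlim x hx

end PointwiseLimits

end UniformlyBoundedJetOn

section Integrals

variable {Ω E : Type*} [MeasurableSpace Ω] {P : Measure Ω} [NormedAddCommGroup E]
  [NormedSpace ℝ E] {s : Set ℝ}

theorem aestronglyMeasurable_of_hasDerivWithinAt {x : ℝ} {F : Ω → ℝ → E} {F' : Ω → E}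
    (hs : UniqueDiffWithinAt ℝ s x) (hx : x ∈ s)
    (hF : ∀ y ∈ s, AEStronglyMeasurable (F · y) P)
    (hderiv : ∀ᵐ ω ∂P, HasDerivWithinAt (F ω) (F' ω) s x) : AEStronglyMeasurable F' P := by
  obtain ⟨y, hys, hyx⟩ := exists_seq_tendsto_nhdsWithin_diff_singleton hs
  refine aestronglyMeasurable_of_tendsto_ae atTop (f := fun N ω => slope (F ω) x (y N))
    (fun N => ((hF _ (hys N).1).sub (hF x hx)).const_smul _) ?_
  filter_upwards [hderiv] with ω hω
  exact (hasDerivWithinAt_iff_tendsto_slope.1 hω).comp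
    (tendsto_nhdsWithin_iff.2 ⟨hyx, .of_forall hys⟩)

theorem hasDerivWithinAt_integral_of_lipschitz [IsFiniteMeasure P] {x C : ℝ} {F : Ω → ℝ → E}
    {F' : Ω → E} (hx : x ∈ s) (hF : ∀ y ∈ s, Integrable (F · y) P)
    (hlip : ∀ᵐ ω ∂P, ∀ y ∈ s, ‖F ω y - F ω x‖ ≤ C * |y - x|)
    (hderiv : ∀ᵐ ω ∂P, HasDerivWithinAt (F ω) (F' ω) s x) :
    HasDerivWithinAt (fun y => ∫ ω, F ω y ∂P) (∫ ω, F' ω ∂P) s x := by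
  rw [hasDerivWithinAt_iff_tendsto_slope]
  have hslope : ∀ y ∈ s, slope (fun y => ∫ ω, F ω y ∂P) x y = ∫ ω, slope (F ω) x y ∂P :=
    fun y hy => by
      simp only [slope_def_module, integral_smul, integral_sub (hF y hy) (hF x hx)]
  have hmem : ∀ᶠ y in 𝓝[s \ {x}] x, y ∈ s \ {x} := self_mem_nhdsWithin
  refine Tendsto.congr' (hmem.mono fun y hy => (hslope y hy.1).symm) ?_
  refine tendsto_integral_filter_of_dominated_convergence (fun _ => C)
    (hmem.mono fun y hy => ?_) (hmem.mono fun y hy => ?_) (integrable_const C) ?_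
  · exact ((hF y hy.1).1.sub (hF x hx).1).const_smul _
  · filter_upwards [hlip] with ω hω
    rw [slope_def_module, norm_smul, norm_inv, Real.norm_eq_abs,
      inv_mul_le_iff₀ (abs_pos.2 (sub_ne_zero.2 hy.2)), mul_comm]
    exact hω y hy.1
  · exact hderiv.mono fun ω hω => hasDerivWithinAt_iff_tendsto_slope.1 hω

theorem UniformlyBoundedOn.integral [IsFiniteMeasure P] {S ι : Type*} {t : Set S} {G : Set Ω}
    {f : Ω → ι → S → E}
    (hf : UniformlyBoundedOn (E := fun _ => E) t fun τ : G × ι => f τ.1 τ.2)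
    (hG : ∀ᵐ ω ∂P, ω ∈ G) :
    UniformlyBoundedOn (E := fun _ => E) t fun i x => ∫ ω, f ω i x ∂P := by
  obtain ⟨C, hC⟩ := hf
  exact ⟨C * P.real univ, fun i x hx =>
    norm_integral_le_of_norm_le_const (hG.mono fun ω hω => hC (⟨ω, hω⟩, i) x hx)⟩

namespace UniformlyBoundedJetOn

variable {ι : Type*} {k : ℕ} {G : Set Ω} {f : Ω → ι → ℝ → E}

theorem aestronglyMeasurable_derivWithin
    (hf : UniformlyBoundedJetOn (E := fun _ => E) s (k + 1) fun τ : G × ι => f τ.1 τ.2)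
    (hu : UniqueDiffOn ℝ s) (hG : ∀ᵐ ω ∂P, ω ∈ G)
    (hm : ∀ i, ∀ x ∈ s, AEStronglyMeasurable (f · i x) P) (i : ι) {x : ℝ} (hx : x ∈ s) :
    AEStronglyMeasurable (fun ω => derivWithin (f ω i) s x) P :=
  aestronglyMeasurable_of_hasDerivWithinAt (hu x hx) hx (hm i)
    (hG.mono fun ω hω => (hf.differentiableOn (⟨ω, hω⟩, i) x hx).hasDerivWithinAt)

section FiniteMeasure

variable [IsFiniteMeasure P]

protected theorem integrable
    (hf : UniformlyBoundedJetOn (E := fun _ => E) s k fun τ : G × ι => f τ.1 τ.2)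
    (hG : ∀ᵐ ω ∂P, ω ∈ G) (hm : ∀ i, ∀ x ∈ s, AEStronglyMeasurable (f · i x) P) (i : ι) {x : ℝ}
    (hx : x ∈ s) : Integrable (f · i x) P := by
  obtain ⟨C, hC⟩ := hf.uniformlyBoundedOn
  exact .of_bound (hm i x hx) C (hG.mono fun ω hω => hC (⟨ω, hω⟩, i) x hx)

theorem hasDerivWithinAt_integral
    (hf : UniformlyBoundedJetOn (E := fun _ => E) s (k + 1) fun τ : G × ι => f τ.1 τ.2)
    (hs : Convex ℝ s) (hG : ∀ᵐ ω ∂P, ω ∈ G)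
    (hm : ∀ i, ∀ x ∈ s, AEStronglyMeasurable (f · i x) P) (i : ι) {x : ℝ} (hx : x ∈ s) :
    HasDerivWithinAt (fun x => ∫ ω, f ω i x ∂P) (∫ ω, derivWithin (f ω i) s x ∂P) s x := by
  obtain ⟨C, -, hC⟩ := hf.exists_lipschitz hs
  exact hasDerivWithinAt_integral_of_lipschitz hx (fun y hy => hf.integrable hG hm i hy)
    (hG.mono fun ω hω => hC (⟨ω, hω⟩, i) x hx)
    (hG.mono fun ω hω => (hf.differentiableOn (⟨ω, hω⟩, i) x hx).hasDerivWithinAt)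

protected theorem integral
    (hf : UniformlyBoundedJetOn (E := fun _ => E) s k fun τ : G × ι => f τ.1 τ.2)
    (hs : Convex ℝ s) (hu : UniqueDiffOn ℝ s) (hG : ∀ᵐ ω ∂P, ω ∈ G)
    (hm : ∀ i, ∀ x ∈ s, AEStronglyMeasurable (f · i x) P) :
    UniformlyBoundedJetOn (E := fun _ => E) s k fun i x => ∫ ω, f ω i x ∂P := by
  induction k generalizing f with
  | zero => exact UniformlyBoundedOn.integral hf hG
  | succ k ih =>
    exact ⟨hf.uniformlyBoundedOn.integral hG, _,
      fun i x hx => hf.hasDerivWithinAt_integral hs hG hm i hx, ih (hf.derivWithin hu)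
        fun i x hx => hf.aestronglyMeasurable_derivWithin hu hG hm i hx⟩

theorem integrable_iteratedDerivWithin
    (hf : UniformlyBoundedJetOn (E := fun _ => E) s k fun τ : G × ι => f τ.1 τ.2)
    (hu : UniqueDiffOn ℝ s) (hG : ∀ᵐ ω ∂P, ω ∈ G)
    (hm : ∀ i, ∀ x ∈ s, AEStronglyMeasurable (f · i x) P) (i : ι) {x : ℝ} (hx : x ∈ s) :
    Integrable (fun ω => iteratedDerivWithin k (f ω i) s x) P := by
  induction k generalizing f with
  | zero => simpa only [iteratedDerivWithin_zero] using hf.integrable hG hm i hx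
  | succ k ih =>
    simpa only [iteratedDerivWithin_succ'] using ih (hf.derivWithin hu)
      fun i x hx => hf.aestronglyMeasurable_derivWithin hu hG hm i hx

theorem iteratedDerivWithin_integral
    (hf : UniformlyBoundedJetOn (E := fun _ => E) s k fun τ : G × ι => f τ.1 τ.2)
    (hs : Convex ℝ s) (hu : UniqueDiffOn ℝ s) (hG : ∀ᵐ ω ∂P, ω ∈ G)
    (hm : ∀ i, ∀ x ∈ s, AEStronglyMeasurable (f · i x) P) (i : ι) {x : ℝ} (hx : x ∈ s) :
    iteratedDerivWithin k (fun x => ∫ ω, f ω i x ∂P) s x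
      = ∫ ω, iteratedDerivWithin k (f ω i) s x ∂P := by
  induction k generalizing f with
  | zero => simp only [iteratedDerivWithin_zero]
  | succ k ih =>
    have hderiv : EqOn (derivWithin (fun x => ∫ ω, f ω i x ∂P) s)
        (fun x => ∫ ω, derivWithin (f ω i) s x ∂P) s := fun y hy =>
      (hf.hasDerivWithinAt_integral hs hG hm i hy).derivWithin (hu y hy)
    simp only [iteratedDerivWithin_succ']
    rw [iteratedDerivWithin_congr hderiv hx]
    exact ih (hf.derivWithin hu) fun i x hx => hf.aestronglyMeasurable_derivWithin hu hG hm i hx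

end FiniteMeasure

theorem contDiffOn_and_tendsto_integral_iteratedDerivWithin [IsProbabilityMeasure P]
    [CompleteSpace E] {f : Ω → ℕ → ℝ → E} {S : ℝ → E}
    (hf : UniformlyBoundedJetOn (E := fun _ => E) s (k + 1) fun τ : G × ℕ => f τ.1 τ.2)
    (hs : Convex ℝ s) (hu : UniqueDiffOn ℝ s) (hG : ∀ᵐ ω ∂P, ω ∈ G)
    (hm : ∀ n, ∀ x ∈ s, AEStronglyMeasurable (f · n x) P)
    (hS : ∀ x ∈ s, ∀ᵐ ω ∂P, Tendsto (f ω · x) atTop (𝓝 (S x))) :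
    ContDiffOn ℝ k S s ∧ ∀ x ∈ s, Tendsto (fun n => ∫ ω, iteratedDerivWithin k (f ω n) s x ∂P)
      atTop (𝓝 (iteratedDerivWithin k S s x)) := by
  obtain ⟨C, hC⟩ := hf.uniformlyBoundedOn
  have hmean : ∀ x ∈ s, Tendsto (fun n => ∫ ω, f ω n x ∂P) atTop (𝓝 (S x)) := fun x hx => by
    simpa using tendsto_integral_of_dominated_convergence (fun _ => C) (fun n => hm n x hx)
      (integrable_const C) (fun n => hG.mono fun ω hω => hC (⟨ω, hω⟩, n) x hx) (hS x hx)
  obtain ⟨hcont, hlim⟩ :=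
    (hf.integral hs hu hG hm).contDiffOn_and_tendsto_iteratedDerivWithin hs hu hmean
  exact ⟨hcont, fun x hx => (hlim x hx).congr fun n =>
    hf.of_succ.iteratedDerivWithin_integral hs hu hG hm n hx⟩

end UniformlyBoundedJetOn

theorem Ico_eventuallyEq_Ico {a b c x : ℝ} (hb : x < b) (hc : x < c) :
    Ico a b =ᶠ[𝓝 x] Ico a c := by
  filter_upwards [Iio_mem_nhds hb, Iio_mem_nhds hc] with y hyb hyc
  exact propext (and_congr_right' (iff_of_true hyb hyc))

theorem secondDerivativeExchange_of_uniformlyBoundedJetOn [IsProbabilityMeasure P]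
    {f : Ω → ℕ → ℝ → ℝ} {S : ℝ → ℝ} {G : Set Ω} (hG : ∀ᵐ ω ∂P, ω ∈ G)
    (hm : ∀ n, ∀ ε ∈ Ico (0 : ℝ) (1 / 2), AEStronglyMeasurable (f · n ε) P)
    (hf : ∀ β < (1 / 2 : ℝ),
      UniformlyBoundedJetOn (E := fun _ => ℝ) (Ico 0 β) 3 fun τ : G × ℕ => f τ.1 τ.2)
    (hS : ∀ ε ∈ Ico (0 : ℝ) (1 / 2), ∀ᵐ ω ∂P, Tendsto (f ω · ε) atTop (𝓝 (S ε))) :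
    SecondDerivativeExchange P (fun ω n ε => n * f ω n ε) S := by
  have hsub : ∀ {β : ℝ}, β < 1 / 2 → Ico 0 β ⊆ Ico 0 (1 / 2) := fun hβ =>
    Ico_subset_Ico_right hβ.le
  have hlocal : ∀ ε ∈ Ico (0 : ℝ) (1 / 2), ∃ β < (1 / 2 : ℝ), ε ∈ Ico 0 β ∧
      Ico 0 β =ᶠ[𝓝 ε] Ico 0 (1 / 2) := fun ε hε => by
    obtain ⟨β, hεβ, hβ⟩ := exists_between hε.2
    exact ⟨β, hβ, ⟨hε.1, hεβ⟩, Ico_eventuallyEq_Ico hεβ hε.2⟩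
  have hlim := fun β (hβ : β < (1 / 2 : ℝ)) =>
    (hf β hβ).contDiffOn_and_tendsto_integral_iteratedDerivWithin (convex_Ico 0 β)
      (uniqueDiffOn_Ico 0 β) hG (fun n ε hε => hm n ε (hsub hβ hε)) fun ε hε => hS ε (hsub hβ hε)
  have hcont : ∀ ω ∈ G, ∀ n, ContDiffOn ℝ 2 (f ω n) (Ico 0 (1 / 2)) := fun ω hω n ε hε => by
    obtain ⟨β, hβ, hεβ, heq⟩ := hlocal ε hε
    exact ((hf β hβ).contDiffOn (uniqueDiffOn_Ico 0 β) (⟨ω, hω⟩, n) ε hεβ).congr_set heq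
  refine ⟨fun ε hε => ?_, hG.mono fun ω hω n => contDiffOn_const.mul (hcont ω hω n), fun ε hε => ?_⟩
  · obtain ⟨β, hβ, hεβ, heq⟩ := hlocal ε hε
    exact ((hlim β hβ).1 ε hεβ).congr_set heq
  obtain ⟨β, hβ, hεβ, heq⟩ := hlocal ε hε
  have hset : ∀ g : ℝ → ℝ,
      iteratedDerivWithin 2 g (Ico 0 (1 / 2)) ε = iteratedDerivWithin 2 g (Ico 0 β) ε := fun g => by
    simp only [iteratedDerivWithin, iteratedFDerivWithin_congr_set heq]
  simp only [iteratedDerivWithin_const_mul_field, hset, integral_const_mul]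
  refine ⟨fun n => ((hf β hβ).of_succ.integrable_iteratedDerivWithin (uniqueDiffOn_Ico 0 β) hG
    (fun n ε hε => hm n ε (hsub hβ hε)) n hεβ).const_mul _, ((hlim β hβ).2 ε hεβ).congr' ?_⟩
  filter_upwards [eventually_ne_atTop 0] with n hn
  rw [← mul_assoc, one_div, inv_mul_cancel₀ (Nat.cast_ne_zero.2 hn), one_mul]

end Integrals

/-! ### Measurability -/

section Measurability

variable {α ι σ : Type*} [MeasurableSpace α] [DecidableEq ι]

theorem measurable_diagonal_diag_apply {A : α → Matrix ι ι ℝ}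
    (hA : ∀ a b, Measurable fun x => A x a b) (a b : ι) :
    Measurable fun x => Matrix.diagonal (A x).diag a b := by
  simp only [Matrix.diagonal_apply]
  split_ifs
  exacts [hA a a, measurable_const]

variable [Fintype ι]

theorem measurable_det {A : α → Matrix ι ι ℝ} (hA : ∀ a b, Measurable fun x => A x a b) :
    Measurable fun x => (A x).det := by
  simp only [Matrix.det_apply]
  exact Finset.measurable_fun_sum _ fun s _ =>
    (Finset.measurable_fun_prod _ fun i _ => hA _ _).const_smul (Equiv.Perm.sign s)

theorem measurable_inv_apply {A : α → Matrix ι ι ℝ} (hA : ∀ a b, Measurable fun x => A x a b)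
    (a b : ι) : Measurable fun x => (A x)⁻¹ a b := by
  simp only [Matrix.inv_def, Ring.inverse_eq_inv', Matrix.smul_apply, smul_eq_mul,
    Matrix.adjugate_apply]
  refine (measurable_det hA).inv.mul (measurable_det fun i j => ?_)
  simp only [Matrix.updateRow_apply]
  split_ifs
  exacts [measurable_const, hA i j]

theorem MatExpr.measurable_eval_apply (e : MatExpr σ) {R : α → Matrix ι ι ℝ}
    {D : σ → α → Matrix ι ι ℝ} (hR : ∀ a b, Measurable fun x => R x a b)
    (hD : ∀ i a b, Measurable fun x => D i x a b) (a b : ι) :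
    Measurable fun x => e.eval (R x) (D · x) a b := by
  induction e generalizing a b with
  | base => exact hR a b
  | var i => exact hD i a b
  | baseInv => exact measurable_inv_apply hR a b
  | diagInv =>
    exact measurable_inv_apply (measurable_diagonal_diag_apply (measurable_inv_apply hR)) a b
  | add _ _ he hf => exact (he a b).add (hf a b)
  | smul c _ he => exact (he a b).const_mul c
  | mul _ _ he hf =>
    simp only [MatExpr.eval, Matrix.mul_apply]
    exact Finset.measurable_fun_sum _ fun i _ => (he a i).mul (hf i b)
  | diag _ he => exact measurable_diagonal_diag_apply he a b
  | transpose _ he => exact he b a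

variable {d : ℕ}

theorem RegularKernel.measurable {h : EuclideanSpace ℝ (Fin d) → ℝ} (hh : RegularKernel h) :
    Measurable h := by
  refine measurable_of_continuousOn_compl_singleton 0 ?_
  have hzero : ContinuousOn (iteratedFDerivWithin ℝ 0 h {0}ᶜ) {0}ᶜ :=
    (hh.differentiable 0 (by norm_num)).continuousOn
  exact ((ContinuousMultilinearMap.apply ℝ (fun _ : Fin 0 => EuclideanSpace ℝ (Fin d)) ℝ
    fun _ => 0).continuous.comp_continuousOn hzero).congr fun t _ => by simp

namespace AdmissibleKernels

variable {k : EuclideanSpace ℝ (Fin d) → ℝ} {D : σ → EuclideanSpace ℝ (Fin d) → ℝ}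

theorem measurable_exprTrace (h : AdmissibleKernels k D) (e : MatExpr σ) (z : ι → Fin d → ℤ)
    (ε : ℝ) :
    Measurable fun x : ι → EuclideanSpace ℝ (Fin d) => exprTrace e k D (perturbedPoint z x ε) := by
  have hentry {h : EuclideanSpace ℝ (Fin d) → ℝ} (hh : RegularKernel h) (a b : ι) :
      Measurable fun x : ι → EuclideanSpace ℝ (Fin d) =>
        kernelMatrix h (perturbedPoint z x ε) a b :=
    hh.measurable.comp (by unfold perturbedPoint; fun_prop)
  exact Finset.measurable_fun_sum _ fun a _ =>
    e.measurable_eval_apply (hentry h.regular) (fun i => hentry (h.regular_var i)) a a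

theorem integrable_exprTrace {ι : Type} [Fintype ι] [DecidableEq ι] (h : AdmissibleKernels k D)
    (e : MatExpr σ) {z : ι → Fin d → ℤ} (hz : Function.Injective z) {ε : ℝ}
    (hε : ε ∈ Ico (0 : ℝ) (1 / 2)) {μ : Measure (EuclideanSpace ℝ (Fin d))} [IsFiniteMeasure μ]
    (hμ : ∀ᵐ x ∂μ, ∀ l, |x l| ≤ 1) :
    Integrable (fun x : ι → EuclideanSpace ℝ (Fin d) => exprTrace e k D (perturbedPoint z x ε))
      (Measure.pi fun _ => μ) := by
  obtain ⟨C, -, hC⟩ := h.exists_abs_exprTrace_le e hε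
  have hbound : ∀ᵐ x ∂Measure.pi fun _ : ι => μ, ∀ a l, |x a l| ≤ 1 :=
    ae_all_iff.2 fun a => (Measure.quasiMeasurePreserving_eval (fun _ => μ) a).ae hμ
  refine .of_bound (h.measurable_exprTrace e z ε).aestronglyMeasurable (C * Fintype.card ι) ?_
  filter_upwards [hbound] with x hx using hC ⟨ι, z, hz, x, hx⟩

end AdmissibleKernels

end Measurability

/-! ### Averages over cubes -/

section CubeAverages

/-- The largest `m` for which a cube of side `m * N` in dimension `d` has at most `n` points. -/
def edgeCount (d N n : ℕ) : ℕ := Nat.nthRoot d n / N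

variable {d N : ℕ} (hd : 0 < d) (hN : 0 < N)

include hd hN

theorem le_edgeCount_iff (m n : ℕ) : m ≤ edgeCount d N n ↔ (m * N) ^ d ≤ n := by
  rw [edgeCount, Nat.le_div_iff_mul_le hN, Nat.le_nthRoot_iff hd.ne']

theorem edgeCount_mul_pow_le (n : ℕ) : (edgeCount d N n * N) ^ d ≤ n :=
  (le_edgeCount_iff hd hN _ n).1 le_rfl

theorem lt_edgeCount_add_one_mul_pow (n : ℕ) : n < ((edgeCount d N n + 1) * N) ^ d :=
  not_le.1 fun h => (Nat.lt_succ_self _).not_ge ((le_edgeCount_iff hd hN _ n).2 h)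

theorem tendsto_edgeCount : Tendsto (edgeCount d N) atTop atTop :=
  tendsto_atTop.2 fun m => (eventually_ge_atTop ((m * N) ^ d)).mono fun n hn =>
    (le_edgeCount_iff hd hN m n).2 hn

theorem tendsto_edgeCount_mul_pow_div :
    Tendsto (fun n : ℕ => (((edgeCount d N n * N) ^ d : ℕ) : ℝ) / n) atTop (𝓝 1) := by
  have hlower : Tendsto (fun n : ℕ => ((edgeCount d N n : ℝ) / (edgeCount d N n + 1)) ^ d) atTop
      (𝓝 1) := by
    simpa using ((tendsto_natCast_div_add_atTop (1 : ℝ)).comp (tendsto_edgeCount hd hN)).pow d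
  refine tendsto_of_tendsto_of_tendsto_of_le_of_le' hlower tendsto_const_nhds ?_
    (.of_forall fun n => div_le_one_of_le₀ (Nat.cast_le.2 (edgeCount_mul_pow_le hd hN n))
      (Nat.cast_nonneg n))
  filter_upwards [eventually_gt_atTop 0] with n hn
  have hlt : (n : ℝ) ≤ ((edgeCount d N n + 1) * N) ^ d := by
    exact_mod_cast (lt_edgeCount_add_one_mul_pow hd hN n).le
  rw [div_pow, div_le_div_iff₀ (by positivity) (by positivity)]
  push_cast
  calc (edgeCount d N n : ℝ) ^ d * n ≤ edgeCount d N n ^ d * ((edgeCount d N n + 1) * N) ^ d := by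
        gcongr
    _ = (edgeCount d N n * N) ^ d * (edgeCount d N n + 1) ^ d := by
      rw [mul_pow, mul_pow]; ring

theorem tendsto_sum_edgeCount_pow_div {Y : ℕ → ℝ} {a : ℝ}
    (hY : Tendsto (fun n : ℕ => (∑ j ∈ Finset.range n, Y j) / n) atTop (𝓝 a)) :
    Tendsto (fun n : ℕ => 1 / (n : ℝ) * ∑ j ∈ Finset.range (edgeCount d N n ^ d), Y j) atTop
      (𝓝 (a / (N : ℝ) ^ d)) := by
  have hpow : Tendsto (fun n => edgeCount d N n ^ d) atTop atTop :=
    (tendsto_pow_atTop hd.ne').comp (tendsto_edgeCount hd hN)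
  have hprod := ((tendsto_edgeCount_mul_pow_div hd hN).div_const ((N : ℝ) ^ d)).mul (hY.comp hpow)
  rw [div_mul_eq_mul_div, one_mul] at hprod
  refine hprod.congr' ?_
  filter_upwards [eventually_gt_atTop 0, (tendsto_edgeCount hd hN).eventually_gt_atTop 0]
    with n hn hm
  simp only [Function.comp_apply, Nat.cast_pow, Nat.cast_mul, mul_pow]
  field_simp

theorem eventually_dist_average_le {T Y : ℕ → ℝ} {C δ a : ℝ}
    (hT : ∀ m n : ℕ, (m * N) ^ d ≤ n → |T n - ∑ j ∈ Finset.range (m ^ d), Y j|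
      ≤ C * (((m * N) ^ d : ℕ) * δ + (n - ((m * N) ^ d : ℕ))))
    (hY : Tendsto (fun n : ℕ => (∑ j ∈ Finset.range n, Y j) / n) atTop (𝓝 a)) {η : ℝ}
    (hη : 0 < η) :
    ∀ᶠ n : ℕ in atTop, dist (1 / (n : ℝ) * T n) (a / (N : ℝ) ^ d) ≤ C * δ + η := by
  have hratio := tendsto_edgeCount_mul_pow_div hd hN
  have herror : Tendsto (fun n : ℕ => C * ((((edgeCount d N n * N) ^ d : ℕ) : ℝ) / n * δ +
      (1 - (((edgeCount d N n * N) ^ d : ℕ) : ℝ) / n))) atTop (𝓝 (C * δ)) := by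
    simpa using ((hratio.mul_const δ).add (hratio.const_sub 1)).const_mul C
  have hcubes := Metric.tendsto_nhds.1 (tendsto_sum_edgeCount_pow_div hd hN hY) _ (half_pos hη)
  filter_upwards [herror.eventually_lt_const (lt_add_of_pos_right _ (half_pos hη)), hcubes,
    eventually_gt_atTop 0] with n hCn hYn hn
  have hTn : dist (1 / (n : ℝ) * T n)
      (1 / (n : ℝ) * ∑ j ∈ Finset.range (edgeCount d N n ^ d), Y j)
      ≤ C * ((((edgeCount d N n * N) ^ d : ℕ) : ℝ) / n * δ +
        (1 - (((edgeCount d N n * N) ^ d : ℕ) : ℝ) / n)) := by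
    rw [Real.dist_eq, ← mul_sub, abs_mul, abs_of_pos (by positivity)]
    refine (mul_le_mul_of_nonneg_left (hT _ n (edgeCount_mul_pow_le hd hN n))
      (by positivity)).trans_eq ?_
    field_simp
  calc dist (1 / (n : ℝ) * T n) (a / (N : ℝ) ^ d) ≤ C * δ + η / 2 + η / 2 :=
        (dist_triangle _ _ _).trans (add_le_add (hTn.trans hCn.le) hYn.le)
    _ = C * δ + η := by rw [add_assoc, add_halves]

end CubeAverages

/-! ### The almost sure limit -/

section StrongLaw

variable {Ω E ι κ : Type*} [MeasurableSpace Ω] [MeasurableSpace E] {P : Measure Ω}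
  {μ : Measure E}

theorem indepFun_rows [Finite κ] {X : ι → κ → Ω → E} (hX : ∀ j w, AEMeasurable (X j w) P)
    (hindep : iIndepFun (fun q : ι × κ => X q.1 q.2) P) {i j : ι} (hij : i ≠ j) :
    IndepFun (fun ω w => X i w ω) (fun ω w => X j w ω) P := by
  classical
  have := Fintype.ofFinite κ
  let row (i : ι) : Finset (ι × κ) := Finset.univ.image (Prod.mk i)
  have hmem (i : ι) (w : κ) : (i, w) ∈ row i := Finset.mem_image_of_mem _ (Finset.mem_univ w)
  have hdisj : Disjoint (row i) (row j) := by
    simpa [row, Finset.disjoint_left] using fun _ => hij.symm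
  exact (hindep.indepFun_finset₀ (row i) (row j) hdisj fun q => hX q.1 q.2).comp
    (φ := fun y w => y ⟨(i, w), hmem i w⟩) (ψ := fun y w => y ⟨(j, w), hmem j w⟩)
    (by fun_prop) (by fun_prop)

theorem ae_tendsto_sum_rows_div [Fintype κ] {X : ℕ → κ → Ω → E} (hX : ∀ j w, HasLaw (X j w) μ P)
    (hindep : iIndepFun (fun q : ℕ × κ => X q.1 q.2) P) {g : (κ → E) → ℝ}
    (hg : Integrable g (Measure.pi fun _ => μ)) :
    ∀ᵐ ω ∂P, Tendsto (fun n : ℕ => (∑ j ∈ Finset.range n, g fun w => X j w ω) / n) atTop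
      (𝓝 (∫ x, g x ∂Measure.pi fun _ => μ)) := by
  have hrow (j : ℕ) : HasLaw (fun ω w => X j w ω) (Measure.pi fun _ => μ) P :=
    (hindep.precomp (Prod.mk_right_injective j)).hasLaw_pi (hX j)
  have hgm (j : ℕ) : AEMeasurable g (P.map fun ω w => X j w ω) := by
    rw [(hrow j).map_eq]
    exact hg.aemeasurable
  rw [← (hrow 0).integral_comp hg.aestronglyMeasurable]
  refine strong_law_ae_real (fun j ω => g fun w => X j w ω) ?_ (fun i j hij => ?_) fun j => ?_
  · rw [← (hrow 0).map_eq] at hg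
    exact hg.comp_aemeasurable (hrow 0).aemeasurable
  · exact (indepFun_rows (fun j w => (hX j w).aemeasurable) hindep hij).comp₀
      (hrow i).aemeasurable (hrow j).aemeasurable (hgm i) (hgm j)
  · exact (IdentDistrib.mk (hrow j).aemeasurable (hrow 0).aemeasurable
      ((hrow j).map_eq.trans (hrow 0).map_eq.symm)).comp_of_aemeasurable (hgm j)

theorem ae_forall_of_hasLaw [Countable ι] {X : ι → Ω → E} (hX : ∀ a, HasLaw (X a) μ P)
    {p : E → Prop} (hp : ∀ᵐ x ∂μ, p x) : ∀ᵐ ω ∂P, ∀ a, p (X a ω) :=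
  ae_all_iff.2 fun a => ae_of_ae_map (hX a).aemeasurable ((hX a).map_eq ▸ hp)

end StrongLaw

section AlmostSure

variable {d : ℕ} {σ Ω : Type*} [MeasurableSpace Ω] {P : Measure Ω} [IsProbabilityMeasure P]
  {μ : Measure (EuclideanSpace ℝ (Fin d))} {X : ℕ → Ω → EuclideanSpace ℝ (Fin d)}
  {k : EuclideanSpace ℝ (Fin d) → ℝ} {D : σ → EuclideanSpace ℝ (Fin d) → ℝ} {ε : ℝ}

namespace CubeEnumeration

variable (E : CubeEnumeration d)

theorem injective_uncurry_indexOf {N : ℕ} :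
    Function.Injective fun q : ℕ × (Fin d → Fin N) => E.indexOf q.1 q.2 := by
  rintro ⟨i, w⟩ ⟨j, w'⟩ (h : E.indexOf i w = E.indexOf j w')
  obtain rfl : i = j := by rw [← E.cubeOf_indexOf i w, ← E.cubeOf_indexOf j w', h]
  rw [E.indexOf_injective i h]

theorem ae_tendsto_sum_cubes_div (hX : ∀ a, HasLaw (X a) μ P) (hindep : iIndepFun X P)
    (hμ : ∀ᵐ x ∂μ, ∀ l, |x l| ≤ 1) (h : AdmissibleKernels k D) (e : MatExpr σ)
    (hε : ε ∈ Ico (0 : ℝ) (1 / 2)) (N : ℕ) :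
    ∀ᵐ ω ∂P, Tendsto (fun n : ℕ => (∑ j ∈ Finset.range n, exprTrace e k D
        (perturbedPoint (cubeSite d N) (fun w => X (E.indexOf j w) ω) ε)) / n) atTop
      (𝓝 (∫ x, exprTrace e k D (perturbedPoint (cubeSite d N) x ε) ∂Measure.pi fun _ => μ)) := by
  have : IsProbabilityMeasure μ := (hX 0).isProbabilityMeasure_iff.1 ‹_›
  have hsite : Function.Injective (cubeSite d N) := fun w w' hw =>
    funext fun l => Fin.ext (Int.ofNat_inj.1 (congrFun hw l))
  exact ae_tendsto_sum_rows_div (X := fun j w => X (E.indexOf j w))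
    (g := fun x => exprTrace e k D (perturbedPoint (cubeSite d N) x ε))
    (fun j w => hX (E.indexOf j w)) (hindep.precomp E.injective_uncurry_indexOf)
    (h.integrable_exprTrace e hsite hε hμ)

theorem exists_ae_tendsto_exprTrace (hd : 0 < d) (hX : ∀ a, HasLaw (X a) μ P)
    (hindep : iIndepFun X P) (hμ : ∀ᵐ x ∂μ, ∀ l, |x l| ≤ 1) (h : AdmissibleKernels k D)
    (e : MatExpr σ) (hε : ε ∈ Ico (0 : ℝ) (1 / 2)) :
    ∃ L : ℝ, ∀ᵐ ω ∂P, Tendsto (fun n : ℕ => 1 / (n : ℝ) *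
      exprTrace e k D fun a : Fin n => perturbedPoint E.site (X · ω) ε a) atTop (𝓝 L) := by
  obtain ⟨C, -, hC⟩ := E.exists_abs_exprTrace_sub_sum_cubes_le h e hε
  have hloss : Tendsto (fun N => C * cubeLoss d N) atTop (𝓝 0) := by
    simpa using (tendsto_cubeLoss d).const_mul C
  let b (N : ℕ) : ℝ :=
    (∫ x, exprTrace e k D (perturbedPoint (cubeSite d N) x ε) ∂Measure.pi fun _ => μ) / (N : ℝ) ^ d
  have hnear : ∀ᵐ ω ∂P, ∀ᶠ N in atTop, ∀ η > 0, ∀ᶠ n : ℕ in atTop,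
      dist (1 / (n : ℝ) * exprTrace e k D fun a : Fin n => perturbedPoint E.site (X · ω) ε a) (b N)
        ≤ C * cubeLoss d N + η := by
    filter_upwards [ae_forall_of_hasLaw hX hμ, ae_all_iff.2 fun N =>
      E.ae_tendsto_sum_cubes_div hX hindep hμ h e hε N] with ω hω hcubes
    filter_upwards [eventually_gt_atTop 0] with N hN η hη
    exact eventually_dist_average_le hd hN (fun m n hn => hC (X · ω) hω N m n hN hn) (hcubes N) hη
  obtain ⟨ω₀, hω₀⟩ := hnear.exists
  obtain ⟨L, hL⟩ := cauchySeq_tendsto_of_complete (cauchySeq_of_eventually_dist_le hloss hω₀)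
  exact ⟨L, hnear.mono fun ω hω => tendsto_of_eventually_dist_le hloss hω hL⟩

end CubeEnumeration

end AlmostSure

/-! ### The criteria of the paper -/

section GridMatrices

variable {p d : ℕ}

namespace SmoothCovarianceCondition

variable {Θ : Set (Fin p → ℝ)} {K : (Fin p → ℝ) → EuclideanSpace ℝ (Fin d) → ℝ}
  (hK : SmoothCovarianceCondition Θ K) {θ : Fin p → ℝ} (hθ : θ ∈ Θ)

include hK hθ

theorem regularKernel : RegularKernel (K θ) where
  differentiable := hK.differentiable_space θ hθ
  bound := by
    obtain ⟨C, hC⟩ := hK.bound 0 (by norm_num) Fin.elim0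
    exact ⟨C, fun t => by simpa [thetaPartial] using hC θ hθ t⟩
  bound_deriv T hT k hk J := hK.bound_space T hT θ hθ k hk J

theorem regularKernel_thetaPartial₁ (i : Fin p) : RegularKernel (thetaPartial₁ Θ K i θ) where
  differentiable := hK.differentiable_space_theta θ hθ i
  bound := by
    obtain ⟨C, hC⟩ := hK.bound 1 (by norm_num) fun _ => i
    exact ⟨C, fun t => hC θ hθ t⟩
  bound_deriv T hT k hk J := hK.bound_space_theta T hT θ hθ i k hk J

theorem admissibleKernels : AdmissibleKernels (K θ) fun i => thetaPartial₁ Θ K i θ where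
  regular := hK.regularKernel hθ
  regular_var := hK.regularKernel_thetaPartial₁ hθ
  coercive _ hβ := hK.toCovarianceCondition.exists_coercive hθ hβ

end SmoothCovarianceCondition

theorem IsPerturbationLaw.ae_abs_le_one {μ : Measure (EuclideanSpace ℝ (Fin d))}
    (hμ : IsPerturbationLaw μ) : ∀ᵐ x ∂μ, ∀ l, |x l| ≤ 1 :=
  mem_of_superset μ.support_mem_ae hμ.support_subset

theorem obsPoint_eq_const_add_perturbedPoint {v : ℕ → Fin d → ℕ} (hv : IsGridEnumeration v)
    (hd : 0 < d) (x : ℕ → EuclideanSpace ℝ (Fin d)) (ε : ℝ) (a : ℕ) :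
    obsPoint v x ε a = WithLp.toLp 2 (fun _ => 1) +
      perturbedPoint (CubeEnumeration.ofIsGridEnumeration hv hd).site x ε a := by
  ext l
  have hcast : ((v a l - 1 : ℕ) : ℝ) = v a l - 1 := by
    rw [Nat.cast_sub (hv.one_le hd a l), Nat.cast_one]
  simp [obsPoint, perturbedPoint, CubeEnumeration.site, CubeEnumeration.ofIsGridEnumeration, hcast]
  ring

variable {σ Ω : Type*} {k : EuclideanSpace ℝ (Fin d) → ℝ} {D : σ → EuclideanSpace ℝ (Fin d) → ℝ}

theorem trace_eval_gridMatrix {v : ℕ → Fin d → ℕ} (hv : IsGridEnumeration v) (hd : 0 < d)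
    (e : MatExpr σ) (x : ℕ → EuclideanSpace ℝ (Fin d)) (ε : ℝ) (n : ℕ) :
    (e.eval (gridMatrix k v x ε n) fun i => gridMatrix (D i) v x ε n).trace = exprTrace e k D
      fun a : Fin n => perturbedPoint (CubeEnumeration.ofIsGridEnumeration hv hd).site x ε a := by
  rw [← exprTrace_const_add e k D _ (WithLp.toLp 2 fun _ => 1)]
  simp only [← obsPoint_eq_const_add_perturbedPoint]
  rfl

variable [MeasurableSpace Ω] {P : Measure Ω} [IsProbabilityMeasure P]
  {μ : Measure (EuclideanSpace ℝ (Fin d))} {X : ℕ → Ω → EuclideanSpace ℝ (Fin d)}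

theorem CubeEnumeration.secondDerivativeExchange_exprTrace (E : CubeEnumeration d)
    (hX : ∀ a, HasLaw (X a) μ P) (hμ : ∀ᵐ x ∂μ, ∀ l, |x l| ≤ 1) (h : AdmissibleKernels k D)
    (e : MatExpr σ) {S : ℝ → ℝ} (hS : IsAlmostSureLimit P
      (fun ω n ε => exprTrace e k D fun a : Fin n => perturbedPoint E.site (X · ω) ε a) S) :
    SecondDerivativeExchange P
      (fun ω n ε => exprTrace e k D fun a : Fin n => perturbedPoint E.site (X · ω) ε a) S := by
  have hmeas (n : ℕ) (ε : ℝ) : AEStronglyMeasurable (fun ω => 1 / (n : ℝ) * exprTrace e k D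
      fun a : Fin n => perturbedPoint E.site (X · ω) ε a) P :=
    (((h.measurable_exprTrace e (fun a : Fin n => E.site a) ε).comp_aemeasurable
      (aemeasurable_pi_lambda _ fun a : Fin n => (hX a).aemeasurable)).const_mul _
      ).aestronglyMeasurable
  have hjet (β : ℝ) (hβ : β < 1 / 2) : UniformlyBoundedJetOn (E := fun _ => ℝ) (Ico 0 β) 3
      fun (τ : {ω | ∀ a l, |X a ω l| ≤ 1} × ℕ) ε => 1 / (τ.2 : ℝ) * exprTrace e k D
        fun a : Fin τ.2 => perturbedPoint E.site (X · τ.1) ε a := by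
    have hcard (x hx n) : Fintype.card (E.configuration x hx n).index = n := Fintype.card_fin n
    have hconf := (h.uniformlyBoundedJetOn_exprTrace e hβ).reindex
      fun τ : {ω | ∀ a l, |X a ω l| ≤ 1} × ℕ => E.configuration (X · τ.1) τ.1.2 τ.2
    simp only [hcard] at hconf
    exact hconf
  have hexchange := secondDerivativeExchange_of_uniformlyBoundedJetOn (ae_forall_of_hasLaw hX hμ)
    (fun n ε _ => hmeas n ε) hjet hS
  convert hexchange using 4 with ω n ε
  rcases eq_or_ne n 0 with rfl | hn
  · simp [exprTrace]
  · field_simp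

theorem exists_isAlmostSureLimit_and_secondDerivativeExchange (hd : 0 < d) {v : ℕ → Fin d → ℕ}
    (hv : IsGridEnumeration v) (hX : ∀ a, HasLaw (X a) μ P) (hindep : iIndepFun X P)
    (hμ : ∀ᵐ x ∂μ, ∀ l, |x l| ≤ 1) (h : AdmissibleKernels k D) (e : MatExpr σ) :
    ∃ S : ℝ → ℝ,
      IsAlmostSureLimit P (fun ω n ε => (e.eval (gridMatrix k v (X · ω) ε n)
        fun i => gridMatrix (D i) v (X · ω) ε n).trace) S ∧
      SecondDerivativeExchange P (fun ω n ε => (e.eval (gridMatrix k v (X · ω) ε n)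
        fun i => gridMatrix (D i) v (X · ω) ε n).trace) S := by
  simp only [trace_eval_gridMatrix hv hd]
  let E := CubeEnumeration.ofIsGridEnumeration hv hd
  choose! S hS using fun ε (hε : ε ∈ Ico (0 : ℝ) (1 / 2)) =>
    E.exists_ae_tendsto_exprTrace hd hX hindep hμ h e hε
  exact ⟨S, hS, E.secondDerivativeExchange_exprTrace hX hμ h e hS⟩

end GridMatrices

end

end PerturbedGrid

open PerturbedGrid in
theorem mainTheorem8_general {d : ℕ} (hd : 0 < d) {σ : Type*}
    {k : EuclideanSpace ℝ (Fin d) → ℝ} {D : σ → EuclideanSpace ℝ (Fin d) → ℝ}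
    (h : AdmissibleKernels k D) {v : ℕ → Fin d → ℕ} (hv : IsGridEnumeration v)
    {μ : Measure (EuclideanSpace ℝ (Fin d))} (hμ : ∀ᵐ x ∂μ, ∀ l, |x l| ≤ 1)
    {Ω : Type*} [MeasurableSpace Ω] {P : Measure Ω} [IsProbabilityMeasure P]
    {X : ℕ → Ω → EuclideanSpace ℝ (Fin d)} (hX : ∀ a, HasLaw (X a) μ P)
    (hindep : iIndepFun X P) :
    ∃ S_ML S_CV1 S_CV2 : ℝ → Matrix σ σ ℝ, ∀ i j : σ,
      let tr (M : ∀ {n : ℕ}, Matrix (Fin n) (Fin n) ℝ → Matrix (Fin n) (Fin n) ℝ →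
          Matrix (Fin n) (Fin n) ℝ → Matrix (Fin n) (Fin n) ℝ) (ω : Ω) (n : ℕ) (ε : ℝ) : ℝ :=
        (M (gridMatrix k v (X · ω) ε n) (gridMatrix (D i) v (X · ω) ε n)
          (gridMatrix (D j) v (X · ω) ε n)).trace
      (IsAlmostSureLimit P (tr matML) (S_ML · i j) ∧
        SecondDerivativeExchange P (tr matML) (S_ML · i j)) ∧
      (IsAlmostSureLimit P (tr matCV1) (S_CV1 · i j) ∧
        SecondDerivativeExchange P (tr matCV1) (S_CV1 · i j)) ∧
      (IsAlmostSureLimit P (tr matCV2) (S_CV2 · i j) ∧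
        SecondDerivativeExchange P (tr matCV2) (S_CV2 · i j)) := by
  have hlimit (e : MatExpr σ) :=
    exists_isAlmostSureLimit_and_secondDerivativeExchange hd hv hX hindep hμ h e
  choose S₁ hS₁ using fun i j => hlimit (.ml i j)
  choose S₂ hS₂ using fun i j => hlimit (.cv1 i j)
  choose S₃ hS₃ using fun i j => hlimit (.cv2 i j)
  simp only [MatExpr.eval_ml] at hS₁
  simp only [MatExpr.eval_cv1] at hS₂
  simp only [MatExpr.eval_cv2] at hS₃
  exact ⟨fun ε => Matrix.of fun i j => S₁ i j ε, fun ε => Matrix.of fun i j => S₂ i j ε,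
    fun ε => Matrix.of fun i j => S₃ i j ε, fun i j => ⟨hS₁ i j, hS₂ i j, hS₃ i j⟩⟩

theorem mainTheorem8 {p d : ℕ} (hd : 0 < d)
    -- the parametric model and the true parameter, in the interior of the parameter box
    (θinf θsup : ℝ) (θ₀ : Fin p → ℝ) (hθ₀ : ∀ i, θinf < θ₀ i ∧ θ₀ i < θsup)
    (K : (Fin p → ℝ) → EuclideanSpace ℝ (Fin d) → ℝ)
    (hK : PerturbedGrid.SmoothCovarianceCondition (PerturbedGrid.paramBox p θinf θsup) K)
    -- the grid and its random perturbation
    (v : ℕ → Fin d → ℕ) (hv : PerturbedGrid.IsGridEnumeration v)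
    (μ : MeasureTheory.Measure (EuclideanSpace ℝ (Fin d)))
    (hμ : PerturbedGrid.IsPerturbationLaw μ)
    {Ω : Type*} [MeasurableSpace Ω] (P : MeasureTheory.Measure Ω)
    [MeasureTheory.IsProbabilityMeasure P]
    (X : ℕ → Ω → EuclideanSpace ℝ (Fin d))
    (hX_law : ∀ a, ProbabilityTheory.HasLaw (X a) μ P)
    (hX_indep : ProbabilityTheory.iIndepFun X P) :
    ∃ S_ML S_CV1 S_CV2 : ℝ → Matrix (Fin p) (Fin p) ℝ, ∀ i j : Fin p,
      let trML : Ω → ℕ → ℝ → ℝ := fun ω => PerturbedGrid.traceAt PerturbedGrid.matML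
        (PerturbedGrid.paramBox p θinf θsup) K θ₀ v i j (fun a => X a ω)
      let trCV1 : Ω → ℕ → ℝ → ℝ := fun ω => PerturbedGrid.traceAt PerturbedGrid.matCV1
        (PerturbedGrid.paramBox p θinf θsup) K θ₀ v i j (fun a => X a ω)
      let trCV2 : Ω → ℕ → ℝ → ℝ := fun ω => PerturbedGrid.traceAt PerturbedGrid.matCV2
        (PerturbedGrid.paramBox p θinf θsup) K θ₀ v i j (fun a => X a ω)
      (PerturbedGrid.IsAlmostSureLimit P trML (fun ε => S_ML ε i j) ∧
        PerturbedGrid.SecondDerivativeExchange P trML (fun ε => S_ML ε i j)) ∧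
      (PerturbedGrid.IsAlmostSureLimit P trCV1 (fun ε => S_CV1 ε i j) ∧
        PerturbedGrid.SecondDerivativeExchange P trCV1 (fun ε => S_CV1 ε i j)) ∧
      (PerturbedGrid.IsAlmostSureLimit P trCV2 (fun ε => S_CV2 ε i j) ∧
        PerturbedGrid.SecondDerivativeExchange P trCV2 (fun ε => S_CV2 ε i j)) :=
  mainTheorem8_general hd (hK.admissibleKernels fun i => ⟨(hθ₀ i).1.le, (hθ₀ i).2.le⟩) hv
    hμ.ae_abs_le_one hX_law hX_indep
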